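/- **Theorem (Operational Soundness, sharing calculus into session $\pi$).** *The sharing calculus.* Terms $M,N$, bags $B$ (finite multisets of terms; $\mathtt 1$ is empty, $|B|$ is the size) and expressions $\mathbb N$ (non-empty finite formal sums of terms, taken up to associativity and commutativity) are given by $$M ::= x \mid \lambda x.(M[\tilde x\leftarrow x]) \mid M\,B \mid M\langle N/x\rangle \mid \mathtt{fail}^{\tilde x}\mid M[\tilde x\leftarrow x]\mid (M[\tilde x\leftarrow x])\langle\!\langle B/x\rangle\!\rangle ,$$ up to renaming of bound variables ($\tilde x=x_1,\dots,x_k$, $k\ge 0$, distinct, is bound in $M$ in $M[\tilde x\leftarrow x]$; $x$ is bound in $M$ in $M\langle N/x\rangle$, and in $M[\tilde x\leftarrow x]$ in the abstraction and in the explicit substitution; in $\mathtt{fail}^{\tilde x}$, $\tilde x$ is a set). Each variable occurs at most once in a term; shared variables occur in $M$; shared variables and the variable of a linear substitution are not sharing variables. The head of a term is: $\mathrm{head}(x)=x$, $\mathrm{head}(M\,B)=\mathrm{head}(M\langle N/x\rangle)=\mathrm{head}(M)$; $\mathrm{head}(M[\tilde x\leftarrow x])$ is $x$ if $\mathrm{head}(M)\in\tilde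 x$ and $\mathrm{head}(M)$ otherwise; $\mathrm{head}((M[\tilde x\leftarrow x])\langle\!\langle B/x\rangle\!\rangle)$ is $\mathrm{head}(M[\tilde x\leftarrow x])$ if $|\tilde x|=|B|$ and $\mathtt{fail}^\emptyset$ otherwise; abstractions and failures are their own head. If $\mathrm{head}(M)=x$, then $M\{\!|N/x|\!\}$ replaces the head occurrence of $x$ by $N$. Sums $\sum_{PER(B)}$ range over all permutations of $B$. Reduction $\longrightarrow$ is generated by - $(\lambda x.M[\tilde x\leftarrow x])B\longrightarrow M[\tilde x\leftarrow x]\langle\!\langle B/x\rangle\!\rangle$; - $M[x_1,\dots,x_k\leftarrow x]\langle\!\langle B/x\rangle\!\rangle\longrightarrow\sum_{B_i\in PER(B)}M\langle B_i(1)/x_1\rangle\cdots\langle B_i(k)/x_k\rangle$ if $k=|B|\ge1$ and $M$ is not a failure term; - $M\langle N/x\rangle\longrightarrow M\{\!|N/x|\!\}$ if $\mathrm{head}(M)=x$; - $M[x_1,\dots,x_k\leftarrow x]\langle\!\langle B/x\rangle\!\rangle\longrightarrow\sum_{PER(B)}\mathtt{fail}^{(fv(M)\setminus\{x_1,\dots,x_k\})\cup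 fv(B)}$ if $k\ne|B|$; - $\mathtt{fail}^{\tilde x}B\longrightarrow\sum_{PER(B)}\mathtt{fail}^{\tilde x\cup fv(B)}$; - $\mathtt{fail}^{\tilde x\uplus\tilde y}[\tilde x\leftarrow x]\langle\!\langle B/x\rangle\!\rangle\longrightarrow\sum_{PER(B)}\mathtt{fail}^{\tilde y\cup fv(B)}$ if $|B|+|\tilde x|\neq0$; - $\mathtt{fail}^{\tilde y\uplus\{x\}}\langle N/x\rangle\longrightarrow\mathtt{fail}^{\tilde y\cup fv(N)}$; - closure under the term contexts $C=[\cdot]B,\ [\cdot]\langle N/x\rangle,\ [\cdot][\tilde x\leftarrow x],\ [\cdot][\leftarrow x]\langle\!\langle\mathtt1/x\rangle\!\rangle$ (if $M\longrightarrow\sum_iM_i$ then $C[M]\longrightarrow\sum_iC[M_i]$) and under sums. The precongruence $\succeq_\lambda$ is the least reflexive, transitive relation closed under the same contexts and sums with $M[\leftarrow x]\langle\!\langle\mathtt1/x\rangle\!\rangle\succeq_\lambda M$; $(M\,B)\langle N/x\rangle\equiv_\lambda(M\langle N/x\rangle)B$ ($x\notin fv(B)$); $M\langle N_2/y\rangle\langle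 N_1/x\rangle\equiv_\lambda M\langle N_1/x\rangle\langle N_2/y\rangle$ ($x\notin fv(N_2)$, $y\notin fv(N_1)$); $(M\,A)[\tilde x\leftarrow x]\langle\!\langle B/x\rangle\!\rangle\equiv_\lambda(M[\tilde x\leftarrow x]\langle\!\langle B/x\rangle\!\rangle)A$ and $M[\tilde y\leftarrow y]\langle\!\langle A/y\rangle\!\rangle[\tilde x\leftarrow x]\langle\!\langle B/x\rangle\!\rangle\succeq_\lambda(M[\tilde x\leftarrow x]\langle\!\langle B/x\rangle\!\rangle)[\tilde y\leftarrow y]\langle\!\langle A/y\rangle\!\rangle$ (both with $\tilde x\cap fv(A)=\emptyset$, the latter also with $\tilde y\cap fv(B)=\emptyset$), where $\equiv_\lambda$ means $\succeq_\lambda$ in both directions. Write $\mathbb N\longrightarrow_{\succeq_\lambda}\mathbb M$ if $\mathbb N\succeq_\lambda\mathbb N_1\longrightarrow\mathbb N_2\succeq_\lambda\mathbb M$ for some $\mathbb N_1,\mathbb N_2$, and $\mathbb N\longrightarrow^*_{\succeq_\lambda}\mathbb N'$ if $\mathbb N'$ is reached from $\mathbb N$ by $i\ge0$ steps $\longrightarrow_{\succeq_\lambda}$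 followed by $\succeq_\lambda$ (so that for $i=0$ it means $\mathbb N\succeq_\lambda\mathbb N'$). *Well-formedness.* Strict types are $\sigma,\tau::=\mathbf{unit}\mid\pi\to\tau$ with $\pi$ a finite multiset of strict types; $\sigma^k$ is $k$ copies of $\sigma$, $\omega=\sigma^0$. Contexts assign strict or multiset types to finitely many variables; "$\Gamma,\Delta$" has disjoint domains. An expression is well-formed if $\Gamma\models\mathbb N:\tau$ is derivable, for some $\Gamma,\tau$, by: $x:\sigma\models x:\sigma$; $\emptyset\models\mathtt1:\omega$; $\Gamma\models\mathtt{fail}^{\tilde x}:\tau$ if $\mathrm{dom}\,\Gamma=\tilde x$; from $\Gamma\models M:\tau$ infer $\Gamma,x:\omega\models M[\leftarrow x]:\tau$; from $\Gamma,x_1:\sigma,\dots,x_k:\sigma\models M:\tau$, $k\neq0$, infer $\Gamma,x:\sigma^k\models M[x_1,\dots,x_k\leftarrow x]:\tau$; from $\Gamma,x:\sigma^k\models M[\tilde x\leftarrow x]:\tau$ infer $\Gamma\models\lambda x.(M[\tilde x\leftarrow x]):\sigma^k\to\tau$ and, if $\Delta\models B:\sigma^j$, $\Gamma,\Delta\models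 M[\tilde x\leftarrow x]\langle\!\langle B/x\rangle\!\rangle:\tau$; from $\Gamma\models M:\sigma^j\to\tau$ and $\Delta\models B:\sigma^k$ infer $\Gamma,\Delta\models M\,B:\tau$; from $\Gamma\models M:\sigma$ and $\Delta\models B:\sigma^k$ infer that the bag $\{M\}\cdot B$ has type $\sigma^{k+1}$ in $\Gamma,\Delta$; from $\Gamma,x:\sigma\models M:\tau$ and $\Delta\models N:\sigma$ infer $\Gamma,\Delta\models M\langle N/x\rangle:\tau$; a sum has type $\tau$ in $\Gamma$ if all its summands do. (Adding the usual rules of the fail-free system, in which the sizes in the rules for application and substitution must agree, derives nothing more.) An expression is closed if it has no free variables. *Processes* are $P::=\mathbf0\mid\bar x(y).P\mid x(y).P\mid P|Q\mid(\nu x)P\mid[x\leftrightarrow y]\mid x.\overline{\mathtt{close}}\mid x.\mathtt{close};P\mid x.\overline{\mathtt{some}};P\mid x.\overline{\mathtt{none}}\mid x.\mathtt{some}_{(w_1,\dots,w_n)};P\mid P\oplus Q$ ($y$ bound in $\bar x(y).P$ and $x(y).P$, $x$ bound in $(\nu x)P$; the order of the $w_i$ is immaterial). Structural congruence $\equiv$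 is the least congruence that contains $\alpha$-equivalence and satisfies $P|\mathbf0\equiv P$; commutativity and associativity of $|$ and of $\oplus$; $[x\leftrightarrow y]\equiv[y\leftrightarrow x]$; $((\nu x)P)|Q\equiv(\nu x)(P|Q)$ for $x\notin fn(Q)$; $(\nu x)(P|(Q\oplus R))\equiv(\nu x)(P|Q)\oplus(\nu x)(P|R)$; $\mathbf0\oplus\mathbf0\equiv\mathbf0$; $(\nu x)\mathbf0\equiv\mathbf0$; $(\nu x)(\nu y)P\equiv(\nu y)(\nu x)P$. Reduction is generated by $\bar x(y).Q|x(y).P\longrightarrow(\nu y)(Q|P)$; $(\nu x)([x\leftrightarrow y]|P)\longrightarrow P\{y/x\}$ ($x\ne y$); $x.\overline{\mathtt{close}}|x.\mathtt{close};P\longrightarrow P$; $x.\overline{\mathtt{some}};P|x.\mathtt{some}_{\tilde w};Q\longrightarrow P|Q$; $x.\overline{\mathtt{none}}|x.\mathtt{some}_{(w_1,\dots,w_n)};Q\longrightarrow w_1.\overline{\mathtt{none}}|\cdots|w_n.\overline{\mathtt{none}}$; closure under $\equiv$, parallel composition, restriction and $\oplus$. *Translation* (auxiliary names fresh): - $[\![x]\!]_u=x.\overline{\mathtt{some}};[x\leftrightarrow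 u]$ and $[\![\lambda x.M[\tilde x\leftarrow x]]\!]_u=u.\overline{\mathtt{some}};u(x).[\![M[\tilde x\leftarrow x]]\!]_u$; - $[\![M\,B]\!]_u=\bigoplus_{B_i\in PER(B)}(\nu v)([\![M]\!]_v\,|\,v.\mathtt{some}_{u,fv(B)};\bar v(x).([v\leftrightarrow u]\,|\,[\![B_i]\!]_x))$; - $[\![M[\tilde x\leftarrow x]\langle\!\langle B/x\rangle\!\rangle]\!]_u=\bigoplus_{B_i\in PER(B)}(\nu x)([\![M[\tilde x\leftarrow x]]\!]_u\,|\,[\![B_i]\!]_x)$; - $[\![M\langle N/x\rangle]\!]_u=(\nu x)([\![M]\!]_u\,|\,x.\mathtt{some}_{fv(N)};[\![N]\!]_x)$; - $[\![M[x_1,\dots,x_k\leftarrow x]]\!]_u=S_1$, where for $1\le i\le k$ $S_i=x.\overline{\mathtt{some}};\bar x(y_i).(y_i.\mathtt{some}_\emptyset;y_i.\mathtt{close};\mathbf0\,|\,x.\overline{\mathtt{some}};x.\mathtt{some}_{u,fv(M)\setminus\{x_i,\dots,x_k\}};x(x_i).S_{i+1})$ and $S_{k+1}=x.\overline{\mathtt{some}};\bar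 x(y).(y.\mathtt{some}_{u,fv(M)};y.\mathtt{close};[\![M]\!]_u\,|\,x.\overline{\mathtt{none}})$; - for a non-empty bag $B'=\{M\}\cdot B$ (in a given order), $[\![B']\!]_x=x.\mathtt{some}_{fv(B')};x(y).x.\mathtt{some}_{y,fv(B')};x.\overline{\mathtt{some}};\bar x(z).(z.\mathtt{some}_{fv(M)};[\![M]\!]_z\,|\,[\![B]\!]_x\,|\,y.\overline{\mathtt{none}})$; - $[\![\mathtt1]\!]_x=x.\mathtt{some}_\emptyset;x(y).(y.\overline{\mathtt{some}};y.\overline{\mathtt{close}}\,|\,x.\mathtt{some}_\emptyset;x.\overline{\mathtt{none}})$; - $[\![\mathtt{fail}^{x_1,\dots,x_k}]\!]_u=u.\overline{\mathtt{none}}\,|\,x_1.\overline{\mathtt{none}}\,|\cdots|\,x_k.\overline{\mathtt{none}}$; - $[\![\mathbb M+\mathbb N]\!]_u=[\![\mathbb M]\!]_u\oplus[\![\mathbb N]\!]_u$. **Statement.** Let $\mathbb N$ be a well-formed, closed expression of the sharing calculus and $u$ a name. If $[\![\mathbb N]\!]_u\longrightarrow^*Q$, then there exist a process $Q'$ and an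 expression $\mathbb N'$ such that $Q\longrightarrow^*Q'$, $\mathbb N\longrightarrow^*_{\succeq_\lambda}\mathbb N'$ and $[\![\mathbb N']\!]_u\equiv Q'$. -/

import Mathlib

open Relation

/-!
The resource lambda-calculus with sharing and failure, the session pi-calculus with
non-determinism and failure, and the translation of the former into the latter.

Both calculi are taken up to renaming of bound variables and names, which is achieved with
de Bruijn indices: a variable (name) is a natural number, a binder of `k` variables makes the
indices `0, …, k-1` refer to the variables it binds and index `i + k` refer to the variable
`i` of the surrounding scope.  Side conditions such as `x ∉ fv B` are expressed by shifting.
-/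

namespace ShLam

/-! ### Terms, bags and expressions -/

/-- Terms of the sharing calculus.  Bags `⟅N₁⟆ · … · ⟅Nₖ⟆` are lists of terms (the empty bag
`1` is `[]`); no definition below depends on the order in which the list is presented, since
sums over a bag range over all its permutations.

In `lam`, `share`, `esub`, the `k` shared variables `x₁, …, xₖ` are the indices `0, …, k-1`
of `M`, in this order.  The grammar has `λx.(M[x̃ ← x])` and `(M[x̃ ← x])⟪B / x⟫` as single
productions, and there the variable `x`, which may only occur once, is used by the displayed
sharing construct and hence not in `M`; it needs no index. -/
inductive Term : Type
  /-- a variable -/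
  | var (x : ℕ) : Term
  /-- `λx.(M[x₁,…,xₖ ← x])` -/
  | lam (k : ℕ) (M : Term) : Term
  /-- `M B` -/
  | app (M : Term) (B : List Term) : Term
  /-- explicit linear substitution `M ⟨N / x⟩`; `x` is the index `0` of `M` -/
  | lsub (M N : Term) : Term
  /-- `fail^{x̃}` with a finite set `x̃` of variables -/
  | fail (X : Finset ℕ) : Term
  /-- the sharing construct `M[x₁,…,xₖ ← x]` with (free) sharing variable `x` -/
  | share (k : ℕ) (M : Term) (x : ℕ) : Term
  /-- explicit substitution `(M[x₁,…,xₖ ← x])⟪B / x⟫` -/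
  | esub (k : ℕ) (M : Term) (B : List Term) : Term

abbrev Bag : Type := List Term

/-- Expressions: finite formal sums of terms, up to associativity and commutativity.  (The
sums of the calculus are non-empty; this is part of well-formedness.) -/
abbrev Expr : Type := Multiset Term

/-- Action of a renaming below a binder of `k` variables. -/
def lift (k : ℕ) (f : ℕ → ℕ) (n : ℕ) : ℕ := if n < k then n else f (n - k) + k

/-- The set of those variables that remain, seen from outside, when a binder of `k` variables
is closed: remove the `k` bound variables. -/
def outer (k : ℕ) (X : Finset ℕ) : Finset ℕ := (X.filter (k ≤ ·)).image (· - k)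

mutual
  def Term.rename (f : ℕ → ℕ) : Term → Term
    | .var x => .var (f x)
    | .lam k M => .lam k (M.rename (lift k f))
    | .app M B => .app (M.rename f) (Bag.rename f B)
    | .lsub M N => .lsub (M.rename (lift 1 f)) (N.rename f)
    | .fail X => .fail (X.image f)
    | .share k M x => .share k (M.rename (lift k f)) (f x)
    | .esub k M B => .esub k (M.rename (lift k f)) (Bag.rename f B)
  def Bag.rename (f : ℕ → ℕ) : List Term → List Term
    | [] => []
    | M :: B => M.rename f :: Bag.rename f B
end

/-- Place a term below `k` further binders. -/
def Term.shift (k : ℕ) (M : Term) : Term := M.rename (· + k)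

/-- Place a bag below `k` further binders. -/
def Bag.shift (k : ℕ) (B : Bag) : Bag := Bag.rename (· + k) B

mutual
  /-- Free variables of a term. -/
  def Term.fv : Term → Finset ℕ
    | .var x => {x}
    | .lam k M => outer k M.fv
    | .app M B => M.fv ∪ Bag.fv B
    | .lsub M N => outer 1 M.fv ∪ N.fv
    | .fail X => X
    | .share k M x => outer k M.fv ∪ {x}
    | .esub k M B => outer k M.fv ∪ Bag.fv B
  /-- Free variables of a bag. -/
  def Bag.fv : List Term → Finset ℕ
    | [] => ∅
    | M :: B => M.fv ∪ Bag.fv B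
end

/-- An expression is closed if none of its summands has a free variable. -/
def Expr.Closed (E : Expr) : Prop := ∀ M ∈ E, M.fv = ∅

/-! ### Head and linear head substitution -/

/-- Going out of a binder of `k` variables: a variable bound there is no longer visible. -/
def outVar (k i : ℕ) : Option ℕ := if i < k then none else some (i - k)

/-- `headVar M = some x` iff the head of `M` is the variable `x` (free in `M`); it is `none`
if the head of `M` is an abstraction, a failure, or a variable bound in `M`. -/
def Term.headVar : Term → Option ℕ
  | .var x => some x
  | .lam _ _ => none
  | .app M _ => M.headVar
  | .lsub M _ => M.headVar.bind (outVar 1)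
  | .fail _ => none
  | .share k M x => M.headVar.map (fun i => if i < k then x else i - k)
  | .esub k M B => if k = B.length then M.headVar.bind (outVar k) else none

/-- Linear head substitution `M ⦃N / x⦄`, of interest when the head of `M` is `x`. -/
def Term.headSubst : Term → ℕ → Term → Term
  | .var y, x, N => if y = x then N else .var y
  | .app M B, x, N => .app (M.headSubst x N) B
  | .lsub M L, x, N => .lsub (M.headSubst (x + 1) (N.shift 1)) L
  | .esub k M B, x, N => .esub k (M.headSubst (x + k) (N.shift k)) B
  | .share k M y, x, N => .share k (M.headSubst (x + k) (N.shift k)) y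
  | .lam k M, _, _ => .lam k M
  | .fail X, _, _ => .fail X

/-- `M ⟨N₁ / x₁⟩ ⋯ ⟨Nₖ / xₖ⟩`, where `xᵢ` is the index `i - 1` of `M` and the `Nᵢ` live outside
of the scope of the `xᵢ`. -/
def Term.lsubs (M : Term) : Bag → Term
  | [] => M
  | N :: L => (Term.lsub M (N.shift L.length)).lsubs L

/-! ### Reduction -/

/-- `∑_{PER(B)} M`: one copy of `M` for each permutation of `B`. -/
def permConst (B : Bag) (M : Term) : Expr := ((B.permutations.map (fun _ => M) : List Term) : Expr)

/-- Reduction of a term to an expression. -/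
inductive TRed : Term → Expr → Prop
  | beta (k : ℕ) (M : Term) (B : Bag) :
      TRed (.app (.lam k M) B) {Term.esub k M B}
  | exSub (k : ℕ) (M : Term) (B : Bag) (hk : 1 ≤ k) (hB : B.length = k)
      (hM : ∀ X, M ≠ .fail X) :
      TRed (.esub k M B) ((B.permutations.map M.lsubs : List Term) : Expr)
  /-- After the substitution the variable `x` (index `0`), which occurs exactly once, is gone
  and the remaining indices are lowered. -/
  | linFetch (M N : Term) (h : M.headVar = some 0) :
      TRed (.lsub M N) {(M.headSubst 0 (N.shift 1)).rename Nat.pred}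
  | fail (k : ℕ) (M : Term) (B : Bag) (h : k ≠ B.length) :
      TRed (.esub k M B) (permConst B (.fail (outer k M.fv ∪ Bag.fv B)))
  | cons₁ (X : Finset ℕ) (B : Bag) :
      TRed (.app (.fail X) B) (permConst B (.fail (X ∪ Bag.fv B)))
  | cons₂ (k : ℕ) (X : Finset ℕ) (B : Bag) (hX : Finset.range k ⊆ X)
      (h : B.length + k ≠ 0) :
      TRed (.esub k (.fail X) B) (permConst B (.fail (outer k X ∪ Bag.fv B)))
  | cons₃ (X : Finset ℕ) (N : Term) (h : 0 ∈ X) :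
      TRed (.lsub (.fail X) N) {Term.fail (outer 1 X ∪ N.fv)}
  | ctxApp (M : Term) (F : Expr) (B : Bag) (h : TRed M F) :
      TRed (.app M B) (F.map (fun M' => .app M' B))
  | ctxLsub (M : Term) (F : Expr) (N : Term) (h : TRed M F) :
      TRed (.lsub M N) (F.map (fun M' => .lsub M' N))
  | ctxShare (k : ℕ) (M : Term) (F : Expr) (x : ℕ) (h : TRed M F) :
      TRed (.share k M x) (F.map (fun M' => .share k M' x))
  | ctxEsub (M : Term) (F : Expr) (h : TRed M F) :
      TRed (.esub 0 M []) (F.map (fun M' => .esub 0 M' []))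

/-- Reduction of expressions: one summand is reduced. -/
inductive Expr.Red : Expr → Expr → Prop
  | summand (M : Term) (F E : Expr) (h : TRed M F) : Expr.Red (M ::ₘ E) (F + E)

/-! ### Precongruence -/

/-- Exchange of two adjacent groups of `l` (inner) and `k` (outer) bound variables. -/
def swapGroups (l k n : ℕ) : ℕ :=
  if n < l then n + k else if n < l + k then n - l else n

/-- The precongruence `⪰` on terms. -/
inductive TPre : Term → Term → Prop
  | refl (M : Term) : TPre M M
  | trans (M N L : Term) (h : TPre M N) (h' : TPre N L) : TPre M L
  /-- `M[ ← x]⟪1/x⟫ ⪰ M` -/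
  | empty (M : Term) : TPre (.esub 0 M []) M
  /-- `(M B)⟨N/x⟩ ≡ (M⟨N/x⟩) B`, `x ∉ fv B` -/
  | appLsub (M N : Term) (B : Bag) :
      TPre (.lsub (.app M (Bag.shift 1 B)) N) (.app (.lsub M N) B)
  | appLsub' (M N : Term) (B : Bag) :
      TPre (.app (.lsub M N) B) (.lsub (.app M (Bag.shift 1 B)) N)
  /-- `M⟨N₂/y⟩⟨N₁/x⟩ ≡ M⟨N₁/x⟩⟨N₂/y⟩`, `x ∉ fv N₂`; the converse is an instance -/
  | lsubLsub (M N₁ N₂ : Term) :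
      TPre (.lsub (.lsub M (N₂.shift 1)) N₁)
        (.lsub (.lsub (M.rename (swapGroups 1 1)) (N₁.shift 1)) N₂)
  /-- `(M A)[x̃ ← x]⟪B/x⟫ ≡ (M[x̃ ← x]⟪B/x⟫) A`, no `xᵢ` in `fv A` -/
  | appEsub (k : ℕ) (M : Term) (A B : Bag) :
      TPre (.esub k (.app M (Bag.shift k A)) B) (.app (.esub k M B) A)
  | appEsub' (k : ℕ) (M : Term) (A B : Bag) :
      TPre (.app (.esub k M B) A) (.esub k (.app M (Bag.shift k A)) B)
  /-- `M[ỹ ← y]⟪A/y⟫[x̃ ← x]⟪B/x⟫ ⪰ (M[x̃ ← x]⟪B/x⟫)[ỹ ← y]⟪A/y⟫`, no `xᵢ` in `fv A` -/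
  | esubEsub (k l : ℕ) (M : Term) (A B : Bag) :
      TPre (.esub k (.esub l M (Bag.shift k A)) B)
        (.esub l (.esub k (M.rename (swapGroups l k)) (Bag.shift l B)) A)
  | ctxApp (M M' : Term) (B : Bag) (h : TPre M M') : TPre (.app M B) (.app M' B)
  | ctxLsub (M M' N : Term) (h : TPre M M') : TPre (.lsub M N) (.lsub M' N)
  | ctxShare (k : ℕ) (M M' : Term) (x : ℕ) (h : TPre M M') :
      TPre (.share k M x) (.share k M' x)
  | ctxEsub (M M' : Term) (h : TPre M M') : TPre (.esub 0 M []) (.esub 0 M' [])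

/-- The precongruence `⪰` on expressions. -/
inductive Expr.Pre : Expr → Expr → Prop
  | refl (E : Expr) : Expr.Pre E E
  | trans (E F G : Expr) (h : Expr.Pre E F) (h' : Expr.Pre F G) : Expr.Pre E G
  | summand (M M' : Term) (E : Expr) (h : TPre M M') : Expr.Pre (M ::ₘ E) (M' ::ₘ E)

/-- One reduction step up to `⪰`: `E ⪰ E₁ ⟶ E₂ ⪰ F`. -/
def Expr.StepPre (E F : Expr) : Prop :=
  ∃ E₁ E₂ : Expr, Expr.Pre E E₁ ∧ Expr.Red E₁ E₂ ∧ Expr.Pre E₂ F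

/-- `i ≥ 0` reduction steps up to `⪰`; also for `i = 0` the precongruence may be used. -/
def Expr.MultiPre (E F : Expr) : Prop :=
  ∃ E' : Expr, ReflTransGen Expr.StepPre E E' ∧ Expr.Pre E' F

/-! ### Types and well-formedness -/

/-- Strict types: `unit` and `π → τ`.  A multiset type `π` is a list of strict types; `ω` is
`[]`.  The typing rules only ever form and inspect `σ^k`. -/
inductive Ty : Type
  | unit : Ty
  | arr (π : List Ty) (τ : Ty) : Ty

/-- `σ^k`, the `k`-fold intersection of `σ`; `σ^0 = ω`. -/
abbrev Ty.pow (σ : Ty) (k : ℕ) : List Ty := List.replicate k σ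

/-- What a context assigns to a variable: a strict type to a variable that occurs as such in a
term, a multiset type to a sharing variable.  Keeping the two apart enforces the syntactic
conditions that neither a shared variable nor the variable of an explicit linear substitution
is a sharing variable. -/
inductive Asg : Type
  | strict (σ : Ty) : Asg
  | inter (π : List Ty) : Asg

/-- Type assignments: each variable is declared at most once. -/
abbrev Ctx : Type := ℕ → Option Asg

def Ctx.empty : Ctx := fun _ => none

/-- `Ctx.Split Θ Γ Δ`: `Θ` is `Γ, Δ`, the union of contexts with disjoint domains. -/
def Ctx.Split (Θ Γ Δ : Ctx) : Prop :=
  ∀ n, (Γ n = none ∧ Θ n = Δ n) ∨ (Δ n = none ∧ Θ n = Γ n)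

/-- `Γ, x₁ : σ, …, xₖ : σ`, seen from below a binder of `x₁, …, xₖ`. -/
def Ctx.push (k : ℕ) (σ : Ty) (Γ : Ctx) : Ctx :=
  fun n => if n < k then some (.strict σ) else Γ (n - k)

/-- `x : a`. -/
def Ctx.single (x : ℕ) (a : Asg) : Ctx := Function.update Ctx.empty x (some a)

/-- `Γ, x : a`. -/
def Ctx.add (Γ : Ctx) (x : ℕ) (a : Asg) : Ctx := Function.update Γ x (some a)

/- The typing judgments `Γ ⊢ M : τ` and `Γ ⊢ B : π`.  The premise `Γ, x : σ^k ⊢ M[x̃ ← x] : τ`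
of the rules for `lam` and `esub` is replaced by the premise `Γ, x₁ : σ, …, xₖ : σ ⊢ M : τ` of
the only rule (`weak` for `k = 0`, `share` for `k ≠ 0`) that derives it. -/
mutual
  inductive Typed : Ctx → Term → Ty → Prop
    | var (x : ℕ) (σ : Ty) : Typed (Ctx.single x (.strict σ)) (.var x) σ
    | weak (Δ : Ctx) (x : ℕ) (M : Term) (τ : Ty) (hx : Δ x = none) (h : Typed Δ M τ) :
        Typed (Δ.add x (.inter [])) (.share 0 M x) τ
    | share (Δ : Ctx) (k : ℕ) (x : ℕ) (M : Term) (σ τ : Ty) (hk : k ≠ 0) (hx : Δ x = none)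
        (h : Typed (Δ.push k σ) M τ) :
        Typed (Δ.add x (.inter (σ.pow k))) (.share k M x) τ
    | lam (Δ : Ctx) (k : ℕ) (M : Term) (σ τ : Ty) (h : Typed (Δ.push k σ) M τ) :
        Typed Δ (.lam k M) (.arr (σ.pow k) τ)
    | app (Θ Γ Δ : Ctx) (M : Term) (B : Bag) (π : List Ty) (τ : Ty) (hs : Ctx.Split Θ Γ Δ)
        (h : Typed Γ M (.arr π τ)) (h' : TypedBag Δ B π) :
        Typed Θ (.app M B) τ
    | lsub (Θ Γ Δ : Ctx) (M N : Term) (σ τ : Ty) (hs : Ctx.Split Θ Γ Δ)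
        (h : Typed (Γ.push 1 σ) M τ) (h' : Typed Δ N σ) :
        Typed Θ (.lsub M N) τ
    | esub (Θ Γ Δ : Ctx) (k : ℕ) (M : Term) (B : Bag) (σ τ : Ty) (hs : Ctx.Split Θ Γ Δ)
        (h : Typed (Γ.push k σ) M τ) (h' : TypedBag Δ B (σ.pow k)) :
        Typed Θ (.esub k M B) τ
  inductive TypedBag : Ctx → List Term → List Ty → Prop
    | one : TypedBag Ctx.empty [] []
    | bag (Θ Γ Δ : Ctx) (M : Term) (B : Bag) (σ : Ty) (k : ℕ) (hs : Ctx.Split Θ Γ Δ)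
        (h : Typed Γ M σ) (h' : TypedBag Δ B (σ.pow k)) :
        TypedBag Θ (M :: B) (σ.pow (k + 1))
end

/- The well-formedness judgments `Γ ⊨ M : τ` and `Γ ⊨ B : π`. -/
mutual
  inductive WF : Ctx → Term → Ty → Prop
    | typed (Γ : Ctx) (M : Term) (τ : Ty) (h : Typed Γ M τ) : WF Γ M τ
    | weak (Γ : Ctx) (x : ℕ) (M : Term) (τ : Ty) (hx : Γ x = none) (h : WF Γ M τ) :
        WF (Γ.add x (.inter [])) (.share 0 M x) τ
    | share (Γ : Ctx) (k : ℕ) (x : ℕ) (M : Term) (σ τ : Ty) (hk : k ≠ 0) (hx : Γ x = none)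
        (h : WF (Γ.push k σ) M τ) :
        WF (Γ.add x (.inter (σ.pow k))) (.share k M x) τ
    | lam (Γ : Ctx) (k : ℕ) (M : Term) (σ τ : Ty) (h : WF (Γ.push k σ) M τ) :
        WF Γ (.lam k M) (.arr (σ.pow k) τ)
    | fail (Γ : Ctx) (X : Finset ℕ) (τ : Ty) (h : ∀ n, Γ n ≠ none ↔ n ∈ X) :
        WF Γ (.fail X) τ
    | app (Θ Γ Δ : Ctx) (M : Term) (B : Bag) (σ τ : Ty) (j k : ℕ) (hs : Ctx.Split Θ Γ Δ)
        (h : WF Γ M (.arr (σ.pow j) τ)) (h' : WFBag Δ B (σ.pow k)) :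
        WF Θ (.app M B) τ
    | lsub (Θ Γ Δ : Ctx) (M N : Term) (σ τ : Ty) (hs : Ctx.Split Θ Γ Δ)
        (h : WF (Γ.push 1 σ) M τ) (h' : WF Δ N σ) :
        WF Θ (.lsub M N) τ
    | esub (Θ Γ Δ : Ctx) (k j : ℕ) (M : Term) (B : Bag) (σ τ : Ty) (hs : Ctx.Split Θ Γ Δ)
        (h : WF (Γ.push k σ) M τ) (h' : WFBag Δ B (σ.pow j)) :
        WF Θ (.esub k M B) τ
  inductive WFBag : Ctx → List Term → List Ty → Prop
    | typed (Γ : Ctx) (B : Bag) (π : List Ty) (h : TypedBag Γ B π) : WFBag Γ B π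
    | bag (Θ Γ Δ : Ctx) (M : Term) (B : Bag) (σ : Ty) (k : ℕ) (hs : Ctx.Split Θ Γ Δ)
        (h : WF Γ M σ) (h' : WFBag Δ B (σ.pow k)) :
        WFBag Θ (M :: B) (σ.pow (k + 1))
end

/-- `Γ ⊨ E : τ` for expressions. -/
inductive WFExpr : Ctx → Expr → Ty → Prop
  | term (Γ : Ctx) (M : Term) (τ : Ty) (h : WF Γ M τ) : WFExpr Γ {M} τ
  | sum (Γ : Ctx) (E F : Expr) (τ : Ty) (h : WFExpr Γ E τ) (h' : WFExpr Γ F τ) :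
      WFExpr Γ (E + F) τ

/-- An expression is well-formed if it has a type in some context. -/
def Expr.WellFormed (E : Expr) : Prop := ∃ (Γ : Ctx) (τ : Ty), WFExpr Γ E τ

end ShLam

/-! ### The session pi-calculus -/

/-- Processes.  `out`, `inp` and `res` bind the name with index `0` in their body. -/
inductive Proc : Type
  | nil : Proc
  /-- `x̄(y).P` -/
  | out (x : ℕ) (P : Proc) : Proc
  /-- `x(y).P` -/
  | inp (x : ℕ) (P : Proc) : Proc
  | par (P Q : Proc) : Proc
  /-- `(νx)P` -/
  | res (P : Proc) : Proc
  /-- `[x ↔ y]` -/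
  | fwd (x y : ℕ) : Proc
  /-- session close (send) -/
  | closeOut (x : ℕ) : Proc
  /-- complementary close `x.close;P` -/
  | closeIn (x : ℕ) (P : Proc) : Proc
  /-- session confirmation (send `some`, then `P`) -/
  | someOut (x : ℕ) (P : Proc) : Proc
  /-- session failure (send `none`) -/
  | noneOut (x : ℕ) : Proc
  /-- session dependency `x.some_(w₁,…,wₙ);P`; the order of the `wᵢ` is immaterial -/
  | someIn (x : ℕ) (w : Multiset ℕ) (P : Proc) : Proc
  /-- `P ⊕ Q` -/
  | choice (P Q : Proc) : Proc

namespace Proc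

/-- Action of a renaming on names; `ShLam.lift 1 f` is its action below a binder. -/
def rename (f : ℕ → ℕ) : Proc → Proc
  | nil => nil
  | out x P => out (f x) (P.rename (ShLam.lift 1 f))
  | inp x P => inp (f x) (P.rename (ShLam.lift 1 f))
  | par P Q => par (P.rename f) (Q.rename f)
  | res P => res (P.rename (ShLam.lift 1 f))
  | fwd x y => fwd (f x) (f y)
  | closeOut x => closeOut (f x)
  | closeIn x P => closeIn (f x) (P.rename f)
  | someOut x P => someOut (f x) (P.rename f)
  | noneOut x => noneOut (f x)
  | someIn x w P => someIn (f x) (w.map f) (P.rename f)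
  | choice P Q => choice (P.rename f) (Q.rename f)

/-- The substitution of the name `y` for the name `0`, whose binder is removed. -/
def inst (y : ℕ) : ℕ → ℕ
  | 0 => y
  | n + 1 => n

/-- Structural congruence. -/
inductive SC : Proc → Proc → Prop
  | refl (P : Proc) : SC P P
  | symm (P Q : Proc) (h : SC P Q) : SC Q P
  | trans (P Q R : Proc) (h : SC P Q) (h' : SC Q R) : SC P R
  | out (x : ℕ) (P Q : Proc) (h : SC P Q) : SC (.out x P) (.out x Q)
  | inp (x : ℕ) (P Q : Proc) (h : SC P Q) : SC (.inp x P) (.inp x Q)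
  | par (P P' Q Q' : Proc) (h : SC P P') (h' : SC Q Q') : SC (.par P Q) (.par P' Q')
  | res (P Q : Proc) (h : SC P Q) : SC (.res P) (.res Q)
  | closeIn (x : ℕ) (P Q : Proc) (h : SC P Q) : SC (.closeIn x P) (.closeIn x Q)
  | someOut (x : ℕ) (P Q : Proc) (h : SC P Q) : SC (.someOut x P) (.someOut x Q)
  | someIn (x : ℕ) (w : Multiset ℕ) (P Q : Proc) (h : SC P Q) :
      SC (.someIn x w P) (.someIn x w Q)
  | choice (P P' Q Q' : Proc) (h : SC P P') (h' : SC Q Q') :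
      SC (.choice P Q) (.choice P' Q')
  | parNil (P : Proc) : SC (.par P .nil) P
  | parComm (P Q : Proc) : SC (.par P Q) (.par Q P)
  | parAssoc (P Q R : Proc) : SC (.par (.par P Q) R) (.par P (.par Q R))
  | fwdSymm (x y : ℕ) : SC (.fwd x y) (.fwd y x)
  /-- `((νx)P) | Q ≡ (νx)(P | Q)`, `x ∉ fn Q` -/
  | scope (P Q : Proc) : SC (.par (.res P) Q) (.res (.par P (Q.rename (· + 1))))
  | distrib (P Q R : Proc) :
      SC (.res (.par P (.choice Q R))) (.choice (.res (.par P Q)) (.res (.par P R)))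
  | choiceNil : SC (.choice .nil .nil) .nil
  | choiceComm (P Q : Proc) : SC (.choice P Q) (.choice Q P)
  | choiceAssoc (P Q R : Proc) :
      SC (.choice (.choice P Q) R) (.choice P (.choice Q R))
  | resNil : SC (.res .nil) .nil
  /-- `(νx)(νy)P ≡ (νy)(νx)P` -/
  | resSwap (P : Proc) : SC (.res (.res P)) (.res (.res (P.rename (ShLam.swapGroups 1 1))))

/-- The parallel composition of the failures of the names in a list. -/
def nones : List ℕ → Proc
  | [] => nil
  | [w] => noneOut w
  | w :: v :: l => par (noneOut w) (nones (v :: l))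

/-- `⨁` of a list of processes (`nil` for the empty list, which does not arise). -/
def choices : List Proc → Proc
  | [] => nil
  | [P] => P
  | P :: Q :: l => choice P (choices (Q :: l))

/-- Reduction. -/
inductive Red : Proc → Proc → Prop
  | comm (x : ℕ) (P Q : Proc) : Red (.par (.out x Q) (.inp x P)) (.res (.par Q P))
  /-- `(νx)([x ↔ y] | P) ⟶ P{y/x}`, `x ≠ y` -/
  | forw (y : ℕ) (P : Proc) :
      Red (.res (.par (.fwd 0 (y + 1)) P)) (P.rename (inst y))
  | close (x : ℕ) (P : Proc) : Red (.par (.closeOut x) (.closeIn x P)) P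
  | some (x : ℕ) (w : Multiset ℕ) (P Q : Proc) :
      Red (.par (.someOut x P) (.someIn x w Q)) (.par P Q)
  | none (x : ℕ) (l : List ℕ) (Q : Proc) :
      Red (.par (.noneOut x) (.someIn x (l : Multiset ℕ) Q)) (nones l)
  | cong (P P' Q Q' : Proc) (h : SC P P') (hr : Red P' Q') (h' : SC Q' Q) : Red P Q
  | par (P Q Q' : Proc) (h : Red Q Q') : Red (.par P Q) (.par P Q')
  | res (P Q : Proc) (h : Red P Q) : Red (.res P) (.res Q)
  | choice (P Q Q' : Proc) (h : Red Q Q') : Red (.choice P Q) (.choice P Q')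

end Proc

/-! ### The translation

`⟦M⟧_u` depends on the assignment `ρ` of names to the variables of `M`. -/

namespace ShLam

/-- The assignment `ρ` seen from below `n` further binders of names. -/
def up (n : ℕ) (ρ : ℕ → ℕ) : ℕ → ℕ := fun i => ρ i + n

/-- The names of a set of variables. -/
def names (ρ : ℕ → ℕ) (X : Finset ℕ) : Multiset ℕ := X.val.map ρ

/-- The translation of `M[x̃ ← x]` in terms of the free variables `X` and the translation
`body` of `M`.  The list contains the shared variables that still have to be received on the
name `x`, in their order; `ρ` assigns names to all other variables of `M`. -/
def shareProc (X : Finset ℕ) (body : (ℕ → ℕ) → ℕ → Proc) :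
    List ℕ → (ℕ → ℕ) → ℕ → ℕ → Proc
  | [], ρ, x, u =>
      .someOut x (.out x (.par
        (.someIn 0 ((u + 1) ::ₘ names (up 1 ρ) X) (.closeIn 0 (body (up 1 ρ) (u + 1))))
        (.noneOut (x + 1))))
  | i :: l, ρ, x, u =>
      .someOut x (.out x (.par
        (.someIn 0 0 (.closeIn 0 .nil))
        (.someOut (x + 1)
          (.someIn (x + 1) ((u + 1) ::ₘ names (up 1 ρ) (X \ (i :: l).toFinset))
            (.inp (x + 1)
              (shareProc X body l (Function.update (up 2 ρ) i 0) (x + 2) (u + 2)))))))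

/-- An element of a bag: its free variables and its translation. -/
abbrev Elem : Type := Finset ℕ × ((ℕ → ℕ) → ℕ → Proc)

/-- The free variables of a list of elements. -/
def elemsFv : List Elem → Finset ℕ
  | [] => ∅
  | e :: L => e.1 ∪ elemsFv L

/-- The translation of a bag at the name `x`, in terms of its elements. -/
def bagProc : List Elem → (ℕ → ℕ) → ℕ → Proc
  | [], _, x =>
      .someIn x 0 (.inp x (.par
        (.someOut 0 (.closeOut 0))
        (.someIn (x + 1) 0 (.noneOut (x + 1)))))
  | e :: L, ρ, x =>
      .someIn x (names ρ (elemsFv (e :: L))) (.inp x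
        (.someIn (x + 1) (0 ::ₘ names (up 1 ρ) (elemsFv (e :: L)))
          (.someOut (x + 1) (.out (x + 1)
            (.par (.someIn 0 (names (up 2 ρ) e.1) (e.2 (up 2 ρ) 0))
              (.par (bagProc L (up 2 ρ) (x + 2)) (.noneOut 1)))))))

mutual
  /-- `⟦M⟧_u`; the sum over `PER(B)` is taken over the permutations of the list of the
  translated elements of `B`. -/
  def Term.enc : Term → (ℕ → ℕ) → ℕ → Proc
    | .var x, ρ, u => .someOut (ρ x) (.fwd (ρ x) u)
    | .lam k M, ρ, u =>
        .someOut u (.inp u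
          (shareProc M.fv M.enc (List.range k) (fun i => ρ (i - k) + 1) 0 (u + 1)))
    | .app M B, ρ, u =>
        Proc.choices ((Bag.elems B).permutations.map fun L =>
          .res (.par (M.enc (up 1 ρ) 0)
            (.someIn 0 ((u + 1) ::ₘ names (up 1 ρ) (Bag.fv B))
              (.out 0 (.par (.fwd 1 (u + 2)) (bagProc L (up 2 ρ) 0))))))
    | .lsub M N, ρ, u =>
        .res (.par
          (M.enc (fun i => if i = 0 then 0 else ρ (i - 1) + 1) (u + 1))
          (.someIn 0 (names (up 1 ρ) N.fv) (N.enc (up 1 ρ) 0)))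
    | .fail X, ρ, u => Proc.nones (u :: (X.sort (· ≤ ·)).map ρ)
    | .share k M x, ρ, u =>
        shareProc M.fv M.enc (List.range k) (fun i => ρ (i - k)) (ρ x) u
    | .esub k M B, ρ, u =>
        Proc.choices ((Bag.elems B).permutations.map fun L =>
          .res (.par
            (shareProc M.fv M.enc (List.range k) (fun i => ρ (i - k) + 1) 0 (u + 1))
            (bagProc L (up 1 ρ) 0)))
  /-- The elements of a bag together with their translations. -/
  def Bag.elems : List Term → List Elem
    | [] => []
    | M :: B => (M.fv, M.enc) :: Bag.elems B
end

theorem Bag.elems_eq_map (B : Bag) : Bag.elems B = B.map (fun M => (M.fv, M.enc)) := by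
  induction B with
  | nil => rfl
  | cons M B ih => rw [Bag.elems, ih, List.map_cons]

/-- The sum in the translation of an application ranges over `PER(B)`. -/
theorem Term.enc_app (M : Term) (B : Bag) (ρ : ℕ → ℕ) (u : ℕ) :
    (Term.app M B).enc ρ u =
      Proc.choices (B.permutations.map fun B' =>
        .res (.par (M.enc (up 1 ρ) 0)
          (.someIn 0 ((u + 1) ::ₘ names (up 1 ρ) (Bag.fv B))
            (.out 0 (.par (.fwd 1 (u + 2)) (bagProc (Bag.elems B') (up 2 ρ) 0)))))) := by
  rw [Term.enc, Bag.elems_eq_map, ← List.map_permutations, List.map_map]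
  simp only [Function.comp_def, Bag.elems_eq_map]

/-- The sum in the translation of an explicit substitution ranges over `PER(B)`. -/
theorem Term.enc_esub (k : ℕ) (M : Term) (B : Bag) (ρ : ℕ → ℕ) (u : ℕ) :
    (Term.esub k M B).enc ρ u =
      Proc.choices (B.permutations.map fun B' =>
        .res (.par
          (shareProc M.fv M.enc (List.range k) (fun i => ρ (i - k) + 1) 0 (u + 1))
          (bagProc (Bag.elems B') (up 1 ρ) 0))) := by
  rw [Term.enc, Bag.elems_eq_map, ← List.map_permutations, List.map_map]
  simp only [Function.comp_def, Bag.elems_eq_map]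

/-- `⟦E⟧_u` for an expression: the choice between the translations of its summands, taken in
some order (the result does not depend on it up to structural congruence). -/
noncomputable def Expr.enc (E : Expr) (ρ : ℕ → ℕ) (u : ℕ) : Proc :=
  Proc.choices (E.toList.map fun M => M.enc ρ u)

end ShLam

namespace ShLam

theorem lift_one_zero (f : ℕ → ℕ) : lift 1 f 0 = 0 := rfl

theorem lift_one_succ (f : ℕ → ℕ) (n : ℕ) : lift 1 f (n + 1) = f n + 1 := by simp [lift]

theorem lift_one_comp (f g : ℕ → ℕ) : lift 1 f ∘ lift 1 g = lift 1 (f ∘ g) := by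
  funext n
  cases n <;> simp [lift]

theorem lift_one_id : lift 1 id = id := by
  funext n
  cases n <;> simp [lift]

theorem lift_one_preimage (f : ℕ → ℕ) (s : Set ℕ) :
    lift 1 f ⁻¹' ((· + 1) '' s) = (· + 1) '' (f ⁻¹' s) := by
  ext n
  cases n <;> simp [lift]

theorem lift_one_preimage_zero (f : ℕ → ℕ) : lift 1 f ⁻¹' {0} = {0} := by
  ext n
  cases n <;> simp [lift]

end ShLam

namespace Proc

open ShLam

/-! ### Renaming -/

theorem rename_rename (P : Proc) (f g : ℕ → ℕ) :
    (P.rename f).rename g = P.rename (g ∘ f) := by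
  induction P generalizing f g <;> simp_all [rename, lift_one_comp]

theorem rename_id (P : Proc) : P.rename id = P := by
  induction P <;> simp_all [rename, lift_one_id]

theorem nones_rename (l : List ℕ) (f : ℕ → ℕ) : (nones l).rename f = nones (l.map f) := by
  induction l with
  | nil => rfl
  | cons a l ih => cases l <;> simp_all [nones, rename]

theorem lift_swapGroups (f : ℕ → ℕ) :
    lift 1 (lift 1 f) ∘ swapGroups 1 1 = swapGroups 1 1 ∘ lift 1 (lift 1 f) := by
  funext n
  rcases n with _ | _ | n <;> simp [lift, swapGroups]

theorem SC.rename {P Q : Proc} (h : SC P Q) (f : ℕ → ℕ) : SC (P.rename f) (Q.rename f) := by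
  induction h generalizing f with
  | refl P => exact .refl _
  | symm P Q _ ih => exact .symm _ _ (ih f)
  | trans P Q R _ _ ih ih' => exact .trans _ _ _ (ih f) (ih' f)
  | out x P Q _ ih => exact .out _ _ _ (ih _)
  | inp x P Q _ ih => exact .inp _ _ _ (ih _)
  | par P P' Q Q' _ _ ih ih' => exact .par _ _ _ _ (ih f) (ih' f)
  | res P Q _ ih => exact .res _ _ (ih _)
  | closeIn x P Q _ ih => exact .closeIn _ _ _ (ih _)
  | someOut x P Q _ ih => exact .someOut _ _ _ (ih _)
  | someIn x w P Q _ ih => exact .someIn _ _ _ _ (ih _)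
  | choice P P' Q Q' _ _ ih ih' => exact .choice _ _ _ _ (ih f) (ih' f)
  | parNil P => exact .parNil _
  | parComm P Q => exact .parComm _ _
  | parAssoc P Q R => exact .parAssoc _ _ _
  | fwdSymm x y => exact .fwdSymm _ _
  | scope P Q =>
    have : (Q.rename (· + 1)).rename (lift 1 f) = (Q.rename f).rename (· + 1) := by
      rw [rename_rename, rename_rename]
      congr 1
    simp only [Proc.rename, this]
    exact .scope _ _
  | distrib P Q R => exact .distrib _ _ _
  | choiceNil => exact .choiceNil
  | choiceComm P Q => exact .choiceComm _ _
  | choiceAssoc P Q R => exact .choiceAssoc _ _ _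
  | resNil => exact .resNil
  | resSwap P =>
    simp only [Proc.rename, rename_rename, lift_swapGroups]
    rw [← rename_rename]
    exact .resSwap _

theorem inst_lift (f : ℕ → ℕ) (y : ℕ) : f ∘ inst y = inst (f y) ∘ lift 1 f := by
  funext n
  cases n <;> simp [inst, lift]

theorem Red.rename {P Q : Proc} (h : Red P Q) (f : ℕ → ℕ) : Red (P.rename f) (Q.rename f) := by
  induction h generalizing f with
  | comm x P Q => exact .comm _ _ _
  | forw y P =>
    rw [rename_rename, inst_lift, ← rename_rename]
    simp only [Proc.rename, lift_one_zero, lift_one_succ]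
    exact .forw _ _
  | close x P => exact .close _ _
  | some x w P Q => exact .some _ _ _ _
  | none x l Q =>
    rw [nones_rename]
    exact .none _ _ _
  | cong P P' Q Q' h _ h' ih => exact .cong _ _ _ _ (h.rename f) (ih f) (h'.rename f)
  | par P Q Q' _ ih => exact .par _ _ _ (ih f)
  | res P Q _ ih => exact .res _ _ (ih _)
  | choice P Q Q' _ ih => exact .choice _ _ _ (ih f)

/-! ### Occurrences, linearity and size -/

open Classical in
/-- Indicator of a set of names. -/
noncomputable def ind (s : Set ℕ) (x : ℕ) : ℕ := if x ∈ s then 1 else 0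

open Classical in
/-- The number of names of a multiset that are in `s`. -/
noncomputable def cnt (s : Set ℕ) (w : Multiset ℕ) : ℕ := w.countP (· ∈ s)

/-- An upper bound, over the branches of the choices, for the number of threads of a process
in which a name of `s` occurs freely. -/
noncomputable def occ : Proc → Set ℕ → ℕ
  | nil, _ => 0
  | out x P, s => max (ind s x) (P.occ ((· + 1) '' s))
  | inp x P, s => max (ind s x) (P.occ ((· + 1) '' s))
  | par P Q, s => P.occ s + Q.occ s
  | res P, s => P.occ ((· + 1) '' s)
  | fwd x y, s => max (ind s x) (ind s y)
  | closeOut x, s => ind s x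
  | closeIn x P, s => max (ind s x) (P.occ s)
  | someOut x P, s => max (ind s x) (P.occ s)
  | noneOut x, s => ind s x
  | someIn x w P, s => max (max (ind s x) (cnt s w)) (P.occ s)
  | choice P Q, s => max (P.occ s) (Q.occ s)

/-- Every restricted name is shared by at most two threads, and every received or sent name
is used by at most one thread. -/
def lin : Proc → Prop
  | nil => True
  | out _ P => P.lin ∧ P.occ {0} ≤ 1
  | inp _ P => P.lin ∧ P.occ {0} ≤ 1
  | par P Q => P.lin ∧ Q.lin
  | res P => P.lin ∧ P.occ {0} ≤ 2
  | fwd _ _ => True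
  | closeOut _ => True
  | closeIn _ P => P.lin
  | someOut _ P => P.lin
  | noneOut _ => True
  | someIn _ _ P => P.lin
  | choice P Q => P.lin ∧ Q.lin

/-- The number of prefixes, the larger branch being counted in a choice. -/
def size : Proc → ℕ
  | nil => 0
  | out _ P => P.size + 1
  | inp _ P => P.size + 1
  | par P Q => P.size + Q.size
  | res P => P.size
  | fwd _ _ => 1
  | closeOut _ => 1
  | closeIn _ P => P.size + 1
  | someOut _ P => P.size + 1
  | noneOut _ => 1
  | someIn _ w P => P.size + w.card + 1
  | choice P Q => max P.size Q.size

theorem ind_mono {s t : Set ℕ} (h : s ⊆ t) (x : ℕ) : ind s x ≤ ind t x := by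
  unfold ind
  by_cases hx : x ∈ s
  · simp [hx, h hx]
  · simp [hx]

theorem ind_union (s t : Set ℕ) (x : ℕ) : ind (s ∪ t) x ≤ ind s x + ind t x := by
  unfold ind
  by_cases h : x ∈ s <;> by_cases h' : x ∈ t <;> simp [h, h']

@[simp] theorem ind_empty (x : ℕ) : ind ∅ x = 0 := by simp [ind]

theorem ind_eq_zero {s : Set ℕ} {x : ℕ} : ind s x = 0 ↔ x ∉ s := by simp [ind]

theorem ind_preimage (f : ℕ → ℕ) (s : Set ℕ) (x : ℕ) : ind s (f x) = ind (f ⁻¹' s) x := rfl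

theorem ind_succ (s : Set ℕ) (x : ℕ) : ind ((· + 1) '' s) (x + 1) = ind s x := by
  have : x + 1 ∈ (· + 1) '' s ↔ x ∈ s := by simp
  unfold ind
  by_cases h : x ∈ s <;> simp only [this, h, if_true, if_false]

theorem cnt_mono {s t : Set ℕ} (h : s ⊆ t) (w : Multiset ℕ) : cnt s w ≤ cnt t w := by
  classical
  induction w using Multiset.induction with
  | empty => simp [cnt]
  | cons a w ih =>
    have := ind_mono h a
    simp only [cnt, Multiset.countP_cons, ind] at *
    omega

theorem cnt_union (s t : Set ℕ) (w : Multiset ℕ) : cnt (s ∪ t) w ≤ cnt s w + cnt t w := by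
  classical
  induction w using Multiset.induction with
  | empty => simp [cnt]
  | cons a w ih =>
    have := ind_union s t a
    simp only [cnt, Multiset.countP_cons, ind] at *
    omega

@[simp] theorem cnt_empty (w : Multiset ℕ) : cnt ∅ w = 0 := by simp [cnt]

@[simp] theorem cnt_zero (s : Set ℕ) : cnt s 0 = 0 := by simp [cnt]

theorem cnt_eq_zero {s : Set ℕ} {w : Multiset ℕ} : cnt s w = 0 ↔ ∀ n ∈ w, n ∉ s := by
  unfold cnt
  exact @Multiset.countP_eq_zero _ _ (fun _ => Classical.propDecidable _) _

theorem cnt_cons (s : Set ℕ) (a : ℕ) (w : Multiset ℕ) : cnt s (a ::ₘ w) = cnt s w + ind s a := by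
  simp [cnt, ind, Multiset.countP_cons]

theorem cnt_add (s : Set ℕ) (v w : Multiset ℕ) : cnt s (v + w) = cnt s v + cnt s w := by
  simp [cnt]

theorem cnt_map (f : ℕ → ℕ) (s : Set ℕ) (w : Multiset ℕ) : cnt s (w.map f) = cnt (f ⁻¹' s) w := by
  classical
  induction w using Multiset.induction with
  | empty => simp
  | cons a w ih => rw [Multiset.map_cons, cnt_cons, cnt_cons, ih, ind_preimage]

theorem occ_rename (P : Proc) (f : ℕ → ℕ) (s : Set ℕ) :
    (P.rename f).occ s = P.occ (f ⁻¹' s) := by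
  induction P generalizing f s <;>
    simp_all [rename, occ, ind_preimage, cnt_map, lift_one_preimage]

theorem occ_mono (P : Proc) {s t : Set ℕ} (h : s ⊆ t) : P.occ s ≤ P.occ t := by
  induction P generalizing s t with
  | nil => exact le_rfl
  | out x P ih => exact max_le_max (ind_mono h x) (ih (Set.image_mono h))
  | inp x P ih => exact max_le_max (ind_mono h x) (ih (Set.image_mono h))
  | par P Q ih ih' => exact add_le_add (ih h) (ih' h)
  | res P ih => exact ih (Set.image_mono h)
  | fwd x y => exact max_le_max (ind_mono h x) (ind_mono h y)
  | closeOut x => exact ind_mono h x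
  | closeIn x P ih => exact max_le_max (ind_mono h x) (ih h)
  | someOut x P ih => exact max_le_max (ind_mono h x) (ih h)
  | noneOut x => exact ind_mono h x
  | someIn x w P ih =>
    exact max_le_max (max_le_max (ind_mono h x) (cnt_mono h w)) (ih h)
  | choice P Q ih ih' => exact max_le_max (ih h) (ih' h)

theorem occ_union (P : Proc) (s t : Set ℕ) : P.occ (s ∪ t) ≤ P.occ s + P.occ t := by
  induction P generalizing s t with
  | nil => exact le_rfl
  | out x P ih | inp x P ih =>
    have := ind_union s t x
    have := ih ((· + 1) '' s) ((· + 1) '' t)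
    simp only [occ, Set.image_union]
    omega
  | par P Q ih ih' =>
    have := ih s t
    have := ih' s t
    simp only [occ]
    omega
  | res P ih => simpa only [occ, Set.image_union] using ih _ _
  | fwd x y =>
    have := ind_union s t x
    have := ind_union s t y
    simp only [occ]
    omega
  | closeOut x | noneOut x => exact ind_union s t x
  | closeIn x P ih | someOut x P ih =>
    have := ind_union s t x
    have := ih s t
    simp only [occ]
    omega
  | someIn x w P ih =>
    have := ind_union s t x
    have := cnt_union s t w
    have := ih s t
    simp only [occ]
    omega
  | choice P Q ih ih' =>
    have := ih s t
    have := ih' s t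
    simp only [occ]
    omega

@[simp] theorem occ_empty (P : Proc) : P.occ ∅ = 0 := by
  induction P <;> simp_all [occ]

theorem preimage_succ_image (s : Set ℕ) : (· + 1) ⁻¹' ((· + 1) '' s) = s := by
  ext n
  simp

theorem preimage_swapGroups (s : Set ℕ) :
    swapGroups 1 1 ⁻¹' ((· + 1) '' ((· + 1) '' s)) = (· + 1) '' ((· + 1) '' s) := by
  ext n
  rcases n with _ | _ | n <;> simp [swapGroups]

theorem SC.occ_eq {P Q : Proc} (h : SC P Q) (s : Set ℕ) : P.occ s = Q.occ s := by
  induction h generalizing s with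
  | scope P Q => simp only [occ, occ_rename, preimage_succ_image]
  | resSwap P => simp only [occ, occ_rename, preimage_swapGroups]
  | distrib P Q R => simp only [occ]; omega
  | _ => simp_all only [occ] <;> omega

theorem lin_rename (P : Proc) (f : ℕ → ℕ) : (P.rename f).lin ↔ P.lin := by
  induction P generalizing f <;>
    simp_all [rename, lin, occ_rename, lift_one_preimage_zero]

theorem SC.lin_iff {P Q : Proc} (h : SC P Q) : P.lin ↔ Q.lin := by
  induction h with
  | symm P Q _ ih => exact ih.symm
  | trans P Q R _ _ ih ih' => exact ih.trans ih'
  | out x P Q h ih => simp only [lin, ih, h.occ_eq]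
  | inp x P Q h ih => simp only [lin, ih, h.occ_eq]
  | res P Q h ih => simp only [lin, ih, h.occ_eq]
  | scope P Q =>
    have : (fun n => n + 1) ⁻¹' ({0} : Set ℕ) = ∅ := by ext; simp
    simp only [lin, occ, lin_rename, occ_rename, this, occ_empty]
    tauto
  | resSwap P =>
    have h0 : swapGroups 1 1 ⁻¹' ({0} : Set ℕ) = {1} := by
      ext n; rcases n with _ | _ | n <;> simp [swapGroups]
    have h1 : swapGroups 1 1 ⁻¹' ({1} : Set ℕ) = {0} := by
      ext n; rcases n with _ | _ | n <;> simp [swapGroups]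
    simp only [lin, occ, lin_rename, occ_rename, Set.image_singleton,
      zero_add, h0, h1]
    tauto
  | distrib P Q R =>
    simp only [lin, occ]
    constructor
    · rintro ⟨⟨h1, h2, h3⟩, h4⟩
      exact ⟨⟨⟨h1, h2⟩, by omega⟩, ⟨h1, h3⟩, by omega⟩
    · rintro ⟨⟨⟨h1, h2⟩, h3⟩, ⟨h4, h5⟩, h6⟩
      exact ⟨⟨h1, h2, h5⟩, by omega⟩
  | resNil => simp [lin, occ]
  | _ => simp_all only [lin] <;> tauto

theorem size_rename (P : Proc) (f : ℕ → ℕ) : (P.rename f).size = P.size := by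
  induction P generalizing f <;> simp_all [rename, size]

theorem SC.size_eq {P Q : Proc} (h : SC P Q) : P.size = Q.size := by
  induction h with
  | scope P Q => simp only [size, size_rename]
  | resSwap P => simp only [size, size_rename]
  | _ => simp_all only [size] <;> omega

theorem rename_congr (P : Proc) {f g : ℕ → ℕ} (h : P.occ {n | f n ≠ g n} = 0) :
    P.rename f = P.rename g := by
  have hl (f g : ℕ → ℕ) : (· + 1) '' {n | f n ≠ g n} = {n | lift 1 f n ≠ lift 1 g n} := by
    ext n
    cases n <;> simp [lift]
  have hi (x : ℕ) (h : ind {n | f n ≠ g n} x = 0) : f x = g x := by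
    simpa [ind_eq_zero] using h
  induction P generalizing f g with
  | nil => rfl
  | out x P ih | inp x P ih =>
    simp only [occ, hl, Nat.max_eq_zero_iff] at h
    simp only [rename, hi x h.1, ih h.2 (by simp [ind_eq_zero])]
  | par P Q ih ih' =>
    simp only [occ, Nat.add_eq_zero_iff] at h
    simp only [rename, ih h.1 hi, ih' h.2 hi]
  | res P ih =>
    simp only [occ, hl] at h
    simp only [rename, ih h (by simp [ind_eq_zero])]
  | fwd x y =>
    simp only [occ, Nat.max_eq_zero_iff] at h
    simp only [rename, hi x h.1, hi y h.2]
  | closeOut x | noneOut x => simp only [rename, hi x h]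
  | closeIn x P ih | someOut x P ih =>
    simp only [occ, Nat.max_eq_zero_iff] at h
    simp only [rename, hi x h.1, ih h.2 hi]
  | someIn x w P ih =>
    simp only [occ, Nat.max_eq_zero_iff] at h
    have hw : w.map f = w.map g := by
      refine Multiset.map_congr rfl fun n hn => ?_
      simpa using cnt_eq_zero.1 h.1.2 n hn
    simp only [rename, hi x h.1.1, hw, ih h.2 hi]
  | choice P Q ih ih' =>
    simp only [occ, Nat.max_eq_zero_iff] at h
    simp only [rename, ih h.1 hi, ih' h.2 hi]

theorem exists_finset_cnt (w : Multiset ℕ) : ∃ G : Finset ℕ, cnt (↑G)ᶜ w = 0 := by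
  classical
  refine ⟨w.toFinset, ?_⟩
  refine cnt_eq_zero.2 fun n hn => ?_
  simpa using hn

theorem exists_finset_occ (P : Proc) : ∃ G : Finset ℕ, P.occ (↑G)ᶜ = 0 := by
  have hs (G : Finset ℕ) : (· + 1) '' (↑(G.image Nat.pred) : Set ℕ)ᶜ ⊆ (↑G)ᶜ := by
    rintro _ ⟨n, hn, rfl⟩ h
    exact hn (by simpa using ⟨n + 1, h, rfl⟩)
  have hx (x : ℕ) {G : Finset ℕ} (h : x ∈ G) : ind (↑G)ᶜ x = 0 := by
    rw [ind_eq_zero]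
    simpa using h
  have mono (P : Proc) {G G' : Finset ℕ} (h : P.occ (↑G)ᶜ = 0) (h' : G ⊆ G') :
      P.occ (↑G')ᶜ = 0 :=
    Nat.le_zero.1 (h ▸ P.occ_mono (Set.compl_subset_compl.2 (Finset.coe_subset.2 h')))
  have mono' (P : Proc) {G G' : Finset ℕ} (h : P.occ (↑G)ᶜ = 0) (h' : G.image Nat.pred ⊆ G') :
      P.occ ((· + 1) '' (↑G')ᶜ) = 0 :=
    Nat.le_zero.1 (h ▸ P.occ_mono ((Set.image_mono
      (Set.compl_subset_compl.2 (Finset.coe_subset.2 h'))).trans (hs G)))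
  induction P with
  | nil => exact ⟨∅, rfl⟩
  | out x P ih | inp x P ih =>
    obtain ⟨G, hG⟩ := ih
    refine ⟨insert x (G.image Nat.pred), ?_⟩
    rw [occ, mono' P hG (Finset.subset_insert _ _), hx x (by simp), max_self]
  | par P Q ih ih' | choice P Q ih ih' =>
    obtain ⟨G, hG⟩ := ih
    obtain ⟨G', hG'⟩ := ih'
    refine ⟨G ∪ G', ?_⟩
    rw [occ, mono P hG Finset.subset_union_left, mono Q hG' Finset.subset_union_right]
    all_goals simp
  | res P ih =>
    obtain ⟨G, hG⟩ := ih
    exact ⟨G.image Nat.pred, mono' P hG subset_rfl⟩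
  | fwd x y => exact ⟨{x, y}, by simp [occ, ind]⟩
  | closeOut x | noneOut x => exact ⟨{x}, by simp [occ, ind]⟩
  | closeIn x P ih | someOut x P ih =>
    obtain ⟨G, hG⟩ := ih
    refine ⟨insert x G, ?_⟩
    rw [occ, mono P hG (Finset.subset_insert _ _), hx x (by simp), max_self]
  | someIn x w P ih =>
    obtain ⟨G, hG⟩ := ih
    obtain ⟨W, hW⟩ := exists_finset_cnt w
    refine ⟨insert x (W ∪ G), ?_⟩
    have : cnt (↑(insert x (W ∪ G)))ᶜ w = 0 := Nat.le_zero.1 (hW ▸ cnt_mono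
      (Set.compl_subset_compl.2 (Finset.coe_subset.2 fun n hn => by simp [hn])) w)
    rw [occ, mono P hG (fun n hn => by simp [hn]), hx x (by simp), this]
    rfl

theorem occ_nones (l : List ℕ) (s : Set ℕ) : (nones l).occ s = cnt s l := by
  induction l with
  | nil => simp [nones, occ]
  | cons a l ih =>
    rw [← Multiset.cons_coe, cnt_cons]
    cases l with
    | nil => simp [nones, occ]
    | cons b l => simp only [nones, occ] at *; omega

theorem lin_nones (l : List ℕ) : (nones l).lin := by
  induction l with
  | nil => trivial
  | cons a l ih =>
    cases l with
    | nil => trivial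
    | cons b l => exact ⟨trivial, ih⟩

theorem size_nones (l : List ℕ) : (nones l).size = l.length := by
  induction l with
  | nil => rfl
  | cons a l ih =>
    cases l with
    | nil => rfl
    | cons b l => simp only [nones, size, List.length_cons] at *; omega

theorem inst_preimage_succ (y : ℕ) (s : Set ℕ) :
    inst y ⁻¹' s ⊆ (· + 1) '' s ∪ {n | n = 0 ∧ y ∈ s} := by
  intro n hn
  cases n with
  | zero => exact Or.inr ⟨rfl, hn⟩
  | succ n => exact Or.inl ⟨n, hn, rfl⟩

theorem Red.occ_eq_zero {P Q : Proc} (h : Red P Q) (s : Set ℕ) (hs : P.occ s = 0) :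
    Q.occ s = 0 := by
  induction h generalizing s with
  | forw y P =>
    simp only [occ, Nat.add_eq_zero_iff, Nat.max_eq_zero_iff, ind_succ] at hs
    rw [occ_rename]
    refine Nat.le_zero.1 (hs.2 ▸ P.occ_mono fun n hn => ?_)
    rcases inst_preimage_succ y s hn with h | ⟨_, h⟩
    · exact h
    · exact absurd h (ind_eq_zero.1 hs.1.2)
  | none x l Q =>
    rw [occ_nones]
    simp only [occ, Nat.add_eq_zero_iff, Nat.max_eq_zero_iff] at hs
    exact hs.2.1.2
  | cong P P' Q Q' h _ h' ih => exact h'.occ_eq s ▸ ih s (h.occ_eq s ▸ hs)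
  | _ => simp_all [occ]

end Proc

namespace Proc

open ShLam

theorem SC.equivalence : Equivalence SC :=
  ⟨.refl, fun h => .symm _ _ h, fun h h' => .trans _ _ _ h h'⟩

/-- Processes up to structural congruence. -/
def SProc : Type := Quotient (⟨SC, SC.equivalence⟩ : Setoid Proc)

/-- The class of a process. -/
def cls (P : Proc) : SProc := Quotient.mk _ P

theorem cls_eq {P Q : Proc} : P.cls = Q.cls ↔ SC P Q :=
  ⟨fun h => Quotient.exact h, fun h => Quotient.sound h⟩

theorem SC.cls {P Q : Proc} (h : SC P Q) : P.cls = Q.cls := cls_eq.2 h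

namespace SProc

theorem ind {C : SProc → Prop} (h : ∀ P : Proc, C P.cls) (p : SProc) : C p :=
  Quotient.ind h p

/-- Renaming of names. -/
def rename (f : ℕ → ℕ) : SProc → SProc :=
  Quotient.map (Proc.rename f) fun _ _ h => SC.rename h f

def out (x : ℕ) : SProc → SProc := Quotient.map (Proc.out x) fun _ _ h => .out _ _ _ h
def inp (x : ℕ) : SProc → SProc := Quotient.map (Proc.inp x) fun _ _ h => .inp _ _ _ h
def res : SProc → SProc := Quotient.map Proc.res fun _ _ h => .res _ _ h
def closeIn (x : ℕ) : SProc → SProc :=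
  Quotient.map (Proc.closeIn x) fun _ _ h => .closeIn _ _ _ h
def someOut (x : ℕ) : SProc → SProc :=
  Quotient.map (Proc.someOut x) fun _ _ h => .someOut _ _ _ h
def someIn (x : ℕ) (w : Multiset ℕ) : SProc → SProc :=
  Quotient.map (Proc.someIn x w) fun _ _ h => .someIn _ _ _ _ h
def fwd (x y : ℕ) : SProc := (Proc.fwd x y).cls
def closeOut (x : ℕ) : SProc := (Proc.closeOut x).cls
def noneOut (x : ℕ) : SProc := (Proc.noneOut x).cls

noncomputable def occ : SProc → Set ℕ → ℕ :=
  Quotient.lift Proc.occ fun _ _ h => funext (SC.occ_eq h)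
def lin : SProc → Prop := Quotient.lift Proc.lin fun _ _ h => propext (SC.lin_iff h)
def size : SProc → ℕ := Quotient.lift Proc.size fun _ _ h => SC.size_eq h

/-- Parallel composition. -/
instance : Add SProc := ⟨Quotient.map₂ Proc.par fun _ _ h _ _ h' => .par _ _ _ _ h h'⟩

instance : Zero SProc := ⟨Proc.nil.cls⟩

instance : AddCommMonoid SProc where
  add_assoc p q r := by
    induction p using ind; induction q using ind; induction r using ind
    exact (SC.parAssoc _ _ _).cls
  add_comm p q := by
    induction p using ind; induction q using ind
    exact (SC.parComm _ _).cls
  add_zero p := by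
    induction p using ind
    exact (SC.parNil _).cls
  zero_add p := by
    induction p using ind
    exact ((SC.parComm _ _).trans _ _ _ (SC.parNil _)).cls
  nsmul := nsmulRec

theorem cls_par (P Q : Proc) : (Proc.par P Q).cls = P.cls + Q.cls := rfl
theorem cls_noneOut (x : ℕ) : (Proc.noneOut x).cls = noneOut x := rfl
theorem cls_rename (P : Proc) (f : ℕ → ℕ) : (P.rename f).cls = P.cls.rename f := rfl

theorem fwd_comm (x y : ℕ) : fwd x y = fwd y x := (SC.fwdSymm x y).cls

theorem rename_rename (p : SProc) (f g : ℕ → ℕ) : (p.rename f).rename g = p.rename (g ∘ f) := by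
  induction p using ind
  exact congrArg cls (Proc.rename_rename _ _ _)

theorem rename_id (p : SProc) : p.rename id = p := by
  induction p using ind
  exact congrArg cls (Proc.rename_id _)

theorem rename_congr (p : SProc) {f g : ℕ → ℕ} (h : p.occ {n | f n ≠ g n} = 0) :
    p.rename f = p.rename g := by
  induction p using ind
  exact congrArg cls (Proc.rename_congr _ h)

theorem rename_add (p q : SProc) (f : ℕ → ℕ) : (p + q).rename f = p.rename f + q.rename f := by
  induction p using ind; induction q using ind; rfl

theorem rename_zero (f : ℕ → ℕ) : (0 : SProc).rename f = 0 := rfl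

theorem rename_res (p : SProc) (f : ℕ → ℕ) : (res p).rename f = res (p.rename (lift 1 f)) := by
  induction p using ind; rfl

theorem rename_out (x : ℕ) (p : SProc) (f : ℕ → ℕ) :
    (out x p).rename f = out (f x) (p.rename (lift 1 f)) := by
  induction p using ind; rfl

theorem rename_inp (x : ℕ) (p : SProc) (f : ℕ → ℕ) :
    (inp x p).rename f = inp (f x) (p.rename (lift 1 f)) := by
  induction p using ind; rfl

theorem rename_someIn (x : ℕ) (w : Multiset ℕ) (p : SProc) (f : ℕ → ℕ) :
    (someIn x w p).rename f = someIn (f x) (w.map f) (p.rename f) := by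
  induction p using ind; rfl

theorem rename_someOut (x : ℕ) (p : SProc) (f : ℕ → ℕ) :
    (someOut x p).rename f = someOut (f x) (p.rename f) := by
  induction p using ind; rfl

theorem rename_closeIn (x : ℕ) (p : SProc) (f : ℕ → ℕ) :
    (closeIn x p).rename f = closeIn (f x) (p.rename f) := by
  induction p using ind; rfl

theorem occ_rename (p : SProc) (f : ℕ → ℕ) (s : Set ℕ) :
    (p.rename f).occ s = p.occ (f ⁻¹' s) := by
  induction p using ind
  exact Proc.occ_rename _ _ _

theorem occ_mono (p : SProc) {s t : Set ℕ} (h : s ⊆ t) : p.occ s ≤ p.occ t := by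
  induction p using ind
  exact Proc.occ_mono _ h

theorem occ_union (p : SProc) (s t : Set ℕ) : p.occ (s ∪ t) ≤ p.occ s + p.occ t := by
  induction p using ind
  exact Proc.occ_union _ _ _

theorem occ_eq_zero_of_subset {p : SProc} {s t : Set ℕ} (h : p.occ t = 0) (h' : s ⊆ t) :
    p.occ s = 0 := Nat.le_zero.1 (h ▸ p.occ_mono h')

@[simp] theorem occ_add (p q : SProc) (s : Set ℕ) : (p + q).occ s = p.occ s + q.occ s := by
  induction p using ind; induction q using ind; rfl

@[simp] theorem occ_zero (s : Set ℕ) : (0 : SProc).occ s = 0 := rfl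

@[simp] theorem occ_res (p : SProc) (s : Set ℕ) : (res p).occ s = p.occ ((· + 1) '' s) := by
  induction p using ind; rfl

@[simp] theorem lin_res (p : SProc) : (res p).lin ↔ p.lin ∧ p.occ {0} ≤ 2 := by
  induction p using ind; rfl

@[simp] theorem lin_add (p q : SProc) : (p + q).lin ↔ p.lin ∧ q.lin := by
  induction p using ind; induction q using ind; rfl

@[simp] theorem size_add (p q : SProc) : (p + q).size = p.size + q.size := by
  induction p using ind; induction q using ind; rfl

@[simp] theorem size_res (p : SProc) : (res p).size = p.size := by
  induction p using ind; rfl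

/-! ### Choice -/

theorem SC_res_fresh (P : Proc) : SC (.res (P.rename (· + 1))) P := by
  have h1 := SC.scope .nil P
  have h2 : SC (.res (.par .nil (P.rename (· + 1)))) (.res (P.rename (· + 1))) :=
    .res _ _ ((SC.parComm _ _).trans _ _ _ (.parNil _))
  have h3 : SC (.par (.res .nil) P) P :=
    ((SC.par _ _ _ _ .resNil (.refl P)).trans _ _ _ (.parComm _ _)).trans _ _ _ (.parNil _)
  exact ((h1.trans _ _ _ h2).symm).trans _ _ _ h3

theorem res_fresh (p : SProc) : res (p.rename (· + 1)) = p := by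
  induction p using ind
  exact (SC_res_fresh _).cls

theorem SC_par_choice (P Q R : Proc) :
    SC (.par P (.choice Q R)) (.choice (.par P Q) (.par P R)) := by
  refine ((SC_res_fresh _).symm).trans _ _ _ ?_
  refine (SC.distrib _ _ _).trans _ _ _ ?_
  exact .choice _ _ _ _ (SC_res_fresh (.par P Q)) (SC_res_fresh (.par P R))

theorem SC_choice_self (P : Proc) : SC (.choice P P) P := by
  refine (SC.choice _ _ _ _ ((SC.parNil P).symm) ((SC.parNil P).symm)).trans _ _ _ ?_
  refine ((SC_par_choice P .nil .nil).symm).trans _ _ _ ?_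
  exact (SC.par _ _ _ _ (.refl P) .choiceNil).trans _ _ _ (.parNil P)

instance : SemilatticeSup SProc := @SemilatticeSup.mk' _
  ⟨Quotient.map₂ Proc.choice fun _ _ h _ _ h' => .choice _ _ _ _ h h'⟩
  (by
    intro p q
    induction p using ind; induction q using ind
    exact (SC.choiceComm _ _).cls)
  (by
    intro p q r
    induction p using ind; induction q using ind; induction r using ind
    exact (SC.choiceAssoc _ _ _).cls)
  (by
    intro p
    induction p using ind
    exact (SC_choice_self _).cls)

theorem cls_choice (P Q : Proc) : (Proc.choice P Q).cls = P.cls ⊔ Q.cls := rfl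

theorem add_sup (p q r : SProc) : p + (q ⊔ r) = (p + q) ⊔ (p + r) := by
  induction p using ind; induction q using ind; induction r using ind
  exact (SC_par_choice _ _ _).cls

theorem sup_add (p q r : SProc) : (p ⊔ q) + r = (p + r) ⊔ (q + r) := by
  rw [add_comm, add_sup, add_comm r, add_comm r]

theorem res_sup (p q : SProc) : res (p ⊔ q) = res p ⊔ res q := by
  induction p using ind; rename_i P
  induction q using ind; rename_i Q
  have h1 : SC (.res (.choice P Q)) (.res (.par .nil (.choice P Q))) :=
    .res _ _ (((SC.parComm _ _).trans _ _ _ (.parNil _)).symm)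
  have h2 (P : Proc) : SC (.res (.par .nil P)) (.res P) :=
    .res _ _ ((SC.parComm _ _).trans _ _ _ (.parNil _))
  exact ((h1.trans _ _ _ (SC.distrib _ _ _)).trans _ _ _ (.choice _ _ _ _ (h2 P) (h2 Q))).cls

theorem rename_sup (p q : SProc) (f : ℕ → ℕ) : (p ⊔ q).rename f = p.rename f ⊔ q.rename f := by
  induction p using ind; induction q using ind; rfl

@[simp] theorem occ_sup (p q : SProc) (s : Set ℕ) : (p ⊔ q).occ s = max (p.occ s) (q.occ s) := by
  induction p using ind; induction q using ind; rfl

theorem add_le_add' {p p' q q' : SProc} (h : p ≤ p') (h' : q ≤ q') : p + q ≤ p' + q' := by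
  rw [← sup_eq_right] at h h' ⊢
  rw [← h, ← h', sup_add, add_sup, add_sup]
  simp only [← sup_assoc, sup_idem]

/-! ### Named restriction -/

theorem res_swap (p : SProc) : res (res p) = res (res (p.rename (swapGroups 1 1))) := by
  induction p using ind
  exact (SC.resSwap _).cls

theorem res_add (p q : SProc) : res p + q = res (p + q.rename (· + 1)) := by
  induction p using ind; induction q using ind
  exact (SC.scope _ _).cls

theorem add_res (p q : SProc) : q + res p = res (q.rename (· + 1) + p) := by
  rw [add_comm, res_add, add_comm]

/-- The renaming that makes `a` the innermost bound name. -/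
def bind (a n : ℕ) : ℕ := if n = a then 0 else n + 1

/-- Restriction of the name `a`. -/
def nu (a : ℕ) (p : SProc) : SProc := res (p.rename (bind a))

theorem bind_preimage (a : ℕ) (s : Set ℕ) : bind a ⁻¹' ((· + 1) '' s) = s \ {a} := by
  ext n
  by_cases h : n = a <;> simp [bind, h]

theorem occ_nu (a : ℕ) (p : SProc) (s : Set ℕ) : (nu a p).occ s = p.occ (s \ {a}) := by
  rw [nu, occ_res, occ_rename, bind_preimage]

theorem nu_comm (a b : ℕ) (p : SProc) : nu a (nu b p) = nu b (nu a p) := by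
  by_cases h : a = b
  · rw [h]
  · simp only [nu, rename_res, rename_rename]
    rw [res_swap, rename_rename]
    congr 3
    funext n
    by_cases h1 : n = a
    · subst h1
      simp [bind, lift, swapGroups, h]
    · by_cases h2 : n = b
      · subst h2
        simp [bind, lift, swapGroups, h1]
      · simp [bind, lift, swapGroups, h1, h2]

theorem rename_bind_of_fresh {a : ℕ} {p : SProc} (h : p.occ {a} = 0) :
    p.rename (bind a) = p.rename (· + 1) := by
  refine rename_congr _ (occ_eq_zero_of_subset h ?_)
  intro n hn
  by_contra h'
  exact hn (if_neg h')

theorem nu_add {a : ℕ} (p : SProc) {q : SProc} (h : q.occ {a} = 0) :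
    nu a p + q = nu a (p + q) := by
  rw [nu, nu, res_add, rename_add, rename_bind_of_fresh h]

theorem nu_sup (a : ℕ) (p q : SProc) : nu a (p ⊔ q) = nu a p ⊔ nu a q := by
  rw [nu, rename_sup, res_sup, nu, nu]

theorem nu_fresh {a : ℕ} {p : SProc} (h : p.occ {a} = 0) : nu a p = p := by
  rw [nu, rename_bind_of_fresh h, res_fresh]

theorem nu_mono (a : ℕ) {p q : SProc} (h : p ≤ q) : nu a p ≤ nu a q := by
  rw [← sup_eq_right] at h ⊢
  rw [← nu_sup, h]

instance : LeftCommutative nu := ⟨nu_comm⟩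

/-- Restriction of a finite set of names. -/
def nus (F : Finset ℕ) (p : SProc) : SProc := F.val.foldr nu p

@[simp] theorem nus_empty (p : SProc) : nus ∅ p = p := rfl

theorem nus_insert {a : ℕ} {F : Finset ℕ} (h : a ∉ F) (p : SProc) :
    nus (insert a F) p = nu a (nus F p) := by
  rw [nus, Finset.insert_val_of_notMem h, Multiset.foldr_cons, nus]

theorem nus_nu (a : ℕ) (F : Finset ℕ) (p : SProc) : nus F (nu a p) = nu a (nus F p) := by
  induction F using Finset.induction with
  | empty => rfl
  | insert b F h ih => rw [nus_insert h, nus_insert h, ih, nu_comm]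

theorem occ_nus (F : Finset ℕ) (p : SProc) (s : Set ℕ) : (nus F p).occ s = p.occ (s \ F) := by
  induction F using Finset.induction generalizing s with
  | empty => simp
  | insert b F h ih =>
    rw [nus_insert h, occ_nu, ih]
    congr 1
    ext n
    simp
    tauto

theorem nus_sup (F : Finset ℕ) (p q : SProc) : nus F (p ⊔ q) = nus F p ⊔ nus F q := by
  induction F using Finset.induction with
  | empty => rfl
  | insert b F h ih => rw [nus_insert h, nus_insert h, nus_insert h, ih, nu_sup]

theorem nus_add (F : Finset ℕ) (p : SProc) {q : SProc} (h : q.occ F = 0) :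
    nus F p + q = nus F (p + q) := by
  induction F using Finset.induction with
  | empty => rfl
  | insert b F hb ih =>
    rw [nus_insert hb, nus_insert hb, nu_add, ih]
    · exact occ_eq_zero_of_subset h (by simp)
    · exact occ_eq_zero_of_subset h (by simp)

theorem nus_nus {F F' : Finset ℕ} (h : Disjoint F F') (p : SProc) :
    nus F (nus F' p) = nus (F ∪ F') p := by
  induction F using Finset.induction with
  | empty => simp
  | insert b F hb ih =>
    rw [Finset.disjoint_insert_left] at h
    rw [nus_insert hb, ih h.2, Finset.insert_union, nus_insert (by simp [hb, h.1])]

theorem nus_fresh (F : Finset ℕ) {p : SProc} (h : p.occ F = 0) : nus F p = p := by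
  induction F using Finset.induction with
  | empty => rfl
  | insert b F hb ih =>
    rw [nus_insert hb, ih, nu_fresh]
    · exact occ_eq_zero_of_subset h (by simp)
    · exact occ_eq_zero_of_subset h (by simp)

theorem nus_eq_nus {F F' : Finset ℕ} {p : SProc} {A : Set ℕ} (hF : Disjoint (F : Set ℕ) A)
    (hF' : Disjoint (F' : Set ℕ) A) (h : p.occ (A ∪ F)ᶜ = 0) (h' : p.occ (A ∪ F')ᶜ = 0) :
    nus F p = nus F' p := by
  have key {F F' : Finset ℕ} (hF' : Disjoint (F' : Set ℕ) A) (h : p.occ (A ∪ F)ᶜ = 0) :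
      nus F p = nus (F ∪ F') p := by
    rw [← Finset.union_sdiff_self_eq_union, ← nus_nus Finset.disjoint_sdiff, nus_fresh (F' \ F)]
    refine occ_eq_zero_of_subset h fun n hn => ?_
    simp only [Finset.coe_sdiff, Set.mem_sdiff, Finset.mem_coe] at hn
    simp only [Set.mem_compl_iff, Set.mem_union, Finset.mem_coe, not_or]
    exact ⟨fun hA => Set.disjoint_left.1 hF' hn.1 hA, hn.2⟩
  rw [key hF' h, key hF h', Finset.union_comm]

/-- The assignment of names `e`, seen from below a binder whose name is `a`. -/
def envCons (a : ℕ) (e : ℕ → ℕ) : ℕ → ℕ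
  | 0 => a
  | n + 1 => e n

theorem rename_envCons (p : SProc) (a : ℕ) (e : ℕ → ℕ) (h : (res p).occ (e ⁻¹' {a}) = 0) :
    res (p.rename (lift 1 e)) = nu a (p.rename (envCons a e)) := by
  rw [nu, rename_rename]
  congr 1
  rw [occ_res] at h
  refine rename_congr _ (occ_eq_zero_of_subset h ?_)
  intro n hn
  cases n with
  | zero => simp [lift, bind, envCons] at hn
  | succ n =>
    refine ⟨n, ?_, rfl⟩
    by_contra hna
    simp only [Set.mem_preimage, Set.mem_singleton_iff] at hna
    simp [lift, bind, envCons, hna] at hn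

/-! ### Reduction -/

/-- Reduction of processes up to structural congruence. -/
def Red (p q : SProc) : Prop := ∃ P Q : Proc, P.cls = p ∧ Q.cls = q ∧ Proc.Red P Q

/-- Many steps. -/
abbrev Reds : SProc → SProc → Prop := ReflTransGen Red

theorem Red.add {p q : SProc} (h : Red p q) (r : SProc) : Red (r + p) (r + q) := by
  induction r using SProc.ind
  obtain ⟨P, Q, rfl, rfl, h⟩ := h
  exact ⟨_, _, rfl, rfl, .par _ _ _ h⟩

theorem Red.res {p q : SProc} (h : Red p q) : Red (res p) (res q) := by
  obtain ⟨P, Q, rfl, rfl, h⟩ := h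
  exact ⟨_, _, rfl, rfl, .res _ _ h⟩

theorem Red.sup {p q : SProc} (h : Red p q) (r : SProc) : Red (r ⊔ p) (r ⊔ q) := by
  induction r using SProc.ind
  obtain ⟨P, Q, rfl, rfl, h⟩ := h
  exact ⟨_, _, rfl, rfl, .choice _ _ _ h⟩

theorem Red.rename {p q : SProc} (h : Red p q) (f : ℕ → ℕ) : Red (p.rename f) (q.rename f) := by
  obtain ⟨P, Q, rfl, rfl, h⟩ := h
  exact ⟨_, _, rfl, rfl, h.rename f⟩

theorem Red.nu {p q : SProc} (h : Red p q) (a : ℕ) : Red (nu a p) (nu a q) := (h.rename _).res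

theorem Reds.add_left {p q : SProc} (h : Reds p q) (r : SProc) : Reds (r + p) (r + q) :=
  h.lift _ fun _ _ h => h.add r

theorem Reds.add_right {p q : SProc} (h : Reds p q) (r : SProc) : Reds (p + r) (q + r) := by
  rw [add_comm p, add_comm q]
  exact h.add_left r

theorem Reds.res {p q : SProc} (h : Reds p q) : Reds (res p) (res q) :=
  h.lift _ fun _ _ h => h.res

theorem Reds.nu {p q : SProc} (h : Reds p q) (a : ℕ) : Reds (nu a p) (nu a q) :=
  h.lift _ fun _ _ h => h.nu a

theorem Reds.nus {p q : SProc} (h : Reds p q) (F : Finset ℕ) : Reds (nus F p) (nus F q) := by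
  induction F using Finset.induction with
  | empty => exact h
  | insert b F hb ih =>
    rw [nus_insert hb, nus_insert hb]
    exact ih.nu b

theorem Reds.sup {p q p' q' : SProc} (h : Reds p q) (h' : Reds p' q') :
    Reds (p ⊔ p') (q ⊔ q') := by
  refine ReflTransGen.trans (b := p ⊔ q') (h'.lift _ fun _ _ h => h.sup p) ?_
  rw [sup_comm p, sup_comm q]
  exact h.lift _ fun _ _ h => h.sup q'

theorem Reds.exists_of_cls {P : Proc} {q : SProc} (h : Reds P.cls q) :
    ∃ Q : Proc, Q.cls = q ∧ ReflTransGen Proc.Red P Q := by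
  induction h with
  | refl => exact ⟨P, rfl, .refl⟩
  | tail _ h ih =>
    obtain ⟨Q, rfl, hQ⟩ := ih
    obtain ⟨P', Q', hP, rfl, h⟩ := h
    exact ⟨Q', rfl, hQ.tail (.cong _ _ _ _ (cls_eq.1 hP.symm) h (.refl _))⟩

/-- The parallel composition of the failures of the names in a multiset. -/
def nones (w : Multiset ℕ) : SProc := (w.map noneOut).sum

theorem cls_nones (l : List ℕ) : (Proc.nones l).cls = nones l := by
  induction l with
  | nil => rfl
  | cons a l ih =>
    cases l with
    | nil => simp [Proc.nones, nones, cls_noneOut]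
    | cons b l =>
      rw [Proc.nones, cls_par, ih, cls_noneOut]
      simp [nones]

theorem nones_add (v w : Multiset ℕ) : nones (v + w) = nones v + nones w := by
  simp [nones]

theorem nones_cons (a : ℕ) (w : Multiset ℕ) : nones (a ::ₘ w) = noneOut a + nones w := by
  simp [nones]

theorem nones_zero : nones 0 = 0 := rfl

theorem nones_rename (w : Multiset ℕ) (f : ℕ → ℕ) : (nones w).rename f = nones (w.map f) := by
  induction w using Multiset.induction with
  | empty => rfl
  | cons a w ih => rw [nones_cons, rename_add, ih, Multiset.map_cons, nones_cons]; rfl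

theorem occ_nones (w : Multiset ℕ) (s : Set ℕ) : (nones w).occ s = cnt s w := by
  induction w using Quotient.ind with
  | _ l => exact (cls_nones l) ▸ Proc.occ_nones l s

theorem lin_nones (w : Multiset ℕ) : (nones w).lin := by
  induction w using Quotient.ind with
  | _ l => exact (cls_nones l) ▸ Proc.lin_nones l

theorem size_nones (w : Multiset ℕ) : (nones w).size = w.card := by
  induction w using Quotient.ind with
  | _ l => exact (cls_nones l) ▸ Proc.size_nones l

theorem Red.comm (x : ℕ) (p q : SProc) : Red (out x q + inp x p) (SProc.res (q + p)) := by
  induction p using SProc.ind; induction q using SProc.ind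
  exact ⟨_, _, rfl, rfl, .comm _ _ _⟩

theorem Red.close (x : ℕ) (p : SProc) : Red (closeOut x + closeIn x p) p := by
  induction p using SProc.ind
  exact ⟨_, _, rfl, rfl, .close _ _⟩

theorem Red.some (x : ℕ) (w : Multiset ℕ) (p q : SProc) :
    Red (someOut x p + someIn x w q) (p + q) := by
  induction p using SProc.ind; induction q using SProc.ind
  exact ⟨_, _, rfl, rfl, .some _ _ _ _⟩

theorem Red.none (x : ℕ) (w : Multiset ℕ) (q : SProc) :
    Red (noneOut x + someIn x w q) (nones w) := by
  induction q using SProc.ind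
  induction w using Quotient.ind with
  | _ l => exact ⟨_, _, rfl, cls_nones l, .none _ _ _⟩

theorem Red.forw (y : ℕ) (p : SProc) :
    Red (SProc.res (fwd 0 (y + 1) + p)) (p.rename (inst y)) := by
  induction p using SProc.ind
  exact ⟨_, _, rfl, rfl, .forw _ _⟩

theorem Red.forw_nu {x y : ℕ} (h : x ≠ y) (p : SProc) :
    Red (SProc.nu x (fwd x y + p)) (p.rename fun n => if n = x then y else n) := by
  have h1 : (fwd x y).rename (bind x) = fwd 0 (y + 1) := by
    change fwd (bind x x) (bind x y) = _
    simp [bind, h.symm]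
  rw [SProc.nu, rename_add, h1]
  convert Red.forw y (p.rename (bind x)) using 1
  rw [rename_rename]
  congr 1
  funext n
  by_cases h : n = x <;> simp [h, bind, inst]

/-! ### Sums -/

/-- The process is a choice between elements of `G`. -/
inductive Sums (G : SProc → Prop) : SProc → Prop
  | base {p : SProc} (h : G p) : Sums G p
  | sup {p q : SProc} (h : Sums G p) (h' : Sums G q) : Sums G (p ⊔ q)

theorem Sums.map {G H : SProc → Prop} (f : SProc → SProc) (hf : ∀ p q, f (p ⊔ q) = f p ⊔ f q)
    (hG : ∀ p, G p → Sums H (f p)) {p : SProc} (h : Sums G p) : Sums H (f p) := by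
  induction h with
  | base h => exact hG _ h
  | sup _ _ ih ih' => rw [hf]; exact .sup ih ih'

theorem Sums.mono {G H : SProc → Prop} (hG : ∀ p, G p → H p) {p : SProc} (h : Sums G p) :
    Sums H p := h.map (fun p => p) (fun _ _ => rfl) fun p hp => .base (hG p hp)

theorem Sums.reds {G H : SProc → Prop} (hG : ∀ p, G p → ∃ q, Reds p q ∧ Sums H q) {p : SProc}
    (h : Sums G p) : ∃ q, Reds p q ∧ Sums H q := by
  induction h with
  | base h => exact hG _ h
  | sup _ _ ih ih' =>
    obtain ⟨q, h, hq⟩ := ih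
    obtain ⟨q', h', hq'⟩ := ih'
    exact ⟨q ⊔ q', h.sup h', .sup hq hq'⟩

theorem Sums.le {G : SProc → Prop} {p q : SProc} (h : Sums G p) (hG : ∀ g, G g → g ≤ p → g ≤ q) :
    p ≤ q := by
  have key : ∀ r, Sums G r → r ≤ p → r ≤ q := by
    intro r hr
    induction hr with
    | base h => exact hG _ h
    | sup _ _ ih ih' =>
      exact fun h => sup_le (ih (le_sup_left.trans h)) (ih' (le_sup_right.trans h))
  exact key p h le_rfl

end SProc

end Proc

namespace Proc

open ShLam SProc

/-! ### Configurations -/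

/-- Prefixed processes and forwarders. -/
inductive Atom : Type
  | out (x : ℕ) (p : SProc) : Atom
  | inp (x : ℕ) (p : SProc) : Atom
  | fwd (s : Sym2 ℕ) : Atom
  | closeOut (x : ℕ) : Atom
  | closeIn (x : ℕ) (p : SProc) : Atom
  | someOut (x : ℕ) (p : SProc) : Atom
  | noneOut (x : ℕ) : Atom
  | someIn (x : ℕ) (w : Multiset ℕ) (p : SProc) : Atom

namespace Atom

def rename (f : ℕ → ℕ) : Atom → Atom
  | out x p => out (f x) (p.rename (lift 1 f))
  | inp x p => inp (f x) (p.rename (lift 1 f))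
  | fwd s => fwd (s.map f)
  | closeOut x => closeOut (f x)
  | closeIn x p => closeIn (f x) (p.rename f)
  | someOut x p => someOut (f x) (p.rename f)
  | noneOut x => noneOut (f x)
  | someIn x w p => someIn (f x) (w.map f) (p.rename f)

/-- The process that consists of an atom. -/
def toSProc : Atom → SProc
  | out x p => .out x p
  | inp x p => .inp x p
  | fwd s => Sym2.lift ⟨SProc.fwd, fwd_comm⟩ s
  | closeOut x => .closeOut x
  | closeIn x p => .closeIn x p
  | someOut x p => .someOut x p
  | noneOut x => .noneOut x
  | someIn x w p => .someIn x w p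

theorem toSProc_rename (a : Atom) (f : ℕ → ℕ) : (a.rename f).toSProc = a.toSProc.rename f := by
  cases a with
  | out x p => exact (rename_out _ _ _).symm
  | inp x p => exact (rename_inp _ _ _).symm
  | fwd s => induction s with | _ x y => rfl
  | closeOut x => rfl
  | closeIn x p => exact (rename_closeIn _ _ _).symm
  | someOut x p => exact (rename_someOut _ _ _).symm
  | noneOut x => rfl
  | someIn x w p => exact (rename_someIn _ _ _ _).symm

theorem rename_rename (a : Atom) (f g : ℕ → ℕ) : (a.rename f).rename g = a.rename (g ∘ f) := by
  cases a <;> simp [rename, SProc.rename_rename, lift_one_comp, Sym2.map_map]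

theorem rename_id (a : Atom) : a.rename id = a := by
  cases a <;> simp [rename, SProc.rename_id, lift_one_id]

theorem image_succ_ne (f g : ℕ → ℕ) :
    (· + 1) '' {n | f n ≠ g n} = {n | lift 1 f n ≠ lift 1 g n} := by
  ext n
  cases n <;> simp [lift]

theorem rename_congr (a : Atom) {f g : ℕ → ℕ} (h : a.toSProc.occ {n | f n ≠ g n} = 0) :
    a.rename f = a.rename g := by
  have hi (x : ℕ) (h : Proc.ind {n | f n ≠ g n} x = 0) : f x = g x := by
    simpa [ind_eq_zero] using h
  cases a with
  | out x p | inp x p =>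
    induction p using SProc.ind
    obtain ⟨h1, h2⟩ := Nat.max_eq_zero_iff.1 h
    rw [image_succ_ne] at h2
    simp only [rename, hi _ h1, SProc.rename_congr (Proc.cls _) h2]
  | fwd s =>
    induction s with | _ x y =>
    obtain ⟨h1, h2⟩ := Nat.max_eq_zero_iff.1 h
    simp only [rename, Sym2.map_mk, hi _ h1, hi _ h2]
  | closeOut x | noneOut x => simp only [rename, hi x h]
  | closeIn x p | someOut x p =>
    induction p using SProc.ind
    obtain ⟨h1, h2⟩ := Nat.max_eq_zero_iff.1 h
    simp only [rename, hi _ h1, SProc.rename_congr (Proc.cls _) h2]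
  | someIn x w p =>
    induction p using SProc.ind
    obtain ⟨h1, h2⟩ := Nat.max_eq_zero_iff.1 h
    obtain ⟨h1, h3⟩ := Nat.max_eq_zero_iff.1 h1
    have hw : w.map f = w.map g := by
      refine Multiset.map_congr rfl fun n hn => ?_
      simpa using cnt_eq_zero.1 h3 n hn
    simp only [rename, hi _ h1, SProc.rename_congr (Proc.cls _) h2, hw]

end Atom

/-- A configuration: a multiset of atoms in parallel. -/
abbrev Config : Type := Multiset Atom

/-- Renaming in a configuration. -/
def Config.rename (f : ℕ → ℕ) (c : Config) : Config := c.map (Atom.rename f)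

/-- The parallel composition of the atoms of a configuration. -/
def Config.body (c : Config) : SProc := (c.map Atom.toSProc).sum

namespace Config

@[simp] theorem body_zero : body 0 = 0 := rfl

@[simp] theorem body_add (c d : Config) : body (c + d) = body c + body d := by simp [body]

@[simp] theorem body_cons (a : Atom) (c : Config) : body (a ::ₘ c) = a.toSProc + body c := by
  simp [body]

@[simp] theorem body_singleton (a : Atom) : body {a} = a.toSProc := by
  simp [body]

@[simp] theorem rename_zero (f : ℕ → ℕ) : rename f 0 = 0 := rfl

@[simp] theorem rename_add (f : ℕ → ℕ) (c d : Config) :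
    rename f (c + d) = rename f c + rename f d := by simp [rename]

@[simp] theorem rename_cons (f : ℕ → ℕ) (a : Atom) (c : Config) :
    rename f (a ::ₘ c) = a.rename f ::ₘ rename f c := by simp [rename]

@[simp] theorem rename_singleton (f : ℕ → ℕ) (a : Atom) :
    rename f {a} = {a.rename f} := by simp [rename]

theorem rename_rename (f g : ℕ → ℕ) (c : Config) : rename g (rename f c) = rename (g ∘ f) c := by
  simp [rename, Function.comp_def, Atom.rename_rename]

theorem rename_id (c : Config) : rename id c = c := by
  simp [rename, Atom.rename_id]

theorem body_rename (f : ℕ → ℕ) (c : Config) : body (rename f c) = (body c).rename f := by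
  induction c using Multiset.induction with
  | empty => rfl
  | cons a c ih => simp [ih, Atom.toSProc_rename, SProc.rename_add]

theorem rename_congr (c : Config) {f g : ℕ → ℕ} (h : (body c).occ {n | f n ≠ g n} = 0) :
    rename f c = rename g c := by
  induction c using Multiset.induction with
  | empty => rfl
  | cons a c ih =>
    simp only [body_cons, occ_add, Nat.add_eq_zero_iff] at h
    simp [ih h.2, a.rename_congr h.1]

theorem rename_eq_self (c : Config) {f : ℕ → ℕ} (h : (body c).occ {n | f n ≠ n} = 0) :
    rename f c = c := (rename_congr c h).trans (rename_id c)

end Config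

theorem comp_envCons (f : ℕ → ℕ) (a : ℕ) (e : ℕ → ℕ) :
    f ∘ envCons a e = envCons (f a) (f ∘ e) := by
  funext n
  cases n <;> rfl

theorem envCons_lift (f : ℕ → ℕ) (a : ℕ) (e : ℕ → ℕ) :
    envCons a e ∘ lift 1 f = envCons a (e ∘ f) := by
  funext n
  cases n <;> simp [envCons, lift]

/-- `Conf P e F c`: one branch of the process `P`, where `e` assigns names to the free names
of `P` and the restrictions outside of prefixes get distinct names in `F`, consists of the
atoms in `c`. -/
def Conf : Proc → (ℕ → ℕ) → Finset ℕ → Config → Prop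
  | nil, _, F, c => F = ∅ ∧ c = 0
  | out x P, e, F, c => F = ∅ ∧ c = {.out (e x) (P.rename (lift 1 e)).cls}
  | inp x P, e, F, c => F = ∅ ∧ c = {.inp (e x) (P.rename (lift 1 e)).cls}
  | par P Q, e, F, c => ∃ F₁ F₂ c₁ c₂, Disjoint F₁ F₂ ∧ F = F₁ ∪ F₂ ∧ c = c₁ + c₂ ∧
      Conf P e F₁ c₁ ∧ Conf Q e F₂ c₂
  | res P, e, F, c => ∃ a F', a ∉ F' ∧ F = insert a F' ∧ Conf P (envCons a e) F' c
  | fwd x y, e, F, c => F = ∅ ∧ c = {.fwd s(e x, e y)}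
  | closeOut x, e, F, c => F = ∅ ∧ c = {.closeOut (e x)}
  | closeIn x P, e, F, c => F = ∅ ∧ c = {.closeIn (e x) (P.rename e).cls}
  | someOut x P, e, F, c => F = ∅ ∧ c = {.someOut (e x) (P.rename e).cls}
  | noneOut x, e, F, c => F = ∅ ∧ c = {.noneOut (e x)}
  | someIn x w P, e, F, c => F = ∅ ∧ c = {.someIn (e x) (w.map e) (P.rename e).cls}
  | choice P Q, e, F, c => Conf P e F c ∨ Conf Q e F c

theorem conf_rename {P : Proc} {f e : ℕ → ℕ} {F : Finset ℕ} {c : Config} :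
    Conf (P.rename f) e F c ↔ Conf P (e ∘ f) F c := by
  induction P generalizing f e F c <;>
    simp_all [Conf, rename, Proc.rename_rename, lift_one_comp, envCons_lift]

theorem Conf.congr {P : Proc} {e e' : ℕ → ℕ} {F : Finset ℕ} {c : Config}
    (h : Conf P e F c) (he : P.occ {n | e n ≠ e' n} = 0) : Conf P e' F c := by
  have hi (x : ℕ) (h : Proc.ind {n | e n ≠ e' n} x = 0) : e x = e' x := by
    simpa [ind_eq_zero] using h
  induction P generalizing e e' F c with
  | nil => exact h
  | out x P | inp x P =>
    obtain ⟨h1, h2⟩ := Nat.max_eq_zero_iff.1 he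
    rw [Atom.image_succ_ne] at h2
    rwa [Conf, hi _ h1, Proc.rename_congr _ h2] at h
  | par P Q ih ih' =>
    obtain ⟨F₁, F₂, c₁, c₂, hF, rfl, rfl, h1, h2⟩ := h
    obtain ⟨he1, he2⟩ := Nat.add_eq_zero_iff.1 he
    exact ⟨F₁, F₂, c₁, c₂, hF, rfl, rfl, ih h1 he1 hi, ih' h2 he2 hi⟩
  | res P ih =>
    obtain ⟨a, F', ha, rfl, h⟩ := h
    refine ⟨a, F', ha, rfl, ih h ?_ (by simp [ind_eq_zero])⟩
    refine (congrArg P.occ ?_).trans he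
    ext n
    cases n <;> simp [envCons]
  | fwd x y =>
    obtain ⟨h1, h2⟩ := Nat.max_eq_zero_iff.1 he
    rwa [Conf, hi _ h1, hi _ h2] at h
  | closeOut x | noneOut x => rwa [Conf, hi _ he] at h
  | closeIn x P | someOut x P =>
    obtain ⟨h1, h2⟩ := Nat.max_eq_zero_iff.1 he
    rwa [Conf, hi _ h1, Proc.rename_congr _ h2] at h
  | someIn x w P =>
    obtain ⟨h1, h2⟩ := Nat.max_eq_zero_iff.1 he
    obtain ⟨h1, h3⟩ := Nat.max_eq_zero_iff.1 h1
    have hw : w.map e = w.map e' := by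
      refine Multiset.map_congr rfl fun n hn => ?_
      simpa using cnt_eq_zero.1 h3 n hn
    rwa [Conf, hi _ h1, Proc.rename_congr _ h2, hw] at h
  | choice P Q ih ih' =>
    obtain ⟨he1, he2⟩ := Nat.max_eq_zero_iff.1 he
    exact h.imp (ih · he1 hi) (ih' · he2 hi)

/-- Configurations are invariant under structural congruence, up to the names of vacuous
restrictions. -/
theorem SC.conf {P Q : Proc} (h : SC P Q) (e : ℕ → ℕ) (c : Config) :
    (∀ F A, Disjoint F A → Conf P e F c → ∃ F', Disjoint F' A ∧ Conf Q e F' c) ∧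
    (∀ F A, Disjoint F A → Conf Q e F c → ∃ F', Disjoint F' A ∧ Conf P e F' c) := by
  induction h generalizing e c with
  | refl P => exact ⟨fun F A hF h => ⟨F, hF, h⟩, fun F A hF h => ⟨F, hF, h⟩⟩
  | symm P Q _ ih => exact (ih e c).symm
  | trans P Q R _ _ ih ih' =>
    constructor
    · intro F A hF h
      obtain ⟨F', hF', h'⟩ := (ih e c).1 F A hF h
      exact (ih' e c).1 F' A hF' h'
    · intro F A hF h
      obtain ⟨F', hF', h'⟩ := (ih' e c).2 F A hF h
      exact (ih e c).2 F' A hF' h'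
  | out x P Q h ih =>
    simp only [Conf, (h.rename (lift 1 e)).cls]
    exact ⟨fun F A hF h => ⟨F, hF, h⟩, fun F A hF h => ⟨F, hF, h⟩⟩
  | inp x P Q h ih =>
    simp only [Conf, (h.rename (lift 1 e)).cls]
    exact ⟨fun F A hF h => ⟨F, hF, h⟩, fun F A hF h => ⟨F, hF, h⟩⟩
  | closeIn x P Q h ih =>
    simp only [Conf, (h.rename e).cls]
    exact ⟨fun F A hF h => ⟨F, hF, h⟩, fun F A hF h => ⟨F, hF, h⟩⟩
  | someOut x P Q h ih =>
    simp only [Conf, (h.rename e).cls]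
    exact ⟨fun F A hF h => ⟨F, hF, h⟩, fun F A hF h => ⟨F, hF, h⟩⟩
  | someIn x w P Q h ih =>
    simp only [Conf, (h.rename e).cls]
    exact ⟨fun F A hF h => ⟨F, hF, h⟩, fun F A hF h => ⟨F, hF, h⟩⟩
  | par P P' Q Q' _ _ ih ih' =>
    have key {P P' Q Q' : Proc}
        (h1 : ∀ c F A, Disjoint F A → Conf P e F c → ∃ F', Disjoint F' A ∧ Conf P' e F' c)
        (h2 : ∀ c F A, Disjoint F A → Conf Q e F c → ∃ F', Disjoint F' A ∧ Conf Q' e F' c)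
        (F A : Finset ℕ) (hF : Disjoint F A) (h : Conf (P.par Q) e F c) :
        ∃ F', Disjoint F' A ∧ Conf (P'.par Q') e F' c := by
      obtain ⟨F₁, F₂, c₁, c₂, hF12, rfl, rfl, hc1, hc2⟩ := h
      rw [Finset.disjoint_union_left] at hF
      obtain ⟨G₁, hG1, h1⟩ := h1 c₁ F₁ (A ∪ F₂) (Finset.disjoint_union_right.2 ⟨hF.1, hF12⟩) hc1
      rw [Finset.disjoint_union_right] at hG1
      obtain ⟨G₂, hG2, h2⟩ := h2 c₂ F₂ (A ∪ G₁)
        (Finset.disjoint_union_right.2 ⟨hF.2, hG1.2.symm⟩) hc2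
      rw [Finset.disjoint_union_right] at hG2
      exact ⟨G₁ ∪ G₂, Finset.disjoint_union_left.2 ⟨hG1.1, hG2.1⟩,
        G₁, G₂, c₁, c₂, hG2.2.symm, rfl, rfl, h1, h2⟩
    exact ⟨key (fun c => (ih e c).1) (fun c => (ih' e c).1),
      key (fun c => (ih e c).2) (fun c => (ih' e c).2)⟩
  | res P Q _ ih =>
    have key {P Q : Proc}
        (h1 : ∀ e F A, Disjoint F A → Conf P e F c → ∃ F', Disjoint F' A ∧ Conf Q e F' c)
        (F A : Finset ℕ) (hF : Disjoint F A) (h : Conf (P.res) e F c) :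
        ∃ F', Disjoint F' A ∧ Conf Q.res e F' c := by
      obtain ⟨a, F', ha, rfl, h⟩ := h
      rw [Finset.disjoint_insert_left] at hF
      obtain ⟨G, hG, h⟩ := h1 _ F' (insert a A) (Finset.disjoint_insert_right.2 ⟨ha, hF.2⟩) h
      rw [Finset.disjoint_insert_right] at hG
      exact ⟨insert a G, Finset.disjoint_insert_left.2 ⟨hF.1, hG.2⟩, a, G, hG.1, rfl, h⟩
    exact ⟨key fun e => (ih e c).1, key fun e => (ih e c).2⟩
  | choice P P' Q Q' _ _ ih ih' =>
    constructor
    · rintro F A hF (h | h)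
      · obtain ⟨F', hF', h⟩ := (ih e c).1 F A hF h
        exact ⟨F', hF', .inl h⟩
      · obtain ⟨F', hF', h⟩ := (ih' e c).1 F A hF h
        exact ⟨F', hF', .inr h⟩
    · rintro F A hF (h | h)
      · obtain ⟨F', hF', h⟩ := (ih e c).2 F A hF h
        exact ⟨F', hF', .inl h⟩
      · obtain ⟨F', hF', h⟩ := (ih' e c).2 F A hF h
        exact ⟨F', hF', .inr h⟩
  | parNil P =>
    constructor
    · rintro F A hF ⟨F₁, F₂, c₁, c₂, h12, rfl, rfl, h, rfl, rfl⟩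
      exact ⟨F₁, by simpa using hF, by simpa using h⟩
    · intro F A hF h
      exact ⟨F, hF, F, ∅, c, 0, by simp, by simp, by simp, h, rfl, rfl⟩
  | parComm P Q =>
    have key {P Q : Proc} (F A : Finset ℕ) (hF : Disjoint F A) (h : Conf (P.par Q) e F c) :
        ∃ F', Disjoint F' A ∧ Conf (Q.par P) e F' c := by
      obtain ⟨F₁, F₂, c₁, c₂, h12, rfl, rfl, h, h'⟩ := h
      exact ⟨_, hF, F₂, F₁, c₂, c₁, h12.symm, Finset.union_comm _ _, add_comm _ _, h', h⟩
    exact ⟨key, key⟩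
  | parAssoc P Q R =>
    constructor
    · rintro F A hF ⟨F₁, F₂, c₁, c₂, h12, rfl, rfl, ⟨F₃, F₄, c₃, c₄, h34, rfl, rfl, h3, h4⟩, h2⟩
      rw [Finset.disjoint_union_left] at h12
      exact ⟨_, hF, F₃, F₄ ∪ F₂, c₃, c₄ + c₂, Finset.disjoint_union_right.2 ⟨h34, h12.1⟩,
        Finset.union_assoc _ _ _, add_assoc _ _ _, h3, F₄, F₂, c₄, c₂, h12.2, rfl, rfl, h4, h2⟩
    · rintro F A hF ⟨F₁, F₂, c₁, c₂, h12, rfl, rfl, h1, ⟨F₃, F₄, c₃, c₄, h34, rfl, rfl, h3, h4⟩⟩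
      rw [Finset.disjoint_union_right] at h12
      exact ⟨_, hF, F₁ ∪ F₃, F₄, c₁ + c₃, c₄, Finset.disjoint_union_left.2 ⟨h12.2, h34⟩,
        (Finset.union_assoc _ _ _).symm, (add_assoc _ _ _).symm,
        ⟨F₁, F₃, c₁, c₃, h12.1, rfl, rfl, h1, h3⟩, h4⟩
  | fwdSymm x y =>
    simp only [Conf, Sym2.eq_swap (a := e x) (b := e y)]
    exact ⟨fun F A hF h => ⟨F, hF, h⟩, fun F A hF h => ⟨F, hF, h⟩⟩
  | scope P Q =>
    have hQ (a : ℕ) (F : Finset ℕ) (c : Config) :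
        Conf (Q.rename (· + 1)) (envCons a e) F c ↔ Conf Q e F c := by
      rw [conf_rename]; rfl
    constructor
    · rintro F A hF ⟨F₁, F₂, c₁, c₂, h12, rfl, rfl, ⟨a, F', ha, rfl, h1⟩, h2⟩
      rw [Finset.disjoint_insert_left] at h12
      exact ⟨_, hF, a, F' ∪ F₂, by simp [ha, h12.1], Finset.insert_union _ _ _,
        F', F₂, c₁, c₂, h12.2, rfl, rfl, h1, (hQ _ _ _).2 h2⟩
    · rintro F A hF ⟨a, F', ha, rfl, F₁, F₂, c₁, c₂, h12, rfl, rfl, h1, h2⟩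
      rw [Finset.mem_union, not_or] at ha
      exact ⟨_, hF, insert a F₁, F₂, c₁, c₂, Finset.disjoint_insert_left.2 ⟨ha.2, h12⟩,
        (Finset.insert_union _ _ _).symm, rfl, ⟨a, F₁, ha.1, rfl, h1⟩, (hQ _ _ _).1 h2⟩
  | distrib P Q R =>
    constructor
    · rintro F A hF ⟨a, F', ha, rfl, F₁, F₂, c₁, c₂, h12, rfl, rfl, h1, h2 | h2⟩
      · exact ⟨_, hF, .inl ⟨a, _, ha, rfl, F₁, F₂, c₁, c₂, h12, rfl, rfl, h1, h2⟩⟩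
      · exact ⟨_, hF, .inr ⟨a, _, ha, rfl, F₁, F₂, c₁, c₂, h12, rfl, rfl, h1, h2⟩⟩
    · rintro F A hF (⟨a, F', ha, rfl, F₁, F₂, c₁, c₂, h12, rfl, rfl, h1, h2⟩ |
        ⟨a, F', ha, rfl, F₁, F₂, c₁, c₂, h12, rfl, rfl, h1, h2⟩)
      · exact ⟨_, hF, a, _, ha, rfl, F₁, F₂, c₁, c₂, h12, rfl, rfl, h1, .inl h2⟩
      · exact ⟨_, hF, a, _, ha, rfl, F₁, F₂, c₁, c₂, h12, rfl, rfl, h1, .inr h2⟩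
  | choiceNil =>
    constructor
    · rintro F A hF (h | h) <;> exact ⟨F, hF, h⟩
    · exact fun F A hF h => ⟨F, hF, .inl h⟩
  | choiceComm P Q =>
    exact ⟨fun F A hF h => ⟨F, hF, h.symm⟩, fun F A hF h => ⟨F, hF, h.symm⟩⟩
  | choiceAssoc P Q R =>
    exact ⟨fun F A hF h => ⟨F, hF, or_assoc.1 h⟩, fun F A hF h => ⟨F, hF, or_assoc.2 h⟩⟩
  | resNil =>
    constructor
    · rintro F A hF ⟨a, F', ha, rfl, rfl, rfl⟩
      exact ⟨∅, by simp, rfl, rfl⟩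
    · rintro F A hF ⟨rfl, rfl⟩
      obtain ⟨a, ha⟩ := Infinite.exists_notMem_finset A
      exact ⟨{a}, by simpa using ha, a, ∅, by simp, by simp, rfl, rfl⟩
  | resSwap P =>
    have hP (a b : ℕ) (F : Finset ℕ) (c : Config) :
        Conf (P.rename (swapGroups 1 1)) (envCons a (envCons b e)) F c ↔
          Conf P (envCons b (envCons a e)) F c := by
      rw [conf_rename]
      have : envCons a (envCons b e) ∘ swapGroups 1 1 = envCons b (envCons a e) := by
        funext n
        rcases n with _ | _ | n <;> rfl
      rw [this]
    constructor
    · rintro F A hF ⟨a, F', ha, rfl, b, F'', hb, rfl, h⟩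
      simp only [Finset.mem_insert, not_or] at ha
      exact ⟨_, hF, b, insert a F'', by simp [hb, Ne.symm ha.1], Finset.insert_comm _ _ _,
        a, F'', ha.2, rfl, (hP _ _ _ _).2 h⟩
    · rintro F A hF ⟨a, F', ha, rfl, b, F'', hb, rfl, h⟩
      simp only [Finset.mem_insert, not_or] at ha
      exact ⟨_, hF, b, insert a F'', by simp [hb, Ne.symm ha.1], Finset.insert_comm _ _ _,
        a, F'', ha.2, rfl, (hP _ _ _ _).1 h⟩

theorem Conf.of_sc {P Q : Proc} (h : SC P Q) {e : ℕ → ℕ} {c : Config} {F A : Finset ℕ}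
    (hF : Disjoint F A) (hc : Conf P e F c) : ∃ F', Disjoint F' A ∧ Conf Q e F' c :=
  (h.conf e c).1 F A hF hc

theorem Conf.map {P : Proc} {e : ℕ → ℕ} {F : Finset ℕ} {c : Config} (h : Conf P e F c)
    {f : ℕ → ℕ} (hf : Set.InjOn f F) : Conf P (f ∘ e) (F.image f) (c.rename f) := by
  induction P generalizing e F c with
  | par P Q ih ih' =>
    obtain ⟨F₁, F₂, c₁, c₂, hF, rfl, rfl, h1, h2⟩ := h
    refine ⟨F₁.image f, F₂.image f, _, _, ?_, Finset.image_union _ _, Config.rename_add _ _ _,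
      ih h1 (hf.mono (by simp)), ih' h2 (hf.mono (by simp))⟩
    rw [Finset.disjoint_left] at hF ⊢
    intro x hx hx'
    simp only [Finset.mem_image] at hx hx'
    obtain ⟨y, hy, rfl⟩ := hx
    obtain ⟨z, hz, hzy⟩ := hx'
    exact hF hy (hf (by simp [hz]) (by simp [hy]) hzy ▸ hz)
  | res P ih =>
    obtain ⟨a, F', ha, rfl, h⟩ := h
    refine ⟨f a, F'.image f, ?_, Finset.image_insert _ _ _, ?_⟩
    · simp only [Finset.mem_image]
      rintro ⟨b, hb, hba⟩
      exact ha (hf (by simp [hb]) (by simp) hba ▸ hb)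
    · rw [← comp_envCons]
      exact ih h (hf.mono (by simp))
  | choice P Q ih ih' => exact Or.imp (ih · hf) (ih' · hf) h
  | nil =>
    obtain ⟨rfl, rfl⟩ := h
    exact ⟨rfl, rfl⟩
  | _ =>
    obtain ⟨rfl, rfl⟩ := h
    simp [Conf, Atom.rename, ← cls_rename, Proc.rename_rename, lift_one_comp]

theorem Conf.exists_of_comp {P : Proc} {f e : ℕ → ℕ} {F : Finset ℕ} {c : Config}
    (h : Conf P (f ∘ e) F c) (hf : ∀ a ∈ F, f a = a) :
    ∃ c', Conf P e F c' ∧ c = c'.rename f := by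
  induction P generalizing e F c with
  | par P Q ih ih' =>
    obtain ⟨F₁, F₂, c₁, c₂, hF, rfl, rfl, h1, h2⟩ := h
    obtain ⟨d₁, hd1, rfl⟩ := ih h1 fun a ha => hf a (by simp [ha])
    obtain ⟨d₂, hd2, rfl⟩ := ih' h2 fun a ha => hf a (by simp [ha])
    exact ⟨d₁ + d₂, ⟨F₁, F₂, d₁, d₂, hF, rfl, rfl, hd1, hd2⟩, (Config.rename_add _ _ _).symm⟩
  | res P ih =>
    obtain ⟨a, F', ha, rfl, h⟩ := h
    rw [← hf a (by simp), ← comp_envCons] at h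
    obtain ⟨d, hd, rfl⟩ := ih h fun a ha => hf a (by simp [ha])
    exact ⟨d, ⟨a, F', ha, rfl, hd⟩, rfl⟩
  | choice P Q ih ih' =>
    rcases h with h | h
    · obtain ⟨d, hd, rfl⟩ := ih h hf
      exact ⟨d, .inl hd, rfl⟩
    · obtain ⟨d, hd, rfl⟩ := ih' h hf
      exact ⟨d, .inr hd, rfl⟩
  | nil =>
    obtain ⟨rfl, rfl⟩ := h
    exact ⟨0, ⟨rfl, rfl⟩, rfl⟩
  | _ =>
    obtain ⟨rfl, rfl⟩ := h
    refine ⟨_, ⟨rfl, rfl⟩, ?_⟩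
    simp [Atom.rename, ← cls_rename, Proc.rename_rename, lift_one_comp]

theorem envCons_preimage_subset (a : ℕ) (e : ℕ → ℕ) (s : Set ℕ) :
    envCons a e ⁻¹' s ⊆ (· + 1) '' (e ⁻¹' s) ∪ {n | n = 0 ∧ a ∈ s} := by
  intro n hn
  cases n with
  | zero => exact .inr ⟨rfl, hn⟩
  | succ n => exact .inl ⟨n, hn, rfl⟩

theorem Conf.occ_le {P : Proc} {e : ℕ → ℕ} {F : Finset ℕ} {c : Config} (h : Conf P e F c)
    {s : Set ℕ} (hs : Disjoint s F) : c.body.occ s ≤ P.occ (e ⁻¹' s) := by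
  have hl : lift 1 e ⁻¹' ((· + 1) '' s) = (· + 1) '' (e ⁻¹' s) := lift_one_preimage e s
  induction P generalizing e F c with
  | par P Q ih ih' =>
    obtain ⟨F₁, F₂, c₁, c₂, hF, rfl, rfl, h1, h2⟩ := h
    simp only [Finset.coe_union, Set.disjoint_union_right] at hs
    simp only [Config.body_add, occ_add, Proc.occ]
    exact add_le_add (ih h1 hs.1 hl) (ih' h2 hs.2 hl)
  | res P ih =>
    obtain ⟨a, F', ha, rfl, h⟩ := h
    simp only [Finset.coe_insert, Set.disjoint_insert_right] at hs
    refine (ih h hs.2 (lift_one_preimage _ _)).trans (Proc.occ_mono _ ?_)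
    refine (envCons_preimage_subset _ _ _).trans ?_
    rintro n (hn | ⟨_, hn⟩)
    · exact hn
    · exact absurd hn hs.1
  | choice P Q ih ih' =>
    rcases h with h | h
    · exact (ih h hs hl).trans (le_max_left _ _)
    · exact (ih' h hs hl).trans (le_max_right _ _)
  | nil =>
    obtain ⟨rfl, rfl⟩ := h
    exact le_rfl
  | out x P | inp x P =>
    obtain ⟨rfl, rfl⟩ := h
    rw [Config.body_singleton]
    change max (Proc.ind s (e x)) ((P.rename (lift 1 e)).occ _) ≤ _
    rw [Proc.occ_rename, hl, ind_preimage]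
    rfl
  | fwd x y | closeOut x | noneOut x =>
    obtain ⟨rfl, rfl⟩ := h
    rw [Config.body_singleton]
    exact le_rfl
  | closeIn x P | someOut x P =>
    obtain ⟨rfl, rfl⟩ := h
    rw [Config.body_singleton]
    change max (Proc.ind s (e x)) ((P.rename e).occ _) ≤ _
    rw [Proc.occ_rename, ind_preimage]
    rfl
  | someIn x w P =>
    obtain ⟨rfl, rfl⟩ := h
    rw [Config.body_singleton]
    change max (max (Proc.ind s (e x)) (cnt s (w.map e))) ((P.rename e).occ _) ≤ _
    rw [Proc.occ_rename, ind_preimage, cnt_map]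
    rfl

theorem Conf.lin {P : Proc} {e : ℕ → ℕ} {F : Finset ℕ} {c : Config} (h : Conf P e F c)
    (hP : P.lin) (hF : P.occ (e ⁻¹' F) = 0) :
    (∀ a ∈ F, c.body.occ {a} ≤ 2) ∧ ∀ a ∈ c, a.toSProc.lin := by
  induction P generalizing e F c with
  | par P Q ih ih' =>
    obtain ⟨F₁, F₂, c₁, c₂, hF12, rfl, rfl, h1, h2⟩ := h
    simp only [Proc.occ, Nat.add_eq_zero_iff, Finset.coe_union, Set.preimage_union] at hF
    have l1 := ih h1 hP.1
      (Nat.le_zero.1 (hF.1 ▸ Proc.occ_mono _ Set.subset_union_left))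
    have l2 := ih' h2 hP.2
      (Nat.le_zero.1 (hF.2 ▸ Proc.occ_mono _ Set.subset_union_right))
    refine ⟨fun a ha => ?_, fun a ha => ?_⟩
    · simp only [Config.body_add, occ_add]
      rcases Finset.mem_union.1 ha with ha | ha
      · have h0 := h2.occ_le (s := {a})
          (by simpa using fun h => Finset.disjoint_left.1 hF12 ha h)
        have : Q.occ (e ⁻¹' {a}) ≤ Q.occ (e ⁻¹' ↑F₁ ∪ e ⁻¹' ↑F₂) :=
          Q.occ_mono fun n hn => .inl (by simpa [Set.mem_singleton_iff.1 hn] using ha)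
        have := l1.1 a ha
        omega
      · have h0 := h1.occ_le (s := {a})
          (by simpa using fun h => Finset.disjoint_left.1 hF12 h ha)
        have : P.occ (e ⁻¹' {a}) ≤ P.occ (e ⁻¹' ↑F₁ ∪ e ⁻¹' ↑F₂) :=
          P.occ_mono fun n hn => .inr (by simpa [Set.mem_singleton_iff.1 hn] using ha)
        have := l2.1 a ha
        omega
    · rcases Multiset.mem_add.1 ha with ha | ha
      · exact l1.2 a ha
      · exact l2.2 a ha
  | res P ih =>
    obtain ⟨a, F', ha, rfl, h⟩ := h
    have h0 : P.occ (envCons a e ⁻¹' ↑F') = 0 := by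
      refine Nat.le_zero.1 (hF ▸ Proc.occ_mono _ ?_)
      refine (envCons_preimage_subset _ _ _).trans ?_
      rintro n (⟨n, hn, rfl⟩ | ⟨_, hn⟩)
      · exact ⟨n, by simpa using Or.inr hn, rfl⟩
      · exact absurd hn ha
    obtain ⟨l1, l2⟩ := ih h hP.1 h0
    refine ⟨fun b hb => ?_, l2⟩
    by_cases hba : b ∈ F'
    · exact l1 b hba
    · have hb' : b = a := by simpa [hba] using hb
      subst hb'
      refine (h.occ_le (s := {b}) (by simpa using ha)).trans ?_
      refine (Proc.occ_mono _ (envCons_preimage_subset _ _ _)).trans ?_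
      refine (Proc.occ_union _ _ _).trans ?_
      have h1 : P.occ ((· + 1) '' (e ⁻¹' {b})) = 0 :=
        Nat.le_zero.1 (hF ▸ Proc.occ_mono _ (Set.image_mono (Set.preimage_mono (by simp))))
      rw [h1, zero_add]
      exact (Proc.occ_mono _ (fun n hn => hn.1)).trans hP.2
  | choice P Q ih ih' =>
    simp only [Proc.occ, Nat.max_eq_zero_iff] at hF
    rcases h with h | h
    · exact ih h hP.1 hF.1
    · exact ih' h hP.2 hF.2
  | nil =>
    obtain ⟨rfl, rfl⟩ := h
    simp
  | _ =>
    obtain ⟨rfl, rfl⟩ := h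
    refine ⟨by simp, fun a ha => ?_⟩
    rw [Multiset.mem_singleton] at ha
    subst ha
    first
    | trivial
    | exact (Proc.lin_rename _ _).2 hP

theorem Conf.size_le {P : Proc} {e : ℕ → ℕ} {F : Finset ℕ} {c : Config} (h : Conf P e F c) :
    c.body.size ≤ P.size := by
  induction P generalizing e F c with
  | par P Q ih ih' =>
    obtain ⟨F₁, F₂, c₁, c₂, hF, rfl, rfl, h1, h2⟩ := h
    simp only [Config.body_add, size_add, Proc.size]
    exact add_le_add (ih h1) (ih' h2)
  | res P ih =>
    obtain ⟨a, F', ha, rfl, h⟩ := h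
    exact ih h
  | choice P Q ih ih' =>
    rcases h with h | h
    · exact (ih h).trans (le_max_left _ _)
    · exact (ih' h).trans (le_max_right _ _)
  | nil =>
    obtain ⟨rfl, rfl⟩ := h
    exact le_rfl
  | out x P | inp x P | closeIn x P | someOut x P =>
    obtain ⟨rfl, rfl⟩ := h
    rw [Config.body_singleton]
    exact Nat.succ_le_succ (Proc.size_rename _ _).le
  | fwd x y | closeOut x | noneOut x =>
    obtain ⟨rfl, rfl⟩ := h
    rw [Config.body_singleton]
    exact le_rfl
  | someIn x w P =>
    obtain ⟨rfl, rfl⟩ := h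
    rw [Config.body_singleton]
    change (P.rename e).size + (w.map e).card + 1 ≤ _
    rw [Proc.size_rename, Multiset.card_map]
    rfl

end Proc

namespace Proc

open ShLam SProc

theorem occ_eq_zero_of_subset {P : Proc} {s t : Set ℕ} (h : P.occ t = 0) (h' : s ⊆ t) :
    P.occ s = 0 := Nat.le_zero.1 (h ▸ P.occ_mono h')

theorem Conf.occ_eq_zero {P : Proc} {e : ℕ → ℕ} {F : Finset ℕ} {c : Config} (h : Conf P e F c)
    {s : Set ℕ} (hs : Disjoint s F) {A : Set ℕ} (hA : P.occ (e ⁻¹' Aᶜ) = 0) (hsA : Disjoint s A) :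
    c.body.occ s = 0 :=
  Nat.le_zero.1 ((h.occ_le hs).trans (occ_eq_zero_of_subset hA
    (Set.preimage_mono hsA.subset_compl_right)).le)

theorem Conf.cover {P : Proc} {e : ℕ → ℕ} {F : Finset ℕ} {c : Config} (h : Conf P e F c)
    {A : Set ℕ} (hA : P.occ (e ⁻¹' Aᶜ) = 0) : c.body.occ (A ∪ F)ᶜ = 0 :=
  h.occ_eq_zero (disjoint_compl_left.mono_right Set.subset_union_right) hA
    (disjoint_compl_left.mono_right Set.subset_union_left)

theorem occ_envCons_eq_zero {P : Proc} {e : ℕ → ℕ} {A : Finset ℕ}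
    (hA : P.res.occ (e ⁻¹' (↑A)ᶜ) = 0) (a : ℕ) :
    P.occ (envCons a e ⁻¹' (↑(insert a A))ᶜ) = 0 := by
  refine occ_eq_zero_of_subset hA ((envCons_preimage_subset _ _ _).trans ?_)
  rintro n (⟨n, hn, rfl⟩ | ⟨_, hn⟩)
  · refine ⟨n, fun h => hn ?_, rfl⟩
    simpa using Or.inr h
  · simp at hn

theorem SProc.nus_add_nus {F₁ F₂ : Finset ℕ} {p₁ p₂ : SProc} (hF : Disjoint F₁ F₂)
    (h₁ : p₁.occ F₂ = 0) (h₂ : p₂.occ F₁ = 0) :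
    nus F₁ p₁ + nus F₂ p₂ = nus (F₁ ∪ F₂) (p₁ + p₂) := by
  rw [nus_add, add_comm, nus_add _ _ h₁, nus_nus hF, add_comm]
  rw [occ_nus]
  exact SProc.occ_eq_zero_of_subset h₂ Set.sdiff_subset

theorem conf_par_body {P Q : Proc} {e : ℕ → ℕ} {F₁ F₂ : Finset ℕ} {c₁ c₂ : Config}
    {A : Finset ℕ} (hA : (P.par Q).occ (e ⁻¹' (↑A)ᶜ) = 0) (h : Disjoint F₁ F₂)
    (h₁ : Disjoint F₁ A) (h₂ : Disjoint F₂ A) (hc₁ : Conf P e F₁ c₁) (hc₂ : Conf Q e F₂ c₂) :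
    nus F₁ c₁.body + nus F₂ c₂.body = nus (F₁ ∪ F₂) (c₁ + c₂).body := by
  obtain ⟨hP, hQ⟩ := Nat.add_eq_zero_iff.1 hA
  rw [Config.body_add]
  rw [← Finset.disjoint_coe] at h h₁ h₂
  exact nus_add_nus (Finset.disjoint_coe.1 h) (hc₁.occ_eq_zero h.symm hP h₂)
    (hc₂.occ_eq_zero h hQ h₁)

/-- Every process is the choice between its configurations. -/
theorem sums_conf (P : Proc) (e : ℕ → ℕ) (A : Finset ℕ) (hA : P.occ (e ⁻¹' (↑A)ᶜ) = 0) :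
    Sums (fun g => ∃ F c, Disjoint F A ∧ Conf P e F c ∧ g = nus F c.body)
      (P.rename e).cls := by
  induction P generalizing e A with
  | par P Q ih ih' =>
    obtain ⟨hP, hQ⟩ := Nat.add_eq_zero_iff.1 hA
    refine (ih e A hP).map (· + (Q.rename e).cls) (fun _ _ => sup_add _ _ _) ?_
    rintro _ ⟨F₁, c₁, hF₁, h₁, rfl⟩
    refine (ih' e (A ∪ F₁) ?_).map (nus F₁ c₁.body + ·) (fun _ _ => add_sup _ _ _) ?_
    · refine occ_eq_zero_of_subset hQ (Set.preimage_mono (Set.compl_subset_compl.2 ?_))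
      simp
    rintro _ ⟨F₂, c₂, hF₂, h₂, rfl⟩
    rw [Finset.disjoint_union_right] at hF₂
    exact .base ⟨F₁ ∪ F₂, c₁ + c₂, Finset.disjoint_union_left.2 ⟨hF₁, hF₂.1⟩,
      ⟨F₁, F₂, c₁, c₂, hF₂.2.symm, rfl, rfl, h₁, h₂⟩,
      conf_par_body hA hF₂.2.symm hF₁ hF₂.1 h₁ h₂⟩
  | res P ih =>
    obtain ⟨a, ha⟩ := Infinite.exists_notMem_finset A
    have h0 : (SProc.res P.cls).occ (e ⁻¹' {a}) = 0 :=
      occ_eq_zero_of_subset hA (Set.preimage_mono (by simpa using ha))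
    change Sums _ (SProc.res (P.cls.rename (lift 1 e)))
    rw [rename_envCons _ a e h0]
    refine (ih _ _ (occ_envCons_eq_zero hA a)).map (nu a) (nu_sup a) ?_
    rintro _ ⟨F, c, hF, h, rfl⟩
    rw [Finset.disjoint_insert_right] at hF
    refine .base ⟨insert a F, c, ?_, ⟨a, F, hF.1, rfl, h⟩, (nus_insert hF.1 _).symm⟩
    exact Finset.disjoint_insert_left.2 ⟨ha, hF.2⟩
  | choice P Q ih ih' =>
    obtain ⟨hP, hQ⟩ := Nat.max_eq_zero_iff.1 hA
    refine .sup ((ih e A hP).mono ?_) ((ih' e A hQ).mono ?_)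
    · rintro _ ⟨F, c, hF, h, rfl⟩
      exact ⟨F, c, hF, .inl h, rfl⟩
    · rintro _ ⟨F, c, hF, h, rfl⟩
      exact ⟨F, c, hF, .inr h, rfl⟩
  | nil => exact .base ⟨∅, _, by simp, ⟨rfl, rfl⟩, rfl⟩
  | _ => exact .base ⟨∅, _, by simp, ⟨rfl, rfl⟩, by rw [Config.body_singleton]; rfl⟩

theorem Conf.le {P : Proc} {e : ℕ → ℕ} {F : Finset ℕ} {c : Config} (h : Conf P e F c)
    {A : Finset ℕ} (hF : Disjoint F A) (hA : P.occ (e ⁻¹' (↑A)ᶜ) = 0) :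
    nus F c.body ≤ (P.rename e).cls := by
  induction P generalizing e F c A with
  | par P Q ih ih' =>
    obtain ⟨F₁, F₂, c₁, c₂, h12, rfl, rfl, h1, h2⟩ := h
    obtain ⟨hP, hQ⟩ := Nat.add_eq_zero_iff.1 hA
    rw [Finset.disjoint_union_left] at hF
    rw [← conf_par_body hA h12 hF.1 hF.2 h1 h2]
    exact add_le_add' (ih h1 hF.1 hP) (ih' h2 hF.2 hQ)
  | res P ih =>
    obtain ⟨a, F', ha, rfl, h⟩ := h
    rw [Finset.disjoint_insert_left] at hF
    have h0 : (SProc.res P.cls).occ (e ⁻¹' {a}) = 0 :=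
      occ_eq_zero_of_subset hA (Set.preimage_mono (by simpa using hF.1))
    change _ ≤ SProc.res (P.cls.rename (lift 1 e))
    rw [rename_envCons _ a e h0, nus_insert ha]
    exact nu_mono a (ih h (Finset.disjoint_insert_right.2 ⟨ha, hF.2⟩)
      (occ_envCons_eq_zero hA a))
  | choice P Q ih ih' =>
    obtain ⟨hP, hQ⟩ := Nat.max_eq_zero_iff.1 hA
    change _ ≤ (P.rename e).cls ⊔ (Q.rename e).cls
    rcases h with h | h
    · exact (ih h hF hP).trans le_sup_left
    · exact (ih' h hF hQ).trans le_sup_right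
  | nil =>
    obtain ⟨rfl, rfl⟩ := h
    exact le_rfl
  | _ =>
    obtain ⟨rfl, rfl⟩ := h
    rw [Config.body_singleton]
    exact le_rfl

/-- `c` is a configuration of `q` whose restricted names are not in `G`. -/
def SProc.HasConf (q : SProc) (G : Finset ℕ) (c : Config) : Prop :=
  ∃ P F, P.cls = q ∧ Disjoint F G ∧ Conf P id F c

theorem hasConf_cls {P : Proc} {G : Finset ℕ} {c : Config} :
    P.cls.HasConf G c ↔ ∃ F, Disjoint F G ∧ Conf P id F c := by
  constructor
  · rintro ⟨P', F, hP, hF, h⟩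
    exact h.of_sc (cls_eq.1 hP) hF
  · rintro ⟨F, hF, h⟩
    exact ⟨P, F, rfl, hF, h⟩

theorem hasConf_cls_rename {P : Proc} {e : ℕ → ℕ} {G : Finset ℕ} {c : Config} :
    (P.rename e).cls.HasConf G c ↔ ∃ F, Disjoint F G ∧ Conf P e F c := by
  simp only [hasConf_cls, conf_rename]
  rfl

/-! ### Redexes of configurations -/

/-- Two atoms with the common subject `x` interact. -/
inductive Contr : ℕ → Atom → Atom → SProc → Prop
  | comm (x : ℕ) (p q : SProc) : Contr x (.out x q) (.inp x p) (.res (q + p))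
  | close (x : ℕ) (p : SProc) : Contr x (.closeOut x) (.closeIn x p) p
  | some (x : ℕ) (w : Multiset ℕ) (p q : SProc) :
      Contr x (.someOut x p) (.someIn x w q) (p + q)
  | none (x : ℕ) (w : Multiset ℕ) (q : SProc) : Contr x (.noneOut x) (.someIn x w q) (SProc.nones w)

theorem Contr.red {x : ℕ} {a b : Atom} {q : SProc} (h : Contr x a b q) :
    SProc.Red (a.toSProc + b.toSProc) q := by
  cases h with
  | comm => exact .comm _ _ _
  | close => exact .close _ _
  | some => exact .some _ _ _ _
  | none => exact .none _ _ _

theorem Contr.rename {x : ℕ} {a b : Atom} {q : SProc} (h : Contr x a b q) (f : ℕ → ℕ) :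
    Contr (f x) (a.rename f) (b.rename f) (q.rename f) := by
  cases h with
  | comm => rw [rename_res, rename_add]; exact .comm _ _ _
  | close => exact .close _ _
  | some => rw [rename_add]; exact .some _ _ _ _
  | none => rw [SProc.nones_rename]; exact .none _ _ _

theorem Contr.unique {x : ℕ} {a b : Atom} {q q' : SProc} (h : Contr x a b q)
    (h' : Contr x a b q') : q = q' := by
  cases h <;> cases h' <;> rfl

theorem Contr.ne {x y : ℕ} {a b a' b' : Atom} {q q' : SProc} (h : Contr x a b q)
    (h' : Contr y a' b' q') : a ≠ b' := by
  cases h <;> cases h' <;> simp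

theorem Contr.subj_left {x y : ℕ} {a b b' : Atom} {q q' : SProc} (h : Contr x a b q)
    (h' : Contr y a b' q') : x = y := by
  cases h <;> cases h' <;> rfl

theorem Contr.subj_right {x y : ℕ} {a a' b : Atom} {q q' : SProc} (h : Contr x a b q)
    (h' : Contr y a' b q') : x = y := by
  cases h <;> cases h' <;> rfl

theorem Contr.ne_fwd {x : ℕ} {a b : Atom} {q : SProc} (h : Contr x a b q) (s : Sym2 ℕ) :
    a ≠ .fwd s ∧ b ≠ .fwd s := by
  cases h <;> simp

namespace SProc

@[simp] theorem occ_out (x : ℕ) (p : SProc) (s : Set ℕ) :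
    (out x p).occ s = max (Proc.ind s x) (p.occ ((· + 1) '' s)) := by
  induction p using SProc.ind; rfl

@[simp] theorem occ_inp (x : ℕ) (p : SProc) (s : Set ℕ) :
    (inp x p).occ s = max (Proc.ind s x) (p.occ ((· + 1) '' s)) := by
  induction p using SProc.ind; rfl

@[simp] theorem occ_closeIn (x : ℕ) (p : SProc) (s : Set ℕ) :
    (closeIn x p).occ s = max (Proc.ind s x) (p.occ s) := by
  induction p using SProc.ind; rfl

@[simp] theorem occ_someOut (x : ℕ) (p : SProc) (s : Set ℕ) :
    (someOut x p).occ s = max (Proc.ind s x) (p.occ s) := by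
  induction p using SProc.ind; rfl

@[simp] theorem occ_someIn (x : ℕ) (w : Multiset ℕ) (p : SProc) (s : Set ℕ) :
    (someIn x w p).occ s = max (max (Proc.ind s x) (cnt s w)) (p.occ s) := by
  induction p using SProc.ind; rfl

@[simp] theorem occ_closeOut (x : ℕ) (s : Set ℕ) : (closeOut x).occ s = Proc.ind s x := rfl

@[simp] theorem occ_noneOut (x : ℕ) (s : Set ℕ) : (noneOut x).occ s = Proc.ind s x := rfl

@[simp] theorem occ_fwd (x y : ℕ) (s : Set ℕ) :
    (fwd x y).occ s = max (Proc.ind s x) (Proc.ind s y) := rfl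

@[simp] theorem lin_out (x : ℕ) (p : SProc) : (out x p).lin ↔ p.lin ∧ p.occ {0} ≤ 1 := by
  induction p using SProc.ind; rfl

@[simp] theorem lin_inp (x : ℕ) (p : SProc) : (inp x p).lin ↔ p.lin ∧ p.occ {0} ≤ 1 := by
  induction p using SProc.ind; rfl

@[simp] theorem lin_closeIn (x : ℕ) (p : SProc) : (closeIn x p).lin ↔ p.lin := by
  induction p using SProc.ind; rfl

@[simp] theorem lin_someOut (x : ℕ) (p : SProc) : (someOut x p).lin ↔ p.lin := by
  induction p using SProc.ind; rfl

@[simp] theorem lin_someIn (x : ℕ) (w : Multiset ℕ) (p : SProc) :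
    (someIn x w p).lin ↔ p.lin := by
  induction p using SProc.ind; rfl

@[simp] theorem size_out (x : ℕ) (p : SProc) : (out x p).size = p.size + 1 := by
  induction p using SProc.ind; rfl

@[simp] theorem size_inp (x : ℕ) (p : SProc) : (inp x p).size = p.size + 1 := by
  induction p using SProc.ind; rfl

@[simp] theorem size_closeIn (x : ℕ) (p : SProc) : (closeIn x p).size = p.size + 1 := by
  induction p using SProc.ind; rfl

@[simp] theorem size_someOut (x : ℕ) (p : SProc) : (someOut x p).size = p.size + 1 := by
  induction p using SProc.ind; rfl

@[simp] theorem size_someIn (x : ℕ) (w : Multiset ℕ) (p : SProc) :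
    (someIn x w p).size = p.size + w.card + 1 := by
  induction p using SProc.ind; rfl

@[simp] theorem size_closeOut (x : ℕ) : (closeOut x).size = 1 := rfl

@[simp] theorem size_noneOut (x : ℕ) : (noneOut x).size = 1 := rfl

end SProc

theorem Contr.occ_le {x : ℕ} {a b : Atom} {q : SProc} (h : Contr x a b q) (s : Set ℕ) :
    q.occ s ≤ a.toSProc.occ s + b.toSProc.occ s := by
  cases h <;> simp [Atom.toSProc, SProc.occ_nones] <;> omega

theorem Contr.one_le_left {x : ℕ} {a b : Atom} {q : SProc} (h : Contr x a b q) :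
    1 ≤ a.toSProc.occ {x} := by
  cases h <;> simp [Atom.toSProc, Proc.ind]

theorem Contr.one_le_right {x : ℕ} {a b : Atom} {q : SProc} (h : Contr x a b q) :
    1 ≤ b.toSProc.occ {x} := by
  cases h <;> simp [Atom.toSProc, Proc.ind]

theorem Contr.lin {x : ℕ} {a b : Atom} {q : SProc} (h : Contr x a b q) (ha : a.toSProc.lin)
    (hb : b.toSProc.lin) : q.lin := by
  cases h with
  | comm p q =>
    simp only [Atom.toSProc, lin_out, lin_inp] at ha hb
    simp only [lin_res, lin_add, occ_add]
    exact ⟨⟨ha.1, hb.1⟩, by omega⟩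
  | close => exact (lin_closeIn _ _).1 hb
  | some => exact (lin_add _ _).2 ⟨(lin_someOut _ _).1 ha, (lin_someIn _ _ _).1 hb⟩
  | none => exact SProc.lin_nones _

theorem Contr.size_lt {x : ℕ} {a b : Atom} {q : SProc} (h : Contr x a b q) :
    q.size < a.toSProc.size + b.toSProc.size := by
  cases h <;> simp [Atom.toSProc, SProc.size_nones] <;> omega

/-- The renaming of `x` to `y`. -/
def repl (x y n : ℕ) : ℕ := if n = x then y else n

theorem repl_self (x y : ℕ) : repl x y x = y := if_pos rfl

theorem repl_of_ne {x n : ℕ} (h : n ≠ x) (y : ℕ) : repl x y n = n := if_neg h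

/-- `Fire A c T`: a redex of the configuration `c`, whose names outside of `A` are restricted,
with the set `T` of the configurations that arise from its reduction. -/
inductive Fire (A : Finset ℕ) : Config → Set Config → Prop
  | pair {x : ℕ} {a b : Atom} {q : SProc} {r : Config} {G : Finset ℕ} (h : Contr x a b q)
      (hA : A ⊆ G) (hG : (Config.body (a ::ₘ b ::ₘ r)).occ (↑G)ᶜ = 0) :
      Fire A (a ::ₘ b ::ₘ r) {c | ∃ d, q.HasConf G d ∧ c = d + r}
  | fwd {x y : ℕ} {r : Config} (hx : x ∉ A) (h : x ≠ y) :
      Fire A (.fwd s(x, y) ::ₘ r) {r.rename (repl x y)}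

theorem Fire.frame {A B : Finset ℕ} {c c₁ : Config} {T : Set Config} (h : Fire B c T)
    (hA : A ⊆ B) (hc : c₁.body.occ (↑B)ᶜ = 0) :
    ∃ T', Fire A (c₁ + c) T' ∧ ∀ d, d ∈ T' ↔ ∃ d' ∈ T, d = c₁ + d' := by
  cases h with
  | @pair x a b q r G h hB hG =>
    have hcG : c₁.body.occ (↑G)ᶜ = 0 :=
      SProc.occ_eq_zero_of_subset hc (Set.compl_subset_compl.2 (Finset.coe_subset.2 hB))
    have e : c₁ + a ::ₘ b ::ₘ r = a ::ₘ b ::ₘ (c₁ + r) := by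
      rw [Multiset.add_cons, Multiset.add_cons]
    rw [e]
    refine ⟨_, .pair h (hA.trans hB) ?_, fun d => ?_⟩
    · simp only [Config.body_cons, Config.body_add, occ_add] at hG ⊢
      omega
    · constructor
      · rintro ⟨d', hd, rfl⟩
        exact ⟨_, ⟨d', hd, rfl⟩, add_left_comm _ _ _⟩
      · rintro ⟨_, ⟨d', hd, rfl⟩, rfl⟩
        exact ⟨d', hd, add_left_comm _ _ _⟩
  | @fwd x y r hx h =>
    rw [Multiset.add_cons]
    refine ⟨_, .fwd (fun hxA => hx (hA hxA)) h, fun d => ?_⟩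
    have : c₁.rename (repl x y) = c₁ := by
      refine Config.rename_eq_self _ (SProc.occ_eq_zero_of_subset hc fun n hn => ?_)
      have : n = x := by
        by_contra hnx
        exact hn (repl_of_ne hnx y)
      simpa [this] using hx
    simp [this]

theorem Fire.of_contr {A : Finset ℕ} {x : ℕ} {a b : Atom} {R : Proc} {e : ℕ → ℕ}
    (h : Contr x a b (R.rename e).cls) (hA : (Config.body ({a} + {b})).occ (↑A)ᶜ = 0) :
    ∃ T, Fire A ({a} + {b}) T ∧ ∀ d, d ∈ T ↔ ∃ F, Disjoint F A ∧ Conf R e F d := by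
  have e1 : ({a} + {b} : Config) = a ::ₘ b ::ₘ 0 := rfl
  rw [e1] at hA ⊢
  refine ⟨_, .pair h subset_rfl hA, fun d => ?_⟩
  rw [← hasConf_cls_rename]
  simp

theorem conf_forw {P : Proc} {y a : ℕ} {e : ℕ → ℕ} {A F : Finset ℕ}
    (hA : (Proc.res (.par (.fwd 0 (y + 1)) P)).occ (e ⁻¹' (↑A)ᶜ) = 0) (ha : a ∉ A)
    {d : Config} (haF : a ∉ F) :
    Conf (P.rename (inst y)) e F d ↔
      ∃ c, Conf P (envCons a e) F c ∧ d = c.rename (repl a (e y)) := by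
  have hfix : ∀ b ∈ F, repl a (e y) b = b := fun b hb =>
    repl_of_ne (fun h => haF (by rwa [← h])) _
  have hz : P.occ {n | (e ∘ inst y) n ≠ (repl a (e y) ∘ envCons a e) n} = 0 := by
    refine occ_eq_zero_of_subset (Nat.add_eq_zero_iff.1 hA).2 fun n hn => ?_
    cases n with
    | zero => simp [inst, envCons, repl] at hn
    | succ n =>
      refine ⟨n, fun h => hn ?_, rfl⟩
      exact (repl_of_ne (x := a) (n := e n) (fun h' => ha (by simpa [h'] using h)) _).symm
  rw [conf_rename]
  constructor
  · intro h
    exact (h.congr hz).exists_of_comp hfix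
  · rintro ⟨c, hc, rfl⟩
    have h := hc.map (f := repl a (e y))
      (fun b hb b' hb' h => by rwa [hfix b hb, hfix b' hb'] at h)
    have himg : F.image (repl a (e y)) = F := by
      rw [Finset.image_congr (g := id) fun b hb => hfix b hb, Finset.image_id]
    rw [himg] at h
    refine h.congr ?_
    simpa only [ne_comm] using hz

/-- A reduction of a process either leaves a configuration alone or contracts a redex. -/
theorem Red.conf_forward {P Q : Proc} (h : Red P Q) {e : ℕ → ℕ} {A F : Finset ℕ} {c : Config}
    (hA : P.occ (e ⁻¹' (↑A)ᶜ) = 0) (hF : Disjoint F A) (hc : Conf P e F c) :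
    (∃ F', Disjoint F' A ∧ Conf Q e F' c) ∨
      ∃ T, Fire A c T ∧ ∀ d ∈ T, ∃ F', Disjoint F' A ∧ Conf Q e F' d := by
  have base {e : ℕ → ℕ} {A : Finset ℕ} {x : ℕ} {P Q R : Proc} {a b : Atom}
      (hA : (P.par Q).occ (e ⁻¹' (↑A)ᶜ) = 0)
      (h : Conf (P.par Q) e ∅ ({a} + {b})) (hR : Contr x a b (R.rename e).cls) :
      ∃ T, Fire A ({a} + {b}) T ∧ ∀ d ∈ T, ∃ F', Disjoint F' A ∧ Conf R e F' d := by
    obtain ⟨T, hT, h'⟩ := Fire.of_contr hR (h.occ_eq_zero (by simp) hA disjoint_compl_left)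
    exact ⟨T, hT, fun d hd => (h' d).1 hd⟩
  induction h generalizing e A F c with
  | comm x P Q =>
    obtain ⟨F₁, F₂, c₁, c₂, h12, rfl, rfl, ⟨rfl, rfl⟩, rfl, rfl⟩ := hc
    exact .inr (base hA ⟨∅, ∅, _, _, by simp, rfl, rfl, ⟨rfl, rfl⟩, rfl, rfl⟩ (.comm _ _ _))
  | close x P =>
    obtain ⟨F₁, F₂, c₁, c₂, h12, rfl, rfl, ⟨rfl, rfl⟩, rfl, rfl⟩ := hc
    exact .inr (base hA ⟨∅, ∅, _, _, by simp, rfl, rfl, ⟨rfl, rfl⟩, rfl, rfl⟩ (.close _ _))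
  | some x w P Q =>
    obtain ⟨F₁, F₂, c₁, c₂, h12, rfl, rfl, ⟨rfl, rfl⟩, rfl, rfl⟩ := hc
    exact .inr (base hA ⟨∅, ∅, _, _, by simp, rfl, rfl, ⟨rfl, rfl⟩, rfl, rfl⟩
      (.some _ _ _ _))
  | none x l Q =>
    obtain ⟨F₁, F₂, c₁, c₂, h12, rfl, rfl, ⟨rfl, rfl⟩, rfl, rfl⟩ := hc
    refine .inr (base (x := e x) hA
      ⟨∅, ∅, _, _, by simp, rfl, rfl, ⟨rfl, rfl⟩, rfl, rfl⟩ ?_)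
    rw [nones_rename, cls_nones]
    exact .none _ _ _
  | forw y P =>
    obtain ⟨a, F', ha, rfl, F₁, F₂, c₁, c₂, h12, rfl, rfl, ⟨rfl, rfl⟩, h⟩ := hc
    rw [Finset.disjoint_insert_left] at hF
    simp only [Finset.empty_union] at ha hF
    have hy : e y ∈ A := by
      by_contra hy
      have := (Nat.max_eq_zero_iff.1 (Nat.add_eq_zero_iff.1 hA).1).2
      rw [ind_eq_zero] at this
      exact this ⟨y, hy, rfl⟩
    refine .inr ⟨_, .fwd (x := a) (y := e y) hF.1 fun h => hF.1 (by rwa [h]), ?_⟩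
    rintro _ rfl
    exact ⟨F₂, hF.2, (conf_forw hA hF.1 ha).2 ⟨c₂, h, rfl⟩⟩
  | cong P P' Q Q' h _ h' ih =>
    obtain ⟨F₁, hF₁, hc₁⟩ := hc.of_sc h hF
    rcases ih (h.occ_eq _ ▸ hA) hF₁ hc₁ with ⟨F₂, hF₂, hc₂⟩ | ⟨T, hT, hd⟩
    · exact .inl (hc₂.of_sc h' hF₂)
    · refine .inr ⟨T, hT, fun d hdT => ?_⟩
      obtain ⟨F₂, hF₂, hc₂⟩ := hd d hdT
      exact hc₂.of_sc h' hF₂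
  | par P Q Q' _ ih =>
    obtain ⟨F₁, F₂, c₁, c₂, h12, rfl, rfl, h1, h2⟩ := hc
    obtain ⟨hP, hQ⟩ := Nat.add_eq_zero_iff.1 hA
    rw [Finset.disjoint_union_left] at hF
    have hQ' : Q.occ (e ⁻¹' (↑(A ∪ F₁))ᶜ) = 0 :=
      occ_eq_zero_of_subset hQ (Set.preimage_mono (Set.compl_subset_compl.2 (by simp)))
    have mk {d : Config} {F : Finset ℕ} (hF' : Disjoint F (A ∪ F₁)) (hd : Conf Q' e F d) :
        ∃ F', Disjoint F' A ∧ Conf (P.par Q') e F' (c₁ + d) := by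
      rw [Finset.disjoint_union_right] at hF'
      exact ⟨F₁ ∪ F, Finset.disjoint_union_left.2 ⟨hF.1, hF'.1⟩, F₁, F, c₁, d, hF'.2.symm,
        rfl, rfl, h1, hd⟩
    rcases ih hQ' (Finset.disjoint_union_right.2 ⟨hF.2, h12.symm⟩) h2
      with ⟨F', hF', h⟩ | ⟨T, hT, hd⟩
    · exact .inl (mk hF' h)
    · obtain ⟨T', hT', h'⟩ := hT.frame (A := A) (c₁ := c₁) Finset.subset_union_left
        (by simpa using h1.cover hP)
      refine .inr ⟨T', hT', fun d hdT => ?_⟩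
      obtain ⟨d', hd', rfl⟩ := (h' d).1 hdT
      obtain ⟨F', hF', h⟩ := hd d' hd'
      exact mk hF' h
  | res P Q _ ih =>
    obtain ⟨a, F', ha, rfl, h⟩ := hc
    rw [Finset.disjoint_insert_left] at hF
    have mk {d : Config} {F : Finset ℕ} (hF' : Disjoint F (insert a A))
        (hd : Conf Q (envCons a e) F d) : ∃ F', Disjoint F' A ∧ Conf Q.res e F' d := by
      rw [Finset.disjoint_insert_right] at hF'
      exact ⟨insert a F, Finset.disjoint_insert_left.2 ⟨hF.1, hF'.2⟩, a, F, hF'.1, rfl, hd⟩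
    rcases ih (occ_envCons_eq_zero hA a) (Finset.disjoint_insert_right.2 ⟨ha, hF.2⟩) h
      with ⟨F', hF', h⟩ | ⟨T, hT, hd⟩
    · exact .inl (mk hF' h)
    · obtain ⟨T', hT', h'⟩ := hT.frame (A := A) (c₁ := 0) (Finset.subset_insert _ _) rfl
      rw [zero_add] at hT'
      refine .inr ⟨T', hT', fun d hdT => ?_⟩
      obtain ⟨d', hd', rfl⟩ := (h' d).1 hdT
      obtain ⟨F', hF', h⟩ := hd d' hd'
      rw [zero_add]
      exact mk hF' h
  | choice P Q Q' _ ih =>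
    rcases hc with hc | hc
    · exact .inl ⟨F, hF, .inl hc⟩
    · rcases ih (Nat.max_eq_zero_iff.1 hA).2 hF hc with ⟨F', hF', h⟩ | ⟨T, hT, hd⟩
      · exact .inl ⟨F', hF', .inr h⟩
      · refine .inr ⟨T, hT, fun d hdT => ?_⟩
        obtain ⟨F', hF', h⟩ := hd d hdT
        exact ⟨F', hF', .inr h⟩

/-- A configuration of a reduct is a configuration of the process or arises from one of them
by contraction of a redex. -/
theorem Red.conf_backward {P Q : Proc} (h : Red P Q) {e : ℕ → ℕ} {A F : Finset ℕ} {d : Config}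
    (hA : P.occ (e ⁻¹' (↑A)ᶜ) = 0) (hF : Disjoint F A) (hd : Conf Q e F d) :
    (∃ F', Disjoint F' A ∧ Conf P e F' d) ∨
      ∃ F' c T, Disjoint F' A ∧ Conf P e F' c ∧ Fire A c T ∧ d ∈ T := by
  have base {e : ℕ → ℕ} {A F : Finset ℕ} {d : Config} {x : ℕ} {P Q R : Proc} {a b : Atom}
      (hF : Disjoint F A) (hd : Conf R e F d) (hA : (P.par Q).occ (e ⁻¹' (↑A)ᶜ) = 0)
      (h : Conf (P.par Q) e ∅ ({a} + {b})) (hR : Contr x a b (R.rename e).cls) :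
      ∃ F' c T, Disjoint F' A ∧ Conf (P.par Q) e F' c ∧ Fire A c T ∧ d ∈ T := by
    obtain ⟨T, hT, h'⟩ := Fire.of_contr hR (h.occ_eq_zero (by simp) hA disjoint_compl_left)
    exact ⟨_, _, T, by simp, h, hT, (h' d).2 ⟨F, hF, hd⟩⟩
  induction h generalizing e A F d with
  | comm x P Q =>
    exact .inr (base hF hd hA ⟨∅, ∅, _, _, by simp, rfl, rfl, ⟨rfl, rfl⟩, rfl, rfl⟩
      (.comm _ _ _))
  | close x P =>
    exact .inr (base hF hd hA ⟨∅, ∅, _, _, by simp, rfl, rfl, ⟨rfl, rfl⟩, rfl, rfl⟩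
      (.close _ _))
  | some x w P Q =>
    exact .inr (base hF hd hA ⟨∅, ∅, _, _, by simp, rfl, rfl, ⟨rfl, rfl⟩, rfl, rfl⟩
      (.some _ _ _ _))
  | none x l Q =>
    refine .inr (base (x := e x) hF hd hA
      ⟨∅, ∅, _, _, by simp, rfl, rfl, ⟨rfl, rfl⟩, rfl, rfl⟩ ?_)
    rw [nones_rename, cls_nones]
    exact .none _ _ _
  | forw y P =>
    obtain ⟨a, ha⟩ := Infinite.exists_notMem_finset (A ∪ F)
    rw [Finset.mem_union, not_or] at ha
    have hy : e y ∈ A := by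
      by_contra hy
      have := (Nat.max_eq_zero_iff.1 (Nat.add_eq_zero_iff.1 hA).1).2
      rw [ind_eq_zero] at this
      exact this ⟨y, hy, rfl⟩
    obtain ⟨c, hc, rfl⟩ := (conf_forw hA ha.1 ha.2).1 hd
    refine .inr ⟨insert a F, _, _, Finset.disjoint_insert_left.2 ⟨ha.1, hF⟩,
      ⟨a, F, ha.2, rfl, ∅, F, _, c, by simp, by simp, rfl, ⟨rfl, rfl⟩, hc⟩,
      .fwd (x := a) (y := e y) ha.1 fun h => ha.1 (by rwa [h]), rfl⟩
  | cong P P' Q Q' h _ h' ih =>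
    obtain ⟨F₁, hF₁, hd₁⟩ := hd.of_sc h'.symm hF
    rcases ih (h.occ_eq _ ▸ hA) hF₁ hd₁ with ⟨F₂, hF₂, hc⟩ | ⟨F₂, c, T, hF₂, hc, hT⟩
    · exact .inl (hc.of_sc h.symm hF₂)
    · obtain ⟨F₃, hF₃, hc⟩ := hc.of_sc h.symm hF₂
      exact .inr ⟨F₃, c, T, hF₃, hc, hT⟩
  | par P Q Q' _ ih =>
    obtain ⟨F₁, F₂, c₁, c₂, h12, rfl, rfl, h1, h2⟩ := hd
    obtain ⟨hP, hQ⟩ := Nat.add_eq_zero_iff.1 hA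
    rw [Finset.disjoint_union_left] at hF
    have hQ' : Q.occ (e ⁻¹' (↑(A ∪ F₁))ᶜ) = 0 :=
      occ_eq_zero_of_subset hQ (Set.preimage_mono (Set.compl_subset_compl.2 (by simp)))
    have mk {d : Config} {F : Finset ℕ} (hF' : Disjoint F (A ∪ F₁)) (hd : Conf Q e F d) :
        ∃ F', Disjoint F' A ∧ Conf (P.par Q) e F' (c₁ + d) := by
      rw [Finset.disjoint_union_right] at hF'
      exact ⟨F₁ ∪ F, Finset.disjoint_union_left.2 ⟨hF.1, hF'.1⟩, F₁, F, c₁, d, hF'.2.symm,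
        rfl, rfl, h1, hd⟩
    rcases ih hQ' (Finset.disjoint_union_right.2 ⟨hF.2, h12.symm⟩) h2
      with ⟨F', hF', h⟩ | ⟨F', c, T, hF', h, hT, hd⟩
    · exact .inl (mk hF' h)
    · obtain ⟨F₃, hF₃, hc⟩ := mk hF' h
      obtain ⟨T', hT', h'⟩ := hT.frame (A := A) (c₁ := c₁) Finset.subset_union_left
        (by simpa using h1.cover hP)
      exact .inr ⟨F₃, _, T', hF₃, hc, hT', (h' _).2 ⟨_, hd, rfl⟩⟩
  | res P Q _ ih =>
    obtain ⟨a, F', ha, rfl, h⟩ := hd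
    rw [Finset.disjoint_insert_left] at hF
    have mk {d : Config} {F : Finset ℕ} (hF' : Disjoint F (insert a A))
        (hd : Conf P (envCons a e) F d) : ∃ F', Disjoint F' A ∧ Conf P.res e F' d := by
      rw [Finset.disjoint_insert_right] at hF'
      exact ⟨insert a F, Finset.disjoint_insert_left.2 ⟨hF.1, hF'.2⟩, a, F, hF'.1, rfl, hd⟩
    rcases ih (occ_envCons_eq_zero hA a) (Finset.disjoint_insert_right.2 ⟨ha, hF.2⟩) h
      with ⟨F', hF', h⟩ | ⟨F', c, T, hF', h, hT, hd⟩
    · exact .inl (mk hF' h)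
    · obtain ⟨F₃, hF₃, hc⟩ := mk hF' h
      obtain ⟨T', hT', h'⟩ := hT.frame (A := A) (c₁ := 0) (Finset.subset_insert _ _) rfl
      rw [zero_add] at hT'
      exact .inr ⟨F₃, _, T', hF₃, hc, hT', (h' _).2 ⟨_, hd, (zero_add _).symm⟩⟩
  | choice P Q Q' _ ih =>
    rcases hd with hd | hd
    · exact .inl ⟨F, hF, .inl hd⟩
    · rcases ih (Nat.max_eq_zero_iff.1 hA).2 hF hd with ⟨F', hF', h⟩ | ⟨F', c, T, hF', h, hT⟩
      · exact .inl ⟨F', hF', .inr h⟩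
      · exact .inr ⟨F', c, T, hF', .inr h, hT⟩

end Proc

namespace Proc

open ShLam SProc

theorem exists_perm_disjoint (F G₀ G₁ : Finset ℕ) (h : Disjoint F G₀) :
    ∃ π : Equiv.Perm ℕ, (∀ g ∈ G₀, π g = g) ∧ Disjoint (F.image π) G₁ := by
  induction F using Finset.induction generalizing G₀ with
  | empty => exact ⟨1, fun _ _ => rfl, by simp⟩
  | insert a F ha ih =>
    rw [Finset.disjoint_insert_left] at h
    obtain ⟨π, h₀, h₁⟩ := ih (insert a G₀) (Finset.disjoint_insert_right.2 ⟨ha, h.2⟩)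
    obtain ⟨b, hb⟩ := Infinite.exists_notMem_finset (insert a (G₀ ∪ G₁ ∪ F.image π))
    simp only [Finset.mem_insert, Finset.mem_union, not_or] at hb
    refine ⟨π.trans (Equiv.swap a b), fun g hg => ?_, ?_⟩
    · rw [Equiv.trans_apply, h₀ g (by simp [hg]), Equiv.swap_apply_of_ne_of_ne]
      · rintro rfl; exact h.1 hg
      · rintro rfl; exact hb.2.1.1 hg
    · rw [Finset.disjoint_left] at h₁ ⊢
      intro x hx
      simp only [Finset.mem_image, Finset.mem_insert] at hx
      obtain ⟨n, rfl | hn, rfl⟩ := hx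
      · rw [Equiv.trans_apply, h₀ n (by simp), Equiv.swap_apply_left]
        exact hb.2.1.2
      · rw [Equiv.trans_apply, Equiv.swap_apply_of_ne_of_ne]
        · exact h₁ (Finset.mem_image_of_mem _ hn)
        · intro hna
          rw [← h₀ a (by simp)] at hna
          exact ha (π.injective hna ▸ hn)
        · rintro rfl
          exact hb.2.2 (Finset.mem_image_of_mem _ hn)

theorem SProc.HasConf.rename {q : SProc} {G : Finset ℕ} {d : Config} (h : q.HasConf G d)
    (π : Equiv.Perm ℕ) : (q.rename π).HasConf (G.image π) (d.rename π) := by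
  obtain ⟨P, F, rfl, hF, h⟩ := h
  refine ⟨P.rename π, F.image π, rfl, ?_, ?_⟩
  · rwa [Finset.disjoint_image π.injective]
  · rw [conf_rename]
    exact h.map (f := π) π.injective.injOn

theorem SProc.HasConf.mono {q : SProc} {G G' : Finset ℕ} {d : Config} (h : q.HasConf G d)
    (hG : G' ⊆ G) : q.HasConf G' d := by
  obtain ⟨P, F, hP, hF, h⟩ := h
  exact ⟨P, F, hP, hF.mono_right hG, h⟩

theorem SProc.HasConf.refresh {q : SProc} {G G₁ : Finset ℕ} {d : Config} (h : q.HasConf G d)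
    (hq : q.occ (↑G)ᶜ = 0) :
    ∃ π : Equiv.Perm ℕ, (∀ g ∈ G, π g = g) ∧ q.HasConf G₁ (d.rename π) := by
  obtain ⟨P, F, rfl, hF, h⟩ := h
  obtain ⟨π, h₀, h₁⟩ := exists_perm_disjoint F G G₁ hF
  refine ⟨π, h₀, P, F.image π, rfl, h₁, ?_⟩
  refine (h.map (f := π) π.injective.injOn).congr (occ_eq_zero_of_subset hq fun n hn hG => ?_)
  exact hn (h₀ n hG)

/-! ### Configurations up to permutations of the restricted names -/

/-- `c` and `d` differ by a permutation of the names outside of `A`. -/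
def Sim (A : Finset ℕ) (c d : Config) : Prop :=
  ∃ π : Equiv.Perm ℕ, (∀ a ∈ A, π a = a) ∧ d = c.rename π

theorem Sim.refl (A : Finset ℕ) (c : Config) : Sim A c c :=
  ⟨1, fun _ _ => rfl, (Config.rename_id c).symm⟩

theorem perm_inv {A : Finset ℕ} {π : Equiv.Perm ℕ} (hπ : ∀ a ∈ A, π a = a) :
    ∀ a ∈ A, π.symm a = a := fun a ha => by
  rw [Equiv.symm_apply_eq, hπ a ha]

theorem rename_perm_symm (c : Config) (π : Equiv.Perm ℕ) : (c.rename π).rename π.symm = c := by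
  rw [Config.rename_rename]
  convert Config.rename_id c
  ext n
  simp

theorem SProc.rename_perm_symm (p : SProc) (π : Equiv.Perm ℕ) :
    (p.rename π).rename π.symm = p := by
  rw [SProc.rename_rename]
  convert SProc.rename_id p
  ext n
  simp

theorem Sim.symm {A : Finset ℕ} {c d : Config} (h : Sim A c d) : Sim A d c := by
  obtain ⟨π, hπ, rfl⟩ := h
  exact ⟨π.symm, perm_inv hπ, (rename_perm_symm c π).symm⟩

theorem Sim.trans {A : Finset ℕ} {c d e : Config} (h : Sim A c d) (h' : Sim A d e) :
    Sim A c e := by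
  obtain ⟨π, hπ, rfl⟩ := h
  obtain ⟨π', hπ', rfl⟩ := h'
  exact ⟨π.trans π', fun a ha => by simp [hπ a ha, hπ' a ha], Config.rename_rename _ _ _⟩

theorem Fire.perm {A : Finset ℕ} {c : Config} {T : Set Config} (h : Fire A c T)
    {π : Equiv.Perm ℕ} (hπ : ∀ a ∈ A, π a = a) :
    ∃ T', Fire A (c.rename π) T' ∧ ∀ d, d ∈ T' ↔ ∃ d' ∈ T, d = d'.rename π := by
  cases h with
  | @pair x a b q r G h hA hG =>
    rw [Config.rename_cons, Config.rename_cons]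
    refine ⟨_, .pair (G := G.image π) (h.rename π) ?_ ?_, fun d => ?_⟩
    · intro a ha
      rw [← hπ a ha]
      exact Finset.mem_image_of_mem _ (hA ha)
    · rw [← Config.rename_cons, ← Config.rename_cons, Config.body_rename, SProc.occ_rename]
      convert hG using 2
      ext n
      simp
    · constructor
      · rintro ⟨d', hd, rfl⟩
        refine ⟨_, ⟨d'.rename π.symm, ?_, rfl⟩, ?_⟩
        · have := hd.rename π.symm
          rwa [SProc.rename_perm_symm, Finset.image_image, Equiv.symm_comp_self,
            Finset.image_id] at this
        · rw [Config.rename_add, ← Equiv.symm_symm π, Equiv.symm_symm π]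
          congr 1
          exact (rename_perm_symm d' π.symm).symm
      · rintro ⟨_, ⟨d', hd, rfl⟩, rfl⟩
        exact ⟨_, hd.rename π, Config.rename_add _ _ _⟩
  | @fwd x y r hx h =>
    rw [Config.rename_cons]
    refine ⟨_, .fwd (x := π x) (y := π y) (fun hxA => hx ?_) (fun h' => h (π.injective h')),
      fun d => ?_⟩
    · have := perm_inv hπ _ hxA
      rw [Equiv.symm_apply_apply] at this
      exact this ▸ hxA
    · have : repl (π x) (π y) ∘ π = π ∘ repl x y := by
        funext n
        by_cases hn : n = x <;> simp [repl, hn]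
      simp [Config.rename_rename, this]

/-- One reduction step of configurations. -/
def Step (A : Finset ℕ) (c d : Config) : Prop := ∃ T, Fire A c T ∧ d ∈ T

theorem Step.pair {A : Finset ℕ} {x : ℕ} {a b : Atom} {q : SProc} {r d : Config}
    {G : Finset ℕ} (h : Contr x a b q) (hA : A ⊆ G)
    (hG : (Config.body (a ::ₘ b ::ₘ r)).occ (↑G)ᶜ = 0) (hd : q.HasConf G d) :
    Step A (a ::ₘ b ::ₘ r) (d + r) := ⟨_, .pair h hA hG, d, hd, rfl⟩

theorem Step.fwd {A : Finset ℕ} {x y : ℕ} (hx : x ∉ A) (h : x ≠ y) (r : Config) :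
    Step A (.fwd s(x, y) ::ₘ r) (r.rename (repl x y)) := ⟨_, .fwd hx h, rfl⟩

/-- A configuration without redexes. -/
def Normal (A : Finset ℕ) (c : Config) : Prop := ∀ T, ¬ Fire A c T

/-- `n` is a normal form of `c`, up to a permutation of restricted names. -/
def NF (A : Finset ℕ) (c n : Config) : Prop :=
  ∃ d, ReflTransGen (Step A) c d ∧ Normal A d ∧ Sim A d n

theorem Step.perm {A : Finset ℕ} {c d : Config} (h : Step A c d)
    {π : Equiv.Perm ℕ} (hπ : ∀ a ∈ A, π a = a) : Step A (c.rename π) (d.rename π) := by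
  obtain ⟨T, hT, hd⟩ := h
  obtain ⟨T', hT', h'⟩ := hT.perm hπ
  exact ⟨T', hT', (h' _).2 ⟨d, hd, rfl⟩⟩

theorem Normal.perm {A : Finset ℕ} {c : Config} (h : Normal A c)
    {π : Equiv.Perm ℕ} (hπ : ∀ a ∈ A, π a = a) : Normal A (c.rename π) := by
  intro T hT
  obtain ⟨T', hT', -⟩ := hT.perm (perm_inv hπ)
  rw [rename_perm_symm] at hT'
  exact h _ hT'

theorem Normal.sim {A : Finset ℕ} {c d : Config} (h : Normal A c) (h' : Sim A c d) :
    Normal A d := by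
  obtain ⟨π, hπ, rfl⟩ := h'
  exact h.perm hπ

theorem NF.of_sim {A : Finset ℕ} {c c' n : Config} (h : NF A c n) (hc : Sim A c c') :
    NF A c' n := by
  obtain ⟨π, hπ, rfl⟩ := hc
  obtain ⟨d, hd, hn, hs⟩ := h
  refine ⟨d.rename π, hd.lift _ fun _ _ h => h.perm hπ, hn.perm hπ, ?_⟩
  exact Sim.trans (Sim.symm ⟨π, hπ, rfl⟩) hs

theorem NF.head {A : Finset ℕ} {c d n : Config} (h : Step A c d) (h' : NF A d n) : NF A c n := by
  obtain ⟨e, he, hn⟩ := h'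
  exact ⟨e, he.head h, hn⟩

/-! ### Confluence -/

/-- Every name is used by at most two atoms, and the atoms are linear. -/
def LinC (c : Config) : Prop := (∀ n, c.body.occ {n} ≤ 2) ∧ ∀ a ∈ c, a.toSProc.lin

theorem repl_preimage_subset (x y n : ℕ) :
    repl x y ⁻¹' {n} ⊆ {m | m = n ∧ n ≠ x ∨ m = x ∧ n = y} := by
  intro m hm
  simp only [repl, Set.mem_preimage, Set.mem_singleton_iff] at hm
  by_cases h : m = x
  · rw [if_pos h] at hm
    exact .inr ⟨h, hm.symm⟩
  · rw [if_neg h] at hm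
    exact .inl ⟨hm, hm ▸ h⟩

theorem LinC.fire {A : Finset ℕ} {c d : Config} {T : Set Config} (hc : LinC c) (h : Fire A c T)
    (hd : d ∈ T) : LinC d := by
  cases h with
  | @pair x a b q r G h hA hG =>
    obtain ⟨d, ⟨P, F, rfl, hF, hd⟩, rfl⟩ := hd
    have hq := h.occ_le
    simp only [LinC, Config.body_cons, occ_add, Multiset.mem_cons] at hc hG ⊢
    have hP : (Proc.cls P).occ (id ⁻¹' F) = 0 := by
      have := hq (↑G)ᶜ
      refine SProc.occ_eq_zero_of_subset (t := (↑G)ᶜ) (by omega) fun n hn hG => ?_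
      exact Finset.disjoint_left.1 hF hn hG
    obtain ⟨l1, l2⟩ := hd.lin (h.lin (hc.2 _ (by simp)) (hc.2 _ (by simp))) hP
    refine ⟨fun n => ?_, fun a ha => ?_⟩
    · rw [Config.body_add, occ_add]
      by_cases hn : n ∈ F
      · have hnG : {n} ⊆ (↑G : Set ℕ)ᶜ := by
          simpa using Finset.disjoint_left.1 hF hn
        have h0 : r.body.occ {n} = 0 := SProc.occ_eq_zero_of_subset (by omega) hnG
        have := l1 n hn
        omega
      · have h1 := hd.occ_le (s := {n}) (by simpa using hn)
        have h2 := hq {n}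
        have h3 := hc.1 n
        change _ ≤ (Proc.cls P).occ {n} at h1
        omega
    · rcases Multiset.mem_add.1 ha with ha | ha
      · exact l2 a ha
      · exact hc.2 a (.inr (.inr ha))
  | @fwd x y r hx h =>
    rw [Set.mem_singleton_iff] at hd
    subst hd
    obtain ⟨h1, h2⟩ := hc
    refine ⟨fun n => ?_, fun a ha => ?_⟩
    · rw [Config.body_rename, SProc.occ_rename]
      refine (SProc.occ_mono _ (repl_preimage_subset x y n)).trans ?_
      have hm := h1 n
      have hx := h1 x
      rw [Config.body_cons, occ_add] at hm hx
      by_cases hny : n = y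
      · subst hny
        have e1 : Proc.ind {n} n = 1 := by simp [Proc.ind]
        have e2 : Proc.ind {x} x = 1 := by simp [Proc.ind]
        have e3 : (Atom.fwd s(x, n)).toSProc.occ {n} = max (Proc.ind {n} x) (Proc.ind {n} n) :=
          rfl
        have e4 : (Atom.fwd s(x, n)).toSProc.occ {x} = max (Proc.ind {x} x) (Proc.ind {x} n) :=
          rfl
        refine (SProc.occ_mono _ (t := {n} ∪ {x}) ?_).trans
          ((SProc.occ_union _ _ _).trans (by omega))
        rintro m (⟨h, _⟩ | ⟨h, _⟩) <;> simp [h]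
      · refine (SProc.occ_mono _ (t := {n}) ?_).trans (by omega)
        rintro m (⟨h, _⟩ | ⟨_, h⟩)
        · exact h
        · exact absurd h hny
    · simp only [Config.rename, Multiset.mem_map] at ha
      obtain ⟨a, ha, rfl⟩ := ha
      have := h2 a (by simp [ha])
      rw [Atom.toSProc_rename]
      generalize a.toSProc = p at this
      induction p using SProc.ind
      exact (Proc.lin_rename _ _).2 this

theorem occ_le_of_mem {c : Config} {a : Atom} (h : a ∈ c) (s : Set ℕ) :
    a.toSProc.occ s ≤ c.body.occ s := by
  obtain ⟨d, rfl⟩ := Multiset.exists_cons_of_mem h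
  rw [Config.body_cons, occ_add]
  exact Nat.le_add_right _ _

theorem cons_cons_eq {a₁ b₁ a₂ b₂ : Atom} {r₁ r₂ : Config}
    (h : a₁ ::ₘ b₁ ::ₘ r₁ = a₂ ::ₘ b₂ ::ₘ r₂) (h1 : a₁ ≠ a₂) (h2 : a₁ ≠ b₂) (h3 : b₁ ≠ a₂)
    (h4 : b₁ ≠ b₂) : ∃ r, r₁ = a₂ ::ₘ b₂ ::ₘ r ∧ r₂ = a₁ ::ₘ b₁ ::ₘ r := by
  have ha : a₂ ∈ r₁ := by
    have : a₂ ∈ a₁ ::ₘ b₁ ::ₘ r₁ := h ▸ Multiset.mem_cons_self _ _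
    simpa [h1.symm, h3.symm] using this
  obtain ⟨r, rfl⟩ := Multiset.exists_cons_of_mem ha
  have e : a₁ ::ₘ b₁ ::ₘ r = b₂ ::ₘ r₂ := by
    rw [Multiset.cons_swap b₁, Multiset.cons_swap a₁, Multiset.cons_inj_right] at h
    exact h
  have hb : b₂ ∈ r := by
    have : b₂ ∈ a₁ ::ₘ b₁ ::ₘ r := e ▸ Multiset.mem_cons_self _ _
    simpa [h2.symm, h4.symm] using this
  obtain ⟨r, rfl⟩ := Multiset.exists_cons_of_mem hb
  rw [Multiset.cons_swap b₁, Multiset.cons_swap a₁, Multiset.cons_inj_right] at e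
  exact ⟨r, rfl, e.symm⟩

theorem occ_fwd_left (x y : ℕ) : 1 ≤ (Atom.fwd s(x, y)).toSProc.occ {x} := by
  have e : (Atom.fwd s(x, y)).toSProc.occ {x} = max (Proc.ind {x} x) (Proc.ind {x} y) := rfl
  have e1 : Proc.ind {x} x = 1 := by simp [Proc.ind]
  omega

theorem occ_fwd_right (x y : ℕ) : 1 ≤ (Atom.fwd s(x, y)).toSProc.occ {y} := by
  rw [Sym2.eq_swap]
  exact occ_fwd_left y x

theorem SProc.HasConf.rename_repl {q : SProc} {x y : ℕ} {G : Finset ℕ} {d : Config}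
    (h : (q.rename (repl x y)).HasConf G d) (hx : x ∈ G) :
    ∃ d', q.HasConf G d' ∧ d = d'.rename (repl x y) := by
  induction q using SProc.ind
  rw [← cls_rename, hasConf_cls_rename] at h
  obtain ⟨F, hF, h⟩ := h
  obtain ⟨d', hd', rfl⟩ := Conf.exists_of_comp (e := id) h fun a ha =>
    repl_of_ne (fun h => Finset.disjoint_left.1 hF ha (by rwa [h])) y
  exact ⟨d', ⟨_, F, rfl, hF, hd'⟩, rfl⟩

theorem SProc.HasConf.repl {q : SProc} {x y : ℕ} {G : Finset ℕ} {d : Config}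
    (h : q.HasConf G d) (hx : x ∈ G) :
    (q.rename (repl x y)).HasConf G (d.rename (repl x y)) := by
  obtain ⟨P, F, rfl, hF, h⟩ := h
  have hfix : ∀ a ∈ F, Proc.repl x y a = a := fun a ha =>
    repl_of_ne (fun h => Finset.disjoint_left.1 hF ha (by rwa [h])) y
  have h' := h.map (f := Proc.repl x y)
    (fun b hb b' hb' h => by rwa [hfix b hb, hfix b' hb'] at h)
  rw [Finset.image_congr (g := id) fun b hb => hfix b hb, Finset.image_id] at h'
  rw [← cls_rename, hasConf_cls_rename]
  exact ⟨F, hF, h'⟩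

theorem exists_finset_body (c : Config) (A : Finset ℕ) :
    ∃ G : Finset ℕ, A ⊆ G ∧ c.body.occ (↑G)ᶜ = 0 := by
  generalize c.body = p
  induction p using SProc.ind with
  | _ P =>
    obtain ⟨G, hG⟩ := exists_finset_occ P
    exact ⟨A ∪ G, Finset.subset_union_left, occ_eq_zero_of_subset hG
      (Set.compl_subset_compl.2 (by simp))⟩

/-- The reductions of two redexes of a linear configuration commute. -/
theorem Fire.diamond {A : Finset ℕ} {c c₂ : Config} {T₁ T₂ : Set Config} (hc : LinC c)
    (h₁ : Fire A c T₁) (h₂ : Fire A c T₂) (hc₂ : c₂ ∈ T₂) :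
    (∃ c₁ ∈ T₁, Sim A c₂ c₁) ∨
      ∃ T, Fire A c₂ T ∧ ∀ d ∈ T, ∃ c₁ ∈ T₁, ∃ d', Step A c₁ d' ∧ Sim A d' d := by
  generalize hcc : c = c' at h₂
  cases h₁ with
  | @pair x₁ a₁ b₁ q₁ r₁ G₁ h₁ hA₁ hG₁ =>
    cases h₂ with
    | @pair x₂ a₂ b₂ q₂ r₂ G₂ h₂ hA₂ hG₂ =>
      obtain ⟨d₂, hd₂, rfl⟩ := hc₂
      by_cases hx : x₁ = x₂
      · subst hx
        have key : ∀ a, a ∈ a₁ ::ₘ b₁ ::ₘ r₁ → 1 ≤ a.toSProc.occ {x₁} → a = a₁ ∨ a = b₁ := by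
          intro a ha h
          rcases Multiset.mem_cons.1 ha with ha | ha
          · exact .inl ha
          · rcases Multiset.mem_cons.1 ha with ha | ha
            · exact .inr ha
            · have e1 := hc.1 x₁
              have e2 := h₁.one_le_left
              have e3 := h₁.one_le_right
              have e4 := occ_le_of_mem ha {x₁}
              simp only [Config.body_cons, occ_add] at e1
              omega
        have ea : a₂ = a₁ := (key a₂ (by rw [hcc]; simp) h₂.one_le_left).resolve_right
          (h₂.ne h₁)
        have eb : b₂ = b₁ := (key b₂ (by rw [hcc]; simp) h₂.one_le_right).resolve_left
          (h₁.ne h₂).symm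
        subst ea eb
        have er : r₁ = r₂ := by simpa using hcc
        subst er
        obtain rfl := h₁.unique h₂
        left
        have hq : q₁.occ (↑G₂)ᶜ = 0 := by
          have := h₁.occ_le (↑G₂)ᶜ
          simp only [Config.body_cons, occ_add] at hG₂
          omega
        obtain ⟨π, hπ, h⟩ := hd₂.refresh (G₁ := G₁) hq
        have hr : r₁.rename π = r₁ := by
          simp only [Config.body_cons, occ_add] at hG₂
          refine Config.rename_eq_self _ (SProc.occ_eq_zero_of_subset (t := (↑G₂)ᶜ)
            (by omega) fun n hn hG => hn (hπ n hG))
        refine ⟨_, ⟨_, h, rfl⟩, π, fun a ha => hπ a (hA₂ ha), ?_⟩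
        rw [Config.rename_add, hr]
      · right
        obtain ⟨r, rfl, rfl⟩ := cons_cons_eq hcc
          (fun h => hx (h₁.subj_left (h ▸ h₂))) (h₁.ne h₂) (h₂.ne h₁).symm
          (fun h => hx (h₁.subj_right (h ▸ h₂)))
        obtain ⟨P, F₂, rfl, hF₂, hd₂⟩ := hd₂
        obtain ⟨G, hG, hGc⟩ := exists_finset_body (d₂ + a₁ ::ₘ b₁ ::ₘ r) (G₁ ∪ G₂ ∪ F₂)
        rw [Multiset.add_cons, Multiset.add_cons] at hGc ⊢
        have hG1 : G₁ ⊆ G := fun n hn => hG (by simp [hn])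
        refine ⟨_, .pair h₁ (hA₁.trans hG1) hGc, ?_⟩
        rintro _ ⟨d₁, ⟨P₁, F₁, rfl, hF₁, hd₁⟩, rfl⟩
        refine ⟨_, ⟨d₁, ⟨P₁, F₁, rfl, hF₁.mono_right hG1, hd₁⟩, rfl⟩, d₂ + (d₁ + r), ?_,
          by rw [add_left_comm]; exact Sim.refl _ _⟩
        rw [Multiset.add_cons, Multiset.add_cons]
        refine .pair (G := G₂ ∪ F₁) h₂ (hA₂.trans Finset.subset_union_left) ?_ ?_
        ·
          have hsub : (↑(G₂ ∪ F₁) : Set ℕ)ᶜ ⊆ (↑G₂)ᶜ :=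
            Set.compl_subset_compl.2 (by simp)
          have h0 : d₁.body.occ (↑(G₂ ∪ F₁))ᶜ = 0 := by
            refine Nat.le_zero.1 ((hd₁.occ_le (disjoint_compl_left.mono_right (by simp))).trans ?_)
            change (Proc.cls P₁).occ _ ≤ 0
            refine (h₁.occ_le _).trans ?_
            have := SProc.occ_eq_zero_of_subset hG₂ hsub
            simp only [Config.body_cons, occ_add] at this
            change _ + _ ≤ 0
            rw [Set.preimage_id]
            omega
          have := SProc.occ_eq_zero_of_subset hG₂ hsub
          simp only [Config.body_cons, Config.body_add, occ_add] at this ⊢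
          omega
        · refine ⟨P, F₂, rfl, ?_, hd₂⟩
          exact Finset.disjoint_union_right.2 ⟨hF₂,
            (hF₁.mono_right fun n hn => hG (by simp [hn])).symm⟩
    | @fwd x₂ y₂ r₂ hx h =>
      rw [Set.mem_singleton_iff] at hc₂
      subst hc₂
      right
      have hf := h₁.ne_fwd s(x₂, y₂)
      have hmem : Atom.fwd s(x₂, y₂) ∈ r₁ := by
        have : Atom.fwd s(x₂, y₂) ∈ a₁ ::ₘ b₁ ::ₘ r₁ := hcc ▸ Multiset.mem_cons_self _ _
        simpa [hf.1.symm, hf.2.symm] using this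
      obtain ⟨r, rfl⟩ := Multiset.exists_cons_of_mem hmem
      have e : r₂ = a₁ ::ₘ b₁ ::ₘ r := by
        rw [Multiset.cons_swap b₁, Multiset.cons_swap a₁, Multiset.cons_inj_right] at hcc
        exact hcc.symm
      subst e
      obtain ⟨G, hG, hGc⟩ := exists_finset_body
        (Config.rename (repl x₂ y₂) (a₁ ::ₘ b₁ ::ₘ r)) (insert x₂ G₁)
      have hG1 : G₁ ⊆ G := fun n hn => hG (by simp [hn])
      have hxG : x₂ ∈ G := hG (by simp)
      rw [Config.rename_cons, Config.rename_cons] at hGc ⊢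
      refine ⟨_, .pair (h₁.rename _) (hA₁.trans hG1) hGc, ?_⟩
      rintro _ ⟨d', hd', rfl⟩
      obtain ⟨d, hd, rfl⟩ := hd'.rename_repl hxG
      refine ⟨_, ⟨d, hd.mono hG1, rfl⟩, (d + r).rename (repl x₂ y₂), ?_, ?_⟩
      · rw [Multiset.add_cons]
        exact .fwd hx h _
      · rw [Config.rename_add]
        exact Sim.refl _ _
  | @fwd x₁ y₁ r₁ hx₁ h₁ =>
    cases h₂ with
    | @pair x₂ a₂ b₂ q₂ r₂ G₂ h₂ hA₂ hG₂ =>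
      obtain ⟨d₂, hd₂, rfl⟩ := hc₂
      right
      have hf := h₂.ne_fwd s(x₁, y₁)
      have hmem : Atom.fwd s(x₁, y₁) ∈ r₂ := by
        have : Atom.fwd s(x₁, y₁) ∈ a₂ ::ₘ b₂ ::ₘ r₂ := hcc ▸ Multiset.mem_cons_self _ _
        simpa [hf.1.symm, hf.2.symm] using this
      obtain ⟨r, rfl⟩ := Multiset.exists_cons_of_mem hmem
      have e : r₁ = a₂ ::ₘ b₂ ::ₘ r := by
        rw [Multiset.cons_swap b₂, Multiset.cons_swap a₂, Multiset.cons_inj_right] at hcc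
        exact hcc
      subst e
      have hxG : x₁ ∈ G₂ := by
        by_contra hxG
        have e1 : (Config.body (a₂ ::ₘ b₂ ::ₘ Atom.fwd s(x₁, y₁) ::ₘ r)).occ {x₁} = 0 :=
          SProc.occ_eq_zero_of_subset hG₂ (by simpa using hxG)
        have e2 := occ_fwd_left x₁ y₁
        simp only [Config.body_cons, occ_add] at e1
        omega
      refine ⟨{(d₂ + r).rename (repl x₁ y₁)}, ?_, ?_⟩
      · rw [Multiset.add_cons]
        exact .fwd hx₁ h₁
      rintro _ rfl
      refine ⟨_, rfl, d₂.rename (repl x₁ y₁) + Config.rename (repl x₁ y₁) r, ?_, ?_⟩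
      · rw [Config.rename_cons, Config.rename_cons]
        refine .pair (G := G₂) (h₂.rename _) hA₂ ?_ (hd₂.repl hxG)
        rw [← Config.rename_cons, ← Config.rename_cons, Config.body_rename, SProc.occ_rename]
        have hy : y₁ ∈ G₂ := by
          by_contra hyG
          have e1 : (Config.body (a₂ ::ₘ b₂ ::ₘ Atom.fwd s(x₁, y₁) ::ₘ r)).occ {y₁} = 0 :=
            SProc.occ_eq_zero_of_subset hG₂ (by simpa using hyG)
          have e2 := occ_fwd_right x₁ y₁
          simp only [Config.body_cons, occ_add] at e1
          omega
        have := SProc.occ_eq_zero_of_subset hG₂ (s := repl x₁ y₁ ⁻¹' (↑G₂)ᶜ) (by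
          intro n hn hG
          by_cases hnx : n = x₁
          · subst hnx
            rw [Set.mem_preimage, repl_self] at hn
            exact hn hy
          · rw [Set.mem_preimage, repl_of_ne hnx] at hn
            exact hn hG)
        simp only [Config.body_cons, occ_add] at this ⊢
        omega
      · rw [Config.rename_add]
        exact Sim.refl _ _
    | @fwd x₂ y₂ r₂ hx₂ h₂ =>
      rw [Set.mem_singleton_iff] at hc₂
      subst hc₂
      have swap_repl (x y : ℕ) (hx : x ∉ A) (hy : y ∉ A) (r : Config) :
          Sim A (r.rename (repl x y)) (r.rename (repl y x)) := by
        refine ⟨Equiv.swap x y, fun a ha => Equiv.swap_apply_of_ne_of_ne ?_ ?_, ?_⟩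
        · rintro rfl; exact hx ha
        · rintro rfl; exact hy ha
        · rw [Config.rename_rename]
          congr 1
          funext n
          by_cases h1 : n = x
          · subst h1
            by_cases h2 : n = y <;> simp [repl, h2]
          · by_cases h2 : n = y
            · subst h2
              simp [repl, h1]
            · simp [repl, h1, h2, Equiv.swap_apply_of_ne_of_ne h1 h2]
      by_cases hs : s(x₁, y₁) = s(x₂, y₂)
      · left
        rw [hs, Multiset.cons_inj_right] at hcc
        subst hcc
        refine ⟨_, rfl, ?_⟩
        rcases Sym2.eq_iff.1 hs with ⟨rfl, rfl⟩ | ⟨rfl, rfl⟩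
        · exact Sim.refl _ _
        · exact swap_repl _ _ hx₂ hx₁ _
      · have hmem : Atom.fwd s(x₂, y₂) ∈ r₁ := by
          have : Atom.fwd s(x₂, y₂) ∈ Atom.fwd s(x₁, y₁) ::ₘ r₁ :=
            hcc ▸ Multiset.mem_cons_self _ _
          rcases Multiset.mem_cons.1 this with h | h
          · exact absurd (Atom.fwd.inj h).symm hs
          · exact h
        obtain ⟨r, rfl⟩ := Multiset.exists_cons_of_mem hmem
        rw [Multiset.cons_swap, Multiset.cons_inj_right] at hcc
        subst hcc
        have z (n : ℕ) : 1 ≤ (Atom.fwd s(x₁, y₁)).toSProc.occ {n} →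
            1 ≤ (Atom.fwd s(x₂, y₂)).toSProc.occ {n} → (Config.body r).occ {n} = 0 := by
          intro e1 e2
          have := hc.1 n
          simp only [Config.body_cons, occ_add] at this
          omega
        have rr (x y : ℕ) (hr : (Config.body r).occ {x} = 0) :
            Config.rename (repl x y) r = r := by
          refine Config.rename_eq_self _ (SProc.occ_eq_zero_of_subset hr fun n hn => ?_)
          by_contra hnx
          exact hn (repl_of_ne hnx y)
        have fr (f : ℕ → ℕ) (x y : ℕ) :
            Config.rename f (Atom.fwd s(x, y) ::ₘ r) = Atom.fwd s(f x, f y) ::ₘ Config.rename f r :=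
          Config.rename_cons _ _ _
        by_cases hx : x₁ = x₂
        · subst hx
          left
          have hr := z x₁ (occ_fwd_left _ _) (occ_fwd_left _ _)
          refine ⟨_, rfl, ?_⟩
          rw [fr, fr, rr _ _ hr, rr _ _ hr, repl_self, repl_self, repl_of_ne h₁.symm,
            repl_of_ne h₂.symm, Sym2.eq_swap]
          exact Sim.refl _ _
        · by_cases hcyc : y₁ = x₂ ∧ y₂ = x₁
          · obtain ⟨rfl, rfl⟩ := hcyc
            left
            have hr := z y₂ (occ_fwd_left _ _) (occ_fwd_right _ _)
            have hr' := z y₁ (occ_fwd_right _ _) (occ_fwd_left _ _)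
            refine ⟨_, rfl, ?_⟩
            have := swap_repl y₁ y₂ hx₂ hx₁ (Atom.fwd s(y₁, y₂) ::ₘ r)
            rwa [Sym2.eq_swap (a := y₂)]
          · right
            have hne₁ : x₁ ≠ repl x₂ y₂ y₁ := by
              by_cases h : y₁ = x₂
              · rw [h, repl_self]
                exact fun h' => hcyc ⟨h, h'.symm⟩
              · rwa [repl_of_ne h]
            have hne₂ : x₂ ≠ repl x₁ y₁ y₂ := by
              by_cases h : y₂ = x₁
              · rw [h, repl_self]
                exact fun h' => hcyc ⟨h'.symm, h⟩
              · rwa [repl_of_ne h]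
            rw [fr, repl_of_ne hx]
            refine ⟨_, .fwd hx₁ hne₁, ?_⟩
            rintro _ rfl
            refine ⟨_, rfl, (Config.rename (repl x₁ y₁) r).rename (repl x₂ (repl x₁ y₁ y₂)),
              ?_, ?_⟩
            · rw [fr, repl_of_ne (Ne.symm hx)]
              exact .fwd hx₂ hne₂ _
            · rw [Config.rename_rename, Config.rename_rename]
              convert Sim.refl _ _ using 2
              funext n
              simp only [Function.comp, repl] at *
              grind

/-- Every normal form of a linear configuration can be reached by way of any redex. -/
theorem NF.fire {A : Finset ℕ} {c n : Config} (h : NF A c n) (hc : LinC c) {T : Set Config}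
    (hT : Fire A c T) : ∃ d ∈ T, NF A d n := by
  obtain ⟨d, hd, hn, hs⟩ := h
  induction hd using ReflTransGen.head_induction_on generalizing T with
  | refl => exact absurd hT (hn T)
  | @head c c₂ h h' ih =>
    obtain ⟨T₂, hT₂, hc₂⟩ := h
    rcases Fire.diamond hc hT hT₂ hc₂ with ⟨c₁, h₁, hsim⟩ | ⟨T', hT', h⟩
    · exact ⟨c₁, h₁, NF.of_sim ⟨d, h', hn, hs⟩ hsim⟩
    · obtain ⟨e, he, hne⟩ := ih (hc.fire hT₂ hc₂) hT'
      obtain ⟨c₁, h₁, d', hstep, hsim⟩ := h e he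
      exact ⟨c₁, h₁, NF.head hstep (hne.of_sim hsim.symm)⟩

end Proc

namespace Proc

open ShLam SProc

/-! ### Normal forms of processes -/

/-- `n` is a normal form of a configuration of `P`. -/
def PNF (A : Finset ℕ) (P : Proc) (n : Config) : Prop :=
  ∃ F c, Disjoint F A ∧ Conf P id F c ∧ NF A c n

/-- A process all of whose names outside of `A` are restricted, with linear configurations. -/
def LinP (A : Finset ℕ) (P : Proc) : Prop :=
  P.occ (↑A)ᶜ = 0 ∧ ∀ F c, Disjoint F A → Conf P id F c → LinC c

theorem Red.linP {A : Finset ℕ} {P Q : Proc} (h : Red P Q) (hP : LinP A P) : LinP A Q := by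
  refine ⟨h.occ_eq_zero _ hP.1, fun F d hF hd => ?_⟩
  rcases h.conf_backward hP.1 hF hd with ⟨F', hF', h⟩ | ⟨F', c, T, hF', h, hT, hd⟩
  · exact hP.2 F' d hF' h
  · exact (hP.2 F' c hF' h).fire hT hd

theorem Red.pnf_iff {A : Finset ℕ} {P Q : Proc} (h : Red P Q) (hP : LinP A P) (n : Config) :
    PNF A P n ↔ PNF A Q n := by
  constructor
  · rintro ⟨F, c, hF, hc, hn⟩
    rcases h.conf_forward hP.1 hF hc with ⟨F', hF', h⟩ | ⟨T, hT, h⟩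
    · exact ⟨F', c, hF', h, hn⟩
    · obtain ⟨d, hd, hn⟩ := hn.fire (hP.2 F c hF hc) hT
      obtain ⟨F', hF', h⟩ := h d hd
      exact ⟨F', d, hF', h, hn⟩
  · rintro ⟨F, d, hF, hd, hn⟩
    rcases h.conf_backward hP.1 hF hd with ⟨F', hF', h⟩ | ⟨F', c, T, hF', h, hT, hd⟩
    · exact ⟨F', d, hF', h, hn⟩
    · exact ⟨F', c, hF', h, hn.head ⟨T, hT, hd⟩⟩

theorem pnf_iff_of_reds {A : Finset ℕ} {P Q : Proc} (h : ReflTransGen Red P Q) (hP : LinP A P) :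
    LinP A Q ∧ ∀ n, PNF A P n ↔ PNF A Q n := by
  induction h with
  | refl => exact ⟨hP, fun _ => Iff.rfl⟩
  | tail _ h ih => exact ⟨h.linP ih.1, fun n => (ih.2 n).trans (h.pnf_iff ih.1 n)⟩

theorem lin.linP {A : Finset ℕ} {P : Proc} (h : P.lin) (hA : P.occ (↑A)ᶜ = 0)
    (h' : ∀ a ∈ A, P.occ {a} ≤ 2) : LinP A P := by
  refine ⟨hA, fun F c hF hc => ?_⟩
  obtain ⟨l1, l2⟩ := hc.lin h (occ_eq_zero_of_subset hA fun n hn hnA =>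
    Finset.disjoint_left.1 hF hn hnA)
  refine ⟨fun n => ?_, l2⟩
  by_cases hn : n ∈ F
  · exact l1 n hn
  · refine (hc.occ_le (s := {n}) (by simpa using hn)).trans ?_
    by_cases hnA : n ∈ A
    · exact h' n hnA
    · have : P.occ (id ⁻¹' {n}) = 0 := occ_eq_zero_of_subset hA (by simpa using hnA)
      omega

/-! ### Configurations of canonical processes -/

theorem exists_proc_atom (a : Atom) :
    ∃ P : Proc, P.cls = a.toSProc ∧ ∀ F c, Conf P id F c ↔ F = ∅ ∧ c = {a} := by
  cases a with
  | out x p =>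
    induction p using SProc.ind with | _ P =>
    exact ⟨.out x P, rfl, fun F c => by simp [Conf, lift_one_id, Proc.rename_id]⟩
  | inp x p =>
    induction p using SProc.ind with | _ P =>
    exact ⟨.inp x P, rfl, fun F c => by simp [Conf, lift_one_id, Proc.rename_id]⟩
  | fwd s =>
    induction s with | _ x y =>
    exact ⟨.fwd x y, rfl, fun F c => by simp [Conf]⟩
  | closeOut x => exact ⟨.closeOut x, rfl, fun F c => by simp [Conf]⟩
  | closeIn x p =>
    induction p using SProc.ind with | _ P =>
    exact ⟨.closeIn x P, rfl, fun F c => by simp [Conf, Proc.rename_id]⟩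
  | someOut x p =>
    induction p using SProc.ind with | _ P =>
    exact ⟨.someOut x P, rfl, fun F c => by simp [Conf, Proc.rename_id]⟩
  | noneOut x => exact ⟨.noneOut x, rfl, fun F c => by simp [Conf]⟩
  | someIn x w p =>
    induction p using SProc.ind with | _ P =>
    exact ⟨.someIn x w P, rfl, fun F c => by simp [Conf, Proc.rename_id]⟩

theorem exists_proc_body (c : Config) :
    ∃ P : Proc, P.cls = c.body ∧ ∀ F d, Conf P id F d ↔ F = ∅ ∧ d = c := by
  induction c using Multiset.induction with
  | empty => exact ⟨.nil, rfl, fun F d => Iff.rfl⟩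
  | cons a c ih =>
    obtain ⟨P, hP, h⟩ := ih
    obtain ⟨Q, hQ, h'⟩ := exists_proc_atom a
    refine ⟨.par Q P, by rw [cls_par, hP, hQ, Config.body_cons], fun F d => ?_⟩
    simp only [Conf, h, h']
    constructor
    · rintro ⟨F₁, F₂, c₁, c₂, -, rfl, rfl, ⟨rfl, rfl⟩, rfl, rfl⟩
      exact ⟨rfl, Multiset.singleton_add _ _⟩
    · rintro ⟨rfl, rfl⟩
      exact ⟨∅, ∅, _, _, by simp, by simp, (Multiset.singleton_add _ _).symm, ⟨rfl, rfl⟩,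
        rfl, rfl⟩

theorem hasConf_body {c d : Config} {A : Finset ℕ} : c.body.HasConf A d ↔ d = c := by
  obtain ⟨P, hP, h⟩ := exists_proc_body c
  rw [← hP, hasConf_cls]
  simp [h]

theorem SProc.HasConf.nu {p : SProc} {a : ℕ} {A : Finset ℕ} {c : Config}
    (h : p.HasConf (insert a A) c) (ha : a ∉ A) : (nu a p).HasConf A c := by
  obtain ⟨P, F, rfl, hF, h⟩ := h
  rw [Finset.disjoint_insert_right] at hF
  refine ⟨.res (P.rename (bind a)), insert a F, rfl,
    Finset.disjoint_insert_left.2 ⟨ha, hF.2⟩, a, F, hF.1, rfl, ?_⟩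
  rw [conf_rename]
  convert h
  funext n
  by_cases hn : n = a <;> simp [SProc.bind, envCons, hn]

theorem SProc.HasConf.of_nu {p : SProc} {a : ℕ} {A : Finset ℕ} {c : Config}
    (h : (SProc.nu a p).HasConf A c) (ha : a ∉ A) (hp : p.occ (↑(insert a A))ᶜ = 0) :
    ∃ d, p.HasConf (insert a A) d ∧ Sim A d c := by
  induction p using SProc.ind with | _ P =>
  obtain ⟨F, hF, b, F', hb, rfl, h⟩ :=
    hasConf_cls.1 (show (Proc.res (P.rename (bind a))).cls.HasConf A c from h)
  rw [Finset.disjoint_insert_left] at hF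
  rw [conf_rename] at h
  have hs : Conf P (Equiv.swap a b) F' c := by
    refine h.congr (occ_eq_zero_of_subset hp fun n hn hnA => hn ?_)
    by_cases hna : n = a
    · subst hna
      simp [SProc.bind, envCons]
    · have hnb : n ≠ b := by
        rintro rfl
        exact hF.1 (by simpa [hna] using hnA)
      simp [SProc.bind, envCons, hna, Equiv.swap_apply_of_ne_of_ne hna hnb]
  have hA : ∀ x ∈ A, Equiv.swap a b x = x := fun x hx =>
    Equiv.swap_apply_of_ne_of_ne (by rintro rfl; exact ha hx) (by rintro rfl; exact hF.1 hx)
  have hm := hs.map (f := Equiv.swap a b) (Equiv.injective _).injOn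
  have hid : (Equiv.swap a b : ℕ → ℕ) ∘ Equiv.swap a b = id := by
    funext n
    simp
  rw [hid] at hm
  refine ⟨_, ⟨P, _, rfl, ?_, hm⟩, Sim.symm ⟨Equiv.swap a b, hA, rfl⟩⟩
  rw [Finset.disjoint_left]
  intro x hx hx'
  obtain ⟨n, hn, rfl⟩ := Finset.mem_image.1 hx
  rcases Finset.mem_insert.1 hx' with hx' | hx'
  · have : n = b := (Equiv.swap a b).injective (hx'.trans (Equiv.swap_apply_right a b).symm)
    exact hb (this ▸ hn)
  · have := hA _ hx'
    have hnn : Equiv.swap a b n = n := (Equiv.injective _) this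
    rw [hnn] at hx'
    exact Finset.disjoint_left.1 hF.2 hn hx'

theorem hasConf_nus {F A : Finset ℕ} {c : Config} (hF : Disjoint F A) :
    (nus F c.body).HasConf A c := by
  induction F using Finset.induction generalizing A with
  | empty => exact hasConf_body.2 rfl
  | insert a F ha ih =>
    rw [Finset.disjoint_insert_left] at hF
    rw [nus_insert ha]
    exact (ih (Finset.disjoint_insert_right.2 ⟨ha, hF.2⟩)).nu hF.1

theorem SProc.HasConf.sim_of_nus {F A : Finset ℕ} {c d : Config}
    (h : (nus F c.body).HasConf A d) (hF : Disjoint F A) (hc : c.body.occ (↑A ∪ ↑F)ᶜ = 0) :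
    Sim A c d := by
  induction F using Finset.induction generalizing A d with
  | empty =>
    obtain rfl := hasConf_body.1 h
    exact Sim.refl _ _
  | insert a F ha ih =>
    rw [Finset.disjoint_insert_left] at hF
    rw [nus_insert ha] at h
    obtain ⟨e, he, hs⟩ := h.of_nu hF.1 (by
      rw [occ_nus]
      refine SProc.occ_eq_zero_of_subset hc fun n hn => ?_
      simpa [and_assoc, and_left_comm] using hn)
    obtain ⟨π, hπ, h⟩ := ih he (Finset.disjoint_insert_right.2 ⟨ha, hF.2⟩) (by
      refine SProc.occ_eq_zero_of_subset hc fun n hn => ?_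
      simpa [and_assoc, and_left_comm] using hn)
    exact Sim.trans ⟨π, fun x hx => hπ x (by simp [hx]), h⟩ hs

theorem hasConf_sup {p q : SProc} {A : Finset ℕ} {c : Config} :
    (p ⊔ q).HasConf A c ↔ p.HasConf A c ∨ q.HasConf A c := by
  induction p using SProc.ind with | _ P =>
  induction q using SProc.ind with | _ Q =>
  rw [← cls_choice, hasConf_cls, hasConf_cls, hasConf_cls]
  constructor
  · rintro ⟨F, hF, h | h⟩
    · exact .inl ⟨F, hF, h⟩
    · exact .inr ⟨F, hF, h⟩
  · rintro (⟨F, hF, h⟩ | ⟨F, hF, h⟩)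
    · exact ⟨F, hF, .inl h⟩
    · exact ⟨F, hF, .inr h⟩

theorem SProc.HasConf.of_le {p q : SProc} {A : Finset ℕ} {c : Config} (h : p.HasConf A c)
    (hpq : p ≤ q) : q.HasConf A c := by
  rw [← sup_eq_right.2 hpq]
  exact hasConf_sup.2 (.inl h)

theorem SProc.Sums.exists_hasConf {G : SProc → Prop} {p : SProc} (h : Sums G p)
    {A : Finset ℕ} {c : Config} (hc : p.HasConf A c) : ∃ g, G g ∧ g.HasConf A c := by
  induction h with
  | base h => exact ⟨_, h, hc⟩
  | sup _ _ ih ih' => exact (hasConf_sup.1 hc).elim ih ih'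

theorem SProc.sums_hasConf (q : SProc) (G : Finset ℕ) (hq : q.occ (↑G)ᶜ = 0) :
    Sums (fun g => ∃ F c, Disjoint F G ∧ c.body.occ (↑G ∪ ↑F)ᶜ = 0 ∧ c.body.size ≤ q.size ∧
      q.HasConf G c ∧ g = nus F c.body) q := by
  induction q using SProc.ind with | _ P =>
  have := sums_conf P id G hq
  rw [Proc.rename_id] at this
  refine this.mono ?_
  rintro _ ⟨F, c, hF, h, rfl⟩
  exact ⟨F, c, hF, h.cover hq, h.size_le, ⟨P, F, rfl, hF, h⟩, rfl⟩

theorem SProc.HasConf.nus_le {q : SProc} {A : Finset ℕ} {c : Config} (h : q.HasConf A c)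
    (hq : q.occ (↑A)ᶜ = 0) {F : Finset ℕ} (hF : Disjoint F A)
    (hc : c.body.occ (↑A ∪ ↑F)ᶜ = 0) : nus F c.body ≤ q := by
  obtain ⟨P, F', rfl, hF', h⟩ := h
  have := h.le hF' hq
  rw [Proc.rename_id] at this
  rwa [nus_eq_nus (A := ↑A) (by exact_mod_cast hF) (by exact_mod_cast hF') hc (h.cover hq)]

/-! ### Normalization -/

/-- A canonical process with a normal configuration. -/
def NormalBranch (A : Finset ℕ) (g : SProc) : Prop :=
  ∃ F c, Disjoint F A ∧ c.body.occ (↑A ∪ ↑F)ᶜ = 0 ∧ Normal A c ∧ g = nus F c.body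

theorem exists_reds_normal (A : Finset ℕ) (k : ℕ) {F : Finset ℕ} {c : Config}
    (hF : Disjoint F A) (hc : c.body.occ (↑A ∪ ↑F)ᶜ = 0) (hk : c.body.size ≤ k) :
    ∃ q, Reds (nus F c.body) q ∧ Sums (NormalBranch A) q := by
  induction k generalizing F c with
  | zero =>
    refine ⟨_, .refl, .base ⟨F, c, hF, hc, fun T hT => ?_, rfl⟩⟩
    cases hT with
    | pair h _ _ =>
      have := h.size_lt
      simp only [Config.body_cons, size_add] at hk
      omega
    | @fwd x y r _ _ =>
      have : (Atom.fwd s(x, y)).toSProc.size = 1 := rfl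
      simp only [Config.body_cons, size_add] at hk
      omega
  | succ k ih =>
    by_cases hn : Normal A c
    · exact ⟨_, .refl, .base ⟨F, c, hF, hc, hn, rfl⟩⟩
    · simp only [Normal, not_forall, not_not] at hn
      obtain ⟨T, hT⟩ := hn
      cases hT with
      | @pair x a b q r G h _ _ =>
        have hsz := h.size_lt
        simp only [Config.body_cons, size_add, occ_add] at hk hc
        have hq : q.occ (↑(A ∪ F))ᶜ = 0 := by
          have := h.occ_le (↑(A ∪ F))ᶜ
          rw [Finset.coe_union] at this ⊢
          omega
        have hs : Sums (fun g => ∃ (F : Finset ℕ) (c : Config), Disjoint F A ∧ c.body.occ (↑A ∪ ↑F)ᶜ = 0 ∧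
            c.body.size ≤ k ∧ g = nus F c.body) (nus F (q + r.body)) := by
          refine (SProc.sums_hasConf q (A ∪ F) hq).map (fun q => nus F (q + r.body))
            (fun p q => by rw [sup_add, nus_sup]) ?_
          rintro _ ⟨F', d, hF', hd, hsz', -, rfl⟩
          rw [Finset.disjoint_union_right] at hF'
          refine .base ⟨F ∪ F', d + r, Finset.disjoint_union_left.2 ⟨hF, hF'.1⟩, ?_, ?_, ?_⟩
          · rw [Config.body_add, occ_add, Finset.coe_union]
            rw [Finset.coe_union] at hd
            rw [← Set.union_assoc, hd, zero_add]
            refine SProc.occ_eq_zero_of_subset (t := (↑A ∪ ↑F)ᶜ) (by omega) ?_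
            exact Set.compl_subset_compl.2 Set.subset_union_left
          · simp only [Config.body_add, size_add]
            omega
          · rw [nus_add, nus_nus hF'.2.symm, Config.body_add]
            refine SProc.occ_eq_zero_of_subset (t := (↑A ∪ ↑F)ᶜ) (by omega) fun n hn hn' => ?_
            rcases hn' with hn' | hn'
            · exact Finset.disjoint_left.1 hF'.1 hn hn'
            · exact Finset.disjoint_left.1 hF'.2 hn hn'
        obtain ⟨q', hq', hs'⟩ := hs.reds (H := NormalBranch A) (by
          rintro _ ⟨F', d, hF', hd, hsz', rfl⟩
          exact ih hF' hd hsz')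
        refine ⟨q', .trans ?_ hq', hs'⟩
        rw [Config.body_cons, Config.body_cons, ← add_assoc]
        refine Reds.nus (.single ?_) F
        rw [add_comm, add_comm q]
        exact h.red.add _
      | @fwd x y r hx h =>
        simp only [Config.body_cons, size_add, occ_add, Nat.add_eq_zero_iff] at hk hc
        have hsz : (Atom.fwd s(x, y)).toSProc.size = 1 := rfl
        have hmem (n : ℕ) (h1 : 1 ≤ (Atom.fwd s(x, y)).toSProc.occ {n}) : n ∈ A ∨ n ∈ F := by
          by_contra hn
          have : (Atom.fwd s(x, y)).toSProc.occ {n} = 0 :=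
            SProc.occ_eq_zero_of_subset hc.1 (by simpa using hn)
          omega
        have hxF := (hmem x (occ_fwd_left x y)).resolve_left hx
        have hy := hmem y (occ_fwd_right x y)
        obtain ⟨q, hq, hs⟩ := ih (F := F.erase x) (c := r.rename (repl x y))
          (hF.mono_left (Finset.erase_subset _ _)) (by
            rw [Config.body_rename, SProc.occ_rename]
            refine SProc.occ_eq_zero_of_subset hc.2 fun n hn hn' => hn ?_
            by_cases hnx : n = x
            · subst hnx
              rw [repl_self]
              exact hy.imp id fun hy => by simpa [Ne.symm h] using hy
            · rw [repl_of_ne hnx]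
              exact hn'.imp id fun hn => by simpa [hnx] using hn) (by
            rw [Config.body_rename]
            have : ∀ (p : SProc) (f : ℕ → ℕ), (p.rename f).size = p.size := by
              intro p f
              induction p using SProc.ind
              exact Proc.size_rename _ _
            rw [this]
            omega)
        refine ⟨q, .trans ?_ hq, hs⟩
        conv_lhs => rw [← Finset.insert_erase hxF]
        rw [nus_insert (Finset.notMem_erase _ _), ← nus_nu, Config.body_cons, Config.body_rename]
        exact Reds.nus (.single (Red.forw_nu h _)) _

/-- If a linear process reduces to a process all of whose configurations are normal, then so
does each of its reducts. -/
theorem exists_reds_of_normal {A : Finset ℕ} {P Q N : Proc} (hP : LinP A P)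
    (hQ : ReflTransGen Red P Q) (hN : Reds P.cls N.cls)
    (hn : ∀ c, N.cls.HasConf A c → Normal A c) :
    ∃ Q', ReflTransGen Red Q Q' ∧ SC N Q' := by
  obtain ⟨N', hNN, hN⟩ := hN.exists_of_cls
  rw [← hNN] at hn
  obtain ⟨lQ, hPQ⟩ := pnf_iff_of_reds hQ hP
  obtain ⟨lN, hPN⟩ := pnf_iff_of_reds hN hP
  obtain ⟨q, hq, hs⟩ := (SProc.sums_hasConf Q.cls A lQ.1).reds (H := NormalBranch A) (by
    rintro _ ⟨F, c, hF, hc, -, -, rfl⟩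
    exact exists_reds_normal A _ hF hc le_rfl)
  obtain ⟨Q', rfl, hQ'⟩ := hq.exists_of_cls
  obtain ⟨lQ', hQQ⟩ := pnf_iff_of_reds hQ' lQ
  have key (n : Config) : PNF A Q' n ↔ PNF A N' n :=
    (hQQ n).symm.trans ((hPQ n).symm.trans (hPN n))
  have normal_eq {c d : Config} (h : Normal A c) (h' : ReflTransGen (Step A) c d) : d = c := by
    rcases h'.cases_head with h' | ⟨e, ⟨T, hT, -⟩, -⟩
    · exact h'.symm
    · exact absurd hT (h T)
  have transfer {P₁ P₂ : Proc} (l : LinP A P₂) (h₁ : ∀ n, PNF A P₁ n → PNF A P₂ n)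
      (h₂ : ∀ c, P₂.cls.HasConf A c → Normal A c) {F : Finset ℕ} {c : Config}
      (hF : Disjoint F A) (hc : c.body.occ (↑A ∪ ↑F)ᶜ = 0) (hcn : Normal A c)
      (hP : P₁.cls.HasConf A c) : nus F c.body ≤ P₂.cls := by
    obtain ⟨F₁, hF₁, h⟩ := hasConf_cls.1 hP
    obtain ⟨F₂, d, hF₂, hd, e, hde, -, π, hπ, rfl⟩ :=
      h₁ c ⟨F₁, c, hF₁, h, c, .refl, hcn, Sim.refl _ _⟩
    obtain rfl := normal_eq (h₂ d (hasConf_cls.2 ⟨F₂, hF₂, hd⟩)) hde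
    refine SProc.HasConf.nus_le (q := P₂.cls) (A := A) ?_ l.1 hF hc
    have himg : A.image π = A := by
      rw [Finset.image_congr (g := id) fun a ha => hπ a ha, Finset.image_id]
    have hc : (P₂.cls.rename π).HasConf A (Config.rename π e) := by
      have := SProc.HasConf.rename (hasConf_cls.2 ⟨F₂, hF₂, hd⟩) π
      rwa [himg] at this
    have : P₂.cls.rename π = P₂.cls := by
      rw [SProc.rename_congr P₂.cls (g := id), SProc.rename_id]
      refine occ_eq_zero_of_subset l.1 fun n hn hnA => hn (hπ n hnA)
    rwa [this] at hc
  refine ⟨Q', hQ', ?_⟩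
  rw [← cls_eq, ← hNN]
  apply le_antisymm
  · refine (SProc.sums_hasConf N'.cls A lN.1).le ?_
    rintro _ ⟨F, c, hF, hc, -, hcN, rfl⟩ -
    refine transfer lQ' (fun n => (key n).2) ?_ hF hc (hn c hcN) hcN
    intro c hc
    obtain ⟨g, ⟨F', d, hF', hd, hdn, rfl⟩, hg⟩ := hs.exists_hasConf hc
    exact hdn.sim (hg.sim_of_nus hF' hd)
  · refine hs.le ?_
    rintro _ ⟨F, c, hF, hc, hcn, rfl⟩ hle
    exact transfer lN (fun n => (key n).1) hn hF hc hcn ((hasConf_nus hF).of_le hle)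

end Proc

namespace Proc.SProc

/-! ### Choices -/

/-- The choice between the elements of a non-empty multiset. -/
def sups (m : Multiset SProc) : SProc := (m.map WithBot.some).sup.unbotD 0

@[simp] theorem sups_singleton (p : SProc) : sups {p} = p := by simp [sups]

theorem coe_sups {m : Multiset SProc} (h : m ≠ 0) :
    (WithBot.some (sups m) : WithBot SProc) = (m.map WithBot.some).sup := by
  obtain ⟨p, hp⟩ := Multiset.exists_mem_of_ne_zero h
  have hle := Multiset.le_sup (Multiset.mem_map_of_mem WithBot.some hp)
  rw [sups]
  generalize (m.map WithBot.some).sup = s at hle ⊢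
  cases s with
  | bot => simp at hle
  | coe s => rfl

theorem sups_cons (p : SProc) {m : Multiset SProc} (h : m ≠ 0) : sups (p ::ₘ m) = p ⊔ sups m := by
  rw [← WithBot.coe_inj, coe_sups (Multiset.cons_ne_zero), Multiset.map_cons, Multiset.sup_cons,
    WithBot.coe_sup, coe_sups h]

theorem le_sups {m : Multiset SProc} {p : SProc} (h : p ∈ m) : p ≤ sups m := by
  rw [← WithBot.coe_le_coe, coe_sups fun h' => by simp [h'] at h]
  exact Multiset.le_sup (Multiset.mem_map_of_mem _ h)

theorem sups_le {m : Multiset SProc} (h : m ≠ 0) {q : SProc} (h' : ∀ p ∈ m, p ≤ q) :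
    sups m ≤ q := by
  rw [← WithBot.coe_le_coe, coe_sups h, Multiset.sup_le]
  simpa using h'

theorem multiset_induction {α : Type*} {C : ∀ m : Multiset α, m ≠ 0 → Prop}
    (h1 : ∀ a, C {a} (Multiset.singleton_ne_zero a))
    (h2 : ∀ a m, ∀ h : m ≠ 0, C m h → C (a ::ₘ m) Multiset.cons_ne_zero) (m : Multiset α)
    (h : m ≠ 0) : C m h := by
  induction m using Multiset.induction with
  | empty => exact absurd rfl h
  | cons a m ih =>
    by_cases hm : m = 0
    · subst hm
      exact h1 a
    · exact h2 a m hm (ih hm)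

theorem multiset_map_ne_zero {α β : Type*} {m : Multiset α} (h : m ≠ 0) (f : α → β) : m.map f ≠ 0 :=
  fun h' => h (Multiset.map_eq_zero.1 h')

theorem map_sups {m : Multiset SProc} (h : m ≠ 0) (f : SProc → SProc)
    (hf : ∀ p q, f (p ⊔ q) = f p ⊔ f q) : f (sups m) = sups (m.map f) := by
  induction m, h using multiset_induction with
  | h1 p => simp
  | h2 p m hm ih => rw [sups_cons p hm, hf, Multiset.map_cons, sups_cons _ (multiset_map_ne_zero hm f), ih]

theorem sups_map_const {α : Type*} {m : Multiset α} (h : m ≠ 0) (p : SProc) :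
    sups (m.map fun _ => p) = p := by
  obtain ⟨a, ha⟩ := Multiset.exists_mem_of_ne_zero h
  refine le_antisymm (sups_le (multiset_map_ne_zero h _) ?_)
    (le_sups (Multiset.mem_map_of_mem (fun _ => p) ha))
  rintro _ hq
  obtain ⟨_, _, rfl⟩ := Multiset.mem_map.1 hq
  exact le_rfl

theorem sups_map_reds {α : Type*} {m : Multiset α} (h : m ≠ 0) {f g : α → SProc}
    (hf : ∀ a ∈ m, Reds (f a) (g a)) : Reds (sups (m.map f)) (sups (m.map g)) := by
  induction m, h using multiset_induction with
  | h1 a => simpa using hf a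
  | h2 a m hm ih =>
    rw [Multiset.map_cons, Multiset.map_cons, sups_cons _ (multiset_map_ne_zero hm _),
      sups_cons _ (multiset_map_ne_zero hm _)]
    exact (hf a (Multiset.mem_cons_self _ _)).sup (ih fun b hb => hf b (Multiset.mem_cons_of_mem hb))

theorem sups_sups_comm {α β : Type*} {m : Multiset α} {n : Multiset β} (hm : m ≠ 0) (hn : n ≠ 0)
    (f : α → β → SProc) :
    sups (m.map fun a => sups (n.map (f a))) = sups (n.map fun b => sups (m.map (f · b))) := by
  apply le_antisymm
  · refine sups_le (multiset_map_ne_zero hm _) fun p hp => ?_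
    obtain ⟨a, ha, rfl⟩ := Multiset.mem_map.1 hp
    refine sups_le (multiset_map_ne_zero hn _) fun p hp => ?_
    obtain ⟨b, hb, rfl⟩ := Multiset.mem_map.1 hp
    exact (le_sups (Multiset.mem_map_of_mem (f · b) ha)).trans
      (le_sups (Multiset.mem_map_of_mem (fun b => sups (m.map (f · b))) hb))
  · refine sups_le (multiset_map_ne_zero hn _) fun p hp => ?_
    obtain ⟨b, hb, rfl⟩ := Multiset.mem_map.1 hp
    refine sups_le (multiset_map_ne_zero hm _) fun p hp => ?_
    obtain ⟨a, ha, rfl⟩ := Multiset.mem_map.1 hp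
    exact (le_sups (Multiset.mem_map_of_mem (f a) hb)).trans
      (le_sups (Multiset.mem_map_of_mem (fun a => sups (n.map (f a))) ha))

theorem occ_sups_le {m : Multiset SProc} (h : m ≠ 0) {s : Set ℕ} {k : ℕ}
    (hk : ∀ p ∈ m, p.occ s ≤ k) : (sups m).occ s ≤ k := by
  induction m, h using multiset_induction with
  | h1 p => simpa using hk
  | h2 p m hm ih =>
    rw [sups_cons p hm, occ_sup]
    exact max_le (hk p (Multiset.mem_cons_self _ _))
      (ih fun q hq => hk q (Multiset.mem_cons_of_mem hq))

theorem lin_sup (p q : SProc) : (p ⊔ q).lin ↔ p.lin ∧ q.lin := by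
  induction p using SProc.ind
  induction q using SProc.ind
  rfl

theorem lin_sups {m : Multiset SProc} (h : m ≠ 0) (hk : ∀ p ∈ m, p.lin) : (sups m).lin := by
  induction m, h using multiset_induction with
  | h1 p => simpa using hk
  | h2 p m hm ih =>
    rw [sups_cons p hm, lin_sup]
    exact ⟨hk p (Multiset.mem_cons_self _ _), ih fun q hq => hk q (Multiset.mem_cons_of_mem hq)⟩

theorem cls_choices {l : List Proc} (h : l ≠ []) :
    (choices l).cls = sups ((l.map cls : List SProc) : Multiset SProc) := by
  induction l with
  | nil => exact absurd rfl h
  | cons P l ih =>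
    cases l with
    | nil => exact (sups_singleton _).symm
    | cons Q l =>
      rw [choices, cls_choice, ih (by simp), List.map_cons (l := Q :: l), ← Multiset.cons_coe,
        sups_cons]
      simp

theorem rename_noneOut (x : ℕ) (f : ℕ → ℕ) : (noneOut x).rename f = noneOut (f x) := rfl

theorem rename_closeOut (x : ℕ) (f : ℕ → ℕ) : (closeOut x).rename f = closeOut (f x) := rfl

theorem rename_fwd (x y : ℕ) (f : ℕ → ℕ) : (fwd x y).rename f = fwd (f x) (f y) := rfl

end Proc.SProc

namespace ShLam

open Proc.SProc

/-! ### Variables of terms -/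

theorem Term.ind {C : Term → Prop} (var : ∀ x, C (.var x)) (lam : ∀ k M, C M → C (.lam k M))
    (app : ∀ M B, C M → (∀ N ∈ B, C N) → C (.app M B))
    (lsub : ∀ M N, C M → C N → C (.lsub M N)) (fail : ∀ X, C (.fail X))
    (share : ∀ k M x, C M → C (.share k M x))
    (esub : ∀ k M B, C M → (∀ N ∈ B, C N) → C (.esub k M B)) (M : Term) : C M :=
  Term.rec (motive_1 := C) (motive_2 := fun B => ∀ N ∈ B, C N) var lam
    (fun M B h h' => app M B h h') lsub fail share (fun k M B h h' => esub k M B h h')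
    (fun _ h => absurd h List.not_mem_nil)
    (fun M B h h' N hN => by
      rcases List.mem_cons.1 hN with rfl | hN
      exacts [h, h' N hN]) M

theorem Bag.rename_eq_map (f : ℕ → ℕ) (B : Bag) : Bag.rename f B = B.map (Term.rename f) := by
  induction B with
  | nil => rfl
  | cons M B ih => rw [Bag.rename, ih, List.map_cons]

theorem Bag.mem_fv {B : Bag} {x : ℕ} : x ∈ Bag.fv B ↔ ∃ N ∈ B, x ∈ N.fv := by
  induction B with
  | nil => simp [Bag.fv]
  | cons M B ih => simp [Bag.fv, ih]

theorem Bag.fv_perm {B B' : Bag} (h : B.Perm B') : Bag.fv B = Bag.fv B' := by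
  ext x
  simp only [Bag.mem_fv, h.mem_iff]

theorem Bag.elemsFv_elems (B : Bag) : elemsFv (Bag.elems B) = Bag.fv B := by
  induction B with
  | nil => rfl
  | cons M B ih => rw [Bag.elems, elemsFv, ih, Bag.fv]

theorem mem_outer {k x : ℕ} {X : Finset ℕ} : x ∈ outer k X ↔ x + k ∈ X := by
  simp only [outer, Finset.mem_image, Finset.mem_filter]
  constructor
  · rintro ⟨y, ⟨hy, hk⟩, rfl⟩
    rwa [Nat.sub_add_cancel hk]
  · exact fun h => ⟨x + k, ⟨h, by omega⟩, by omega⟩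

theorem lift_add (k : ℕ) (f : ℕ → ℕ) (n : ℕ) : lift k f (n + k) = f n + k := by simp [lift]

theorem lift_of_lt {k n : ℕ} (f : ℕ → ℕ) (h : n < k) : lift k f n = n := by simp [lift, h]

theorem lift_eq_iff {k i : ℕ} (f : ℕ → ℕ) (hi : i < k) (n : ℕ) : lift k f n = i ↔ n = i := by
  simp only [lift]
  split_ifs <;> omega

theorem outer_image_lift (k : ℕ) (f : ℕ → ℕ) (X : Finset ℕ) :
    outer k (X.image (lift k f)) = (outer k X).image f := by
  ext x
  simp only [mem_outer, Finset.mem_image]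
  constructor
  · rintro ⟨y, hy, h⟩
    refine ⟨y - k, ?_, ?_⟩ <;> simp only [lift] at h <;> split_ifs at h <;>
      first | omega | skip
    rwa [Nat.sub_add_cancel (by omega)]
  · rintro ⟨y, hy, rfl⟩
    exact ⟨_, hy, lift_add k f y⟩

theorem Bag.fv_rename_of {f : ℕ → ℕ} {B : Bag}
    (h : ∀ N ∈ B, ∀ f : ℕ → ℕ, (N.rename f).fv = N.fv.image f) :
    Bag.fv (Bag.rename f B) = (Bag.fv B).image f := by
  induction B with
  | nil => rfl
  | cons M B ih =>
    rw [Bag.rename, Bag.fv, Bag.fv, Finset.image_union, h M (by simp),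
      ih fun N hN => h N (by simp [hN])]

theorem Term.fv_rename (M : Term) (f : ℕ → ℕ) : (M.rename f).fv = M.fv.image f := by
  induction M using Term.ind generalizing f with
  | var x => simp [Term.rename, Term.fv]
  | lam k M ih => rw [Term.rename, Term.fv, Term.fv, ih, outer_image_lift]
  | app M B ih ih' =>
    rw [Term.rename, Term.fv, Term.fv, ih, Finset.image_union, Bag.fv_rename_of ih']
  | lsub M N ih ih' =>
    rw [Term.rename, Term.fv, Term.fv, ih, ih', outer_image_lift, Finset.image_union]
  | fail X => rfl
  | share k M x ih =>
    rw [Term.rename, Term.fv, Term.fv, ih, outer_image_lift, Finset.image_union,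
      Finset.image_singleton]
  | esub k M B ih ih' =>
    rw [Term.rename, Term.fv, Term.fv, ih, outer_image_lift, Finset.image_union,
      Bag.fv_rename_of ih']

theorem Bag.fv_rename (B : Bag) (f : ℕ → ℕ) : Bag.fv (Bag.rename f B) = (Bag.fv B).image f :=
  Bag.fv_rename_of fun N _ => N.fv_rename

theorem injOn_lift {k : ℕ} {f : ℕ → ℕ} {X : Finset ℕ} (h : Set.InjOn f (outer k X)) :
    Set.InjOn (lift k f) X := by
  intro a ha b hb hab
  simp only [lift] at hab
  split_ifs at hab with h1 h2 h2
  · exact hab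
  · omega
  · omega
  · have key (c : ℕ) (hc : c ∈ X) (h1 : ¬ c < k) : c - k ∈ outer k X := by
      rwa [mem_outer, Nat.sub_add_cancel (not_lt.1 h1)]
    have := h (key a ha h1) (key b hb h2) (by omega)
    omega

/-! ### The translation up to structural congruence -/

/-- The translation of a term up to structural congruence. -/
def Term.den (M : Term) (ρ : ℕ → ℕ) (u : ℕ) : Proc.SProc := (M.enc ρ u).cls

/-- The translation of a sharing construct up to structural congruence. -/
def Term.shareDen (M : Term) (l : List ℕ) (ρ : ℕ → ℕ) (x u : ℕ) : Proc.SProc :=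
  (shareProc M.fv M.enc l ρ x u).cls

/-- The translation of a bag up to structural congruence. -/
def Bag.den (B : Bag) (ρ : ℕ → ℕ) (x : ℕ) : Proc.SProc := (bagProc (Bag.elems B) ρ x).cls

/-- The argument of an application. -/
def argDen (B L : Bag) (ρ : ℕ → ℕ) (u : ℕ) : Proc.SProc :=
  someIn 0 ((u + 1) ::ₘ names (up 1 ρ) (Bag.fv B)) (out 0 (fwd 1 (u + 2) + Bag.den L (up 2 ρ) 0))

/-- The argument of a linear substitution. -/
def Term.subDen (N : Term) (ρ : ℕ → ℕ) : Proc.SProc :=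
  someIn 0 (names (up 1 ρ) N.fv) (N.den (up 1 ρ) 0)

/-- The assignment `ρ` seen from below a binder of one variable. -/
def ext (ρ : ℕ → ℕ) (i : ℕ) : ℕ := if i = 0 then 0 else ρ (i - 1) + 1

theorem shareDen_nil (M : Term) (ρ : ℕ → ℕ) (x u : ℕ) :
    M.shareDen [] ρ x u =
      someOut x (out x (someIn 0 ((u + 1) ::ₘ names (up 1 ρ) M.fv)
        (closeIn 0 (M.den (up 1 ρ) (u + 1))) + noneOut (x + 1))) := rfl

theorem shareDen_cons (M : Term) (i : ℕ) (l : List ℕ) (ρ : ℕ → ℕ) (x u : ℕ) :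
    M.shareDen (i :: l) ρ x u =
      someOut x (out x (someIn 0 0 (closeIn 0 0) +
        someOut (x + 1) (someIn (x + 1) ((u + 1) ::ₘ names (up 1 ρ) (M.fv \ (i :: l).toFinset))
          (inp (x + 1)
            (M.shareDen l (Function.update (up 2 ρ) i 0) (x + 2) (u + 2)))))) := rfl

theorem bagDen_nil (ρ : ℕ → ℕ) (x : ℕ) :
    Bag.den [] ρ x =
      someIn x 0 (inp x (someOut 0 (closeOut 0) + someIn (x + 1) 0 (noneOut (x + 1)))) := rfl

theorem bagDen_cons (N : Term) (L : Bag) (ρ : ℕ → ℕ) (x : ℕ) :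
    Bag.den (N :: L) ρ x =
      someIn x (names ρ (Bag.fv (N :: L))) (inp x
        (someIn (x + 1) (0 ::ₘ names (up 1 ρ) (Bag.fv (N :: L)))
          (someOut (x + 1) (out (x + 1)
            (N.subDen (up 1 ρ) + (Bag.den L (up 2 ρ) (x + 2) + noneOut 1)))))) := by
  rw [← Bag.elemsFv_elems]
  rfl

theorem den_var (x : ℕ) (ρ : ℕ → ℕ) (u : ℕ) :
    (Term.var x).den ρ u = someOut (ρ x) (fwd (ρ x) u) := rfl

theorem den_lam (k : ℕ) (M : Term) (ρ : ℕ → ℕ) (u : ℕ) :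
    (Term.lam k M).den ρ u =
      someOut u (inp u (M.shareDen (List.range k) (fun i => ρ (i - k) + 1) 0 (u + 1))) := rfl

theorem permutations_ne_nil {α β : Type*} (l : List α) (f : List α → β) :
    l.permutations.map f ≠ [] := by
  intro h
  have := List.mem_permutations.2 (List.Perm.refl l)
  simp [List.map_eq_nil_iff.1 h] at this

theorem den_app (M : Term) (B : Bag) (ρ : ℕ → ℕ) (u : ℕ) :
    (Term.app M B).den ρ u =
      sups ((B.permutations : Multiset Bag).map fun L => res (M.den (up 1 ρ) 0 + argDen B L ρ u)) := by
  rw [Term.den, Term.enc_app, cls_choices (permutations_ne_nil _ _), List.map_map,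
    Multiset.map_coe]
  rfl

theorem den_lsub (M N : Term) (ρ : ℕ → ℕ) (u : ℕ) :
    (Term.lsub M N).den ρ u = res (M.den (ext ρ) (u + 1) + N.subDen ρ) := rfl

theorem den_fail (X : Finset ℕ) (ρ : ℕ → ℕ) (u : ℕ) :
    (Term.fail X).den ρ u = Proc.SProc.nones (u ::ₘ names ρ X) := by
  rw [Term.den, Term.enc, cls_nones, ← Multiset.cons_coe, ← Multiset.map_coe, Finset.sort_eq]
  rfl

theorem den_share (k : ℕ) (M : Term) (x : ℕ) (ρ : ℕ → ℕ) (u : ℕ) :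
    (Term.share k M x).den ρ u = M.shareDen (List.range k) (fun i => ρ (i - k)) (ρ x) u := rfl

theorem den_esub (k : ℕ) (M : Term) (B : Bag) (ρ : ℕ → ℕ) (u : ℕ) :
    (Term.esub k M B).den ρ u =
      sups ((B.permutations : Multiset Bag).map fun L =>
        res (M.shareDen (List.range k) (fun i => ρ (i - k) + 1) 0 (u + 1) +
          Bag.den L (up 1 ρ) 0)) := by
  rw [Term.den, Term.enc_esub, cls_choices (permutations_ne_nil _ _), List.map_map,
    Multiset.map_coe]
  rfl

theorem permutations_ne_zero {α : Type*} (l : List α) : (l.permutations : Multiset (List α)) ≠ 0 := by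
  simpa using permutations_ne_nil l id

theorem permutations_rename (f : ℕ → ℕ) (B : Bag) :
    ((Bag.rename f B).permutations : Multiset Bag) =
      (B.permutations : Multiset Bag).map (Bag.rename f) := by
  have : Bag.rename f = List.map (Term.rename f) := funext (Bag.rename_eq_map f)
  rw [this, ← List.map_permutations, Multiset.map_coe]

end ShLam

namespace ShLam

open Proc.SProc
open Proc (SProc)

/-! ### Renaming and the translation -/

theorem lift_comp_update (f ρ : ℕ → ℕ) (i : ℕ) :
    lift 1 f ∘ Function.update (up 1 ρ) i 0 = Function.update (up 1 (f ∘ ρ)) i 0 := by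
  funext n
  by_cases h : n = i
  · subst h
    simp [lift]
  · simp [h, lift, up]

theorem lift_comp_up (f ρ : ℕ → ℕ) : lift 1 f ∘ up 1 ρ = up 1 (f ∘ ρ) := by
  funext n
  simp [lift, up]

theorem up_two (ρ : ℕ → ℕ) : up 2 ρ = up 1 (up 1 ρ) := rfl

theorem names_map (ρ f : ℕ → ℕ) (X : Finset ℕ) : (names ρ X).map f = names (f ∘ ρ) X := by
  rw [names, names, Multiset.map_map]

theorem lift_one_comp_ext (f ρ : ℕ → ℕ) : lift 1 f ∘ ext ρ = ext (f ∘ ρ) := by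
  funext n
  by_cases h : n = 0 <;> simp [ext, lift, h]

theorem names_congr {ρ ρ' : ℕ → ℕ} {X : Finset ℕ} (h : ∀ x ∈ X, ρ x = ρ' x) :
    names ρ X = names ρ' X := Multiset.map_congr rfl h

theorem names_image {ρ f : ℕ → ℕ} {X : Finset ℕ} (h : Set.InjOn f X) :
    names ρ (X.image f) = names (ρ ∘ f) X := by
  rw [names, Finset.image_val_of_injOn h, Multiset.map_map]
  rfl

theorem shareDen_rename_of {M : Term}
    (h : ∀ ρ u f, (M.den ρ u).rename f = M.den (f ∘ ρ) (f u)) (l : List ℕ) (ρ : ℕ → ℕ)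
    (x u : ℕ) (f : ℕ → ℕ) :
    (M.shareDen l ρ x u).rename f = M.shareDen l (f ∘ ρ) (f x) (f u) := by
  induction l generalizing ρ x u f with
  | nil =>
    simp only [shareDen_nil, rename_someOut, rename_out, rename_add, rename_someIn,
      rename_closeIn, h, rename_noneOut, Multiset.map_cons, names_map, lift_one_zero,
      lift_one_succ, lift_comp_up]
  | cons i l ih =>
    simp only [shareDen_cons, rename_someOut, rename_out, rename_add, rename_someIn, rename_inp,
      rename_closeIn, ih, Multiset.map_cons, names_map, lift_one_zero, rename_zero,
      lift_one_succ, lift_comp_up, lift_comp_update, Multiset.map_zero, up_two]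

theorem subDen_rename_of {N : Term}
    (h : ∀ ρ u f, (N.den ρ u).rename f = N.den (f ∘ ρ) (f u)) (ρ f : ℕ → ℕ) :
    (N.subDen ρ).rename (lift 1 f) = N.subDen (f ∘ ρ) := by
  rw [Term.subDen, rename_someIn, h, names_map, lift_comp_up]
  rfl

theorem bagDen_rename_of {B : Bag}
    (h : ∀ N ∈ B, ∀ ρ u f, (Term.den N ρ u).rename f = N.den (f ∘ ρ) (f u)) (ρ : ℕ → ℕ) (x : ℕ)
    (f : ℕ → ℕ) : (Bag.den B ρ x).rename f = Bag.den B (f ∘ ρ) (f x) := by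
  induction B generalizing ρ x f with
  | nil =>
    simp only [bagDen_nil, rename_someIn, rename_inp, rename_add, rename_someOut,
      rename_closeOut, rename_noneOut, Multiset.map_zero, lift_one_zero, lift_one_succ]
  | cons N L ih =>
    have h1 : lift 1 (lift 1 f) 1 = 1 := rfl
    simp only [bagDen_cons, rename_someOut, rename_out, rename_add, rename_someIn, rename_inp,
      ih fun N hN => h N (List.mem_cons_of_mem _ hN), subDen_rename_of (h N List.mem_cons_self),
      rename_noneOut, Multiset.map_cons, names_map, lift_one_zero, h1,
      lift_one_succ, lift_comp_up, up_two]

theorem argDen_rename_of {B L : Bag}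
    (h : ∀ N ∈ L, ∀ ρ u f, (Term.den N ρ u).rename f = N.den (f ∘ ρ) (f u)) (ρ : ℕ → ℕ) (u : ℕ)
    (f : ℕ → ℕ) : (argDen B L ρ u).rename (lift 1 f) = argDen B L (f ∘ ρ) (f u) := by
  have h1 : lift 1 (lift 1 f) 1 = 1 := rfl
  simp only [argDen, rename_someIn, rename_out, rename_add, rename_fwd, Multiset.map_cons,
    names_map, bagDen_rename_of h, lift_one_zero, lift_one_succ, lift_comp_up, up_two, h1]

theorem mem_of_mem_permutations {B L : Bag} (h : L ∈ (B.permutations : Multiset Bag)) :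
    L.Perm B := List.mem_permutations.1 (Multiset.mem_coe.1 h)

theorem sups_permutations_congr {B : Bag} {f g : Bag → SProc} (h : ∀ L, L.Perm B → f L = g L) :
    sups ((B.permutations : Multiset Bag).map f) = sups ((B.permutations : Multiset Bag).map g) :=
  congrArg sups (Multiset.map_congr rfl fun L hL => h L (mem_of_mem_permutations hL))

theorem map_sups_permutations {B : Bag} {g : Bag → SProc} (f : SProc → SProc)
    (hf : ∀ p q, f (p ⊔ q) = f p ⊔ f q) :
    f (sups ((B.permutations : Multiset Bag).map g)) =
      sups ((B.permutations : Multiset Bag).map fun L => f (g L)) := by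
  rw [map_sups (multiset_map_ne_zero (permutations_ne_zero B) g) f hf, Multiset.map_map]
  rfl

/-- The translation commutes with the renaming of names. -/
theorem Term.rename_den (M : Term) (ρ : ℕ → ℕ) (u : ℕ) (f : ℕ → ℕ) :
    (M.den ρ u).rename f = M.den (f ∘ ρ) (f u) := by
  induction M using Term.ind generalizing ρ u f with
  | var x => rfl
  | lam k M ih =>
    rw [den_lam, den_lam, rename_someOut, rename_inp, shareDen_rename_of ih]
    simp only [lift_one_zero, lift_one_succ, Function.comp_def]
  | app M B ih ih' =>
    rw [den_app, den_app, map_sups_permutations (SProc.rename f) (rename_sup · · f)]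
    refine sups_permutations_congr fun L hL => ?_
    rw [rename_res, rename_add, ih, argDen_rename_of fun N hN => ih' N (hL.mem_iff.1 hN),
      lift_comp_up, lift_one_zero]
  | lsub M N ih ih' =>
    rw [den_lsub, den_lsub, rename_res, rename_add, ih, subDen_rename_of ih', lift_one_comp_ext,
      lift_one_succ]
  | fail X => rw [den_fail, den_fail, nones_rename, Multiset.map_cons, names_map]
  | share k M x ih =>
    rw [den_share, den_share, shareDen_rename_of ih]
    rfl
  | esub k M B ih ih' =>
    rw [den_esub, den_esub, map_sups_permutations (SProc.rename f) (rename_sup · · f)]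
    refine sups_permutations_congr fun L hL => ?_
    rw [rename_res, rename_add, shareDen_rename_of ih,
      bagDen_rename_of fun N hN => ih' N (hL.mem_iff.1 hN), lift_comp_up, lift_one_zero,
      lift_one_succ]
    simp only [lift_one_succ, Function.comp_def]

theorem Term.rename_shareDen (M : Term) (l : List ℕ) (ρ : ℕ → ℕ) (x u : ℕ) (f : ℕ → ℕ) :
    (M.shareDen l ρ x u).rename f = M.shareDen l (f ∘ ρ) (f x) (f u) :=
  shareDen_rename_of M.rename_den l ρ x u f

theorem Bag.rename_den (B : Bag) (ρ : ℕ → ℕ) (x : ℕ) (f : ℕ → ℕ) :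
    (Bag.den B ρ x).rename f = Bag.den B (f ∘ ρ) (f x) :=
  bagDen_rename_of (fun N _ => N.rename_den) ρ x f

theorem Term.rename_subDen (N : Term) (ρ f : ℕ → ℕ) :
    (N.subDen ρ).rename f = someIn (f 0) (names (f ∘ up 1 ρ) N.fv) (N.den (f ∘ up 1 ρ) (f 0)) := by
  rw [Term.subDen, rename_someIn, N.rename_den, names_map]

theorem rename_argDen (B L : Bag) (ρ : ℕ → ℕ) (u : ℕ) (f : ℕ → ℕ) :
    (argDen B L ρ u).rename f =
      someIn (f 0) (f (u + 1) ::ₘ names (f ∘ up 1 ρ) (Bag.fv B))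
        (out (f 0) (fwd (f 0 + 1) (f (u + 1) + 1) + Bag.den L (up 1 (f ∘ up 1 ρ)) 0)) := by
  have h1 : lift 1 f 1 = f 0 + 1 := lift_one_succ f 0
  simp only [argDen, rename_someIn, rename_out, rename_add, rename_fwd, Multiset.map_cons,
    names_map, Bag.rename_den, lift_one_zero, lift_one_succ, lift_comp_up, up_two, h1]

/-! ### Renaming of variables -/

theorem shareDen_of_rename {M M' : Term} {g : ℕ → ℕ} (hM : M'.fv = M.fv.image g)
    (hg : Set.InjOn g M.fv)
    (h : ∀ ρ ρ' u, (∀ x ∈ M.fv, ρ' (g x) = ρ x) → M'.den ρ' u = M.den ρ u)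
    {l : List ℕ} (hl : ∀ i ∈ l, ∀ y, g y = i ↔ y = i) {ρ ρ' : ℕ → ℕ} (x u : ℕ)
    (hρ : ∀ y ∈ M.fv, y ∉ l → ρ' (g y) = ρ y) :
    M'.shareDen l ρ' x u = M.shareDen l ρ x u := by
  induction l generalizing ρ ρ' x u with
  | nil =>
    have h1 : ∀ y ∈ M.fv, up 1 ρ' (g y) = up 1 ρ y := fun y hy => by
      simp [up, hρ y hy]
    rw [shareDen_nil, shareDen_nil, h _ _ _ h1, hM, names_image hg]
    rw [names_congr (ρ := up 1 ρ' ∘ g) h1]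
  | cons i l ih =>
    have hi := hl i List.mem_cons_self
    have hX : M'.fv \ (i :: l).toFinset = (M.fv \ (i :: l).toFinset).image g := by
      ext y
      simp only [hM, Finset.mem_sdiff, Finset.mem_image, List.mem_toFinset]
      constructor
      · rintro ⟨⟨z, hz, rfl⟩, hzl⟩
        exact ⟨z, ⟨hz, fun h => hzl (by rwa [(hl z h z).2 rfl])⟩, rfl⟩
      · rintro ⟨z, ⟨hz, hzl⟩, rfl⟩
        exact ⟨⟨z, hz, rfl⟩, fun h => hzl (by rwa [← (hl _ h z).1 rfl] at h)⟩
    rw [shareDen_cons, shareDen_cons, hX,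
      names_image (hg.mono (by simp)),
      names_congr (ρ := up 1 ρ' ∘ g) (ρ' := up 1 ρ),
      ih (fun j hj => hl j (List.mem_cons_of_mem _ hj)) (ρ := Function.update (up 2 ρ) i 0)]
    · intro y hy hyl
      by_cases hyi : y = i
      · rw [hyi, (hi i).2 rfl, Function.update_self, Function.update_self]
      · rw [Function.update_of_ne hyi, Function.update_of_ne (fun h => hyi ((hi y).1 h))]
        simp [up, hρ y hy (by simp [hyi, hyl])]
    · intro y hy
      obtain ⟨hy, hyl⟩ := Finset.mem_sdiff.1 hy
      simp [up, hρ y hy (by simpa using hyl)]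

theorem subDen_of_rename {N : Term} {f : ℕ → ℕ} (hf : Set.InjOn f N.fv)
    (h : ∀ ρ ρ' u, (∀ x ∈ N.fv, ρ' (f x) = ρ x) → (N.rename f).den ρ' u = N.den ρ u)
    {ρ ρ' : ℕ → ℕ} (hρ : ∀ x ∈ N.fv, ρ' (f x) = ρ x) :
    (N.rename f).subDen ρ' = N.subDen ρ := by
  have h1 : ∀ y ∈ N.fv, up 1 ρ' (f y) = up 1 ρ y := fun y hy => by simp [up, hρ y hy]
  rw [Term.subDen, Term.subDen, h _ _ _ h1, N.fv_rename, names_image hf,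
    names_congr (ρ := up 1 ρ' ∘ f) h1]

theorem bagDen_of_rename {B : Bag} {f : ℕ → ℕ} (hf : Set.InjOn f (Bag.fv B))
    (h : ∀ N ∈ B, ∀ ρ ρ' u, (∀ x ∈ Term.fv N, ρ' (f x) = ρ x) →
      (N.rename f).den ρ' u = N.den ρ u)
    {ρ ρ' : ℕ → ℕ} (x : ℕ) (hρ : ∀ x ∈ Bag.fv B, ρ' (f x) = ρ x) :
    Bag.den (Bag.rename f B) ρ' x = Bag.den B ρ x := by
  induction B generalizing ρ ρ' x with
  | nil => rfl
  | cons N L ih =>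
    have hn (n : ℕ) : names (up n ρ') (Bag.fv (Bag.rename f (N :: L))) =
        names (up n ρ) (Bag.fv (N :: L)) := by
      rw [Bag.fv_rename, names_image hf]
      exact names_congr fun y hy => by simp [up, hρ y hy]
    have hN : N.fv ⊆ Bag.fv (N :: L) := Finset.subset_union_left
    have hL : Bag.fv L ⊆ Bag.fv (N :: L) := Finset.subset_union_right
    have h0 := hn 0
    have h1 := hn 1
    rw [Bag.rename] at h0 h1 ⊢
    rw [bagDen_cons, bagDen_cons, h1, show names ρ' _ = names ρ _ from h0,
      ih (hf.mono hL) (fun N hN => h N (List.mem_cons_of_mem _ hN)) (ρ := up 2 ρ),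
      subDen_of_rename (hf.mono hN) (h N List.mem_cons_self) (ρ := up 1 ρ)]
    · intro y hy
      simp [up, hρ y (hN hy)]
    · intro y hy
      simp [up, hρ y (hL hy)]

theorem argDen_of_rename {B L : Bag} (hL : L.Perm B) {f : ℕ → ℕ} (hf : Set.InjOn f (Bag.fv B))
    (h : ∀ N ∈ B, ∀ ρ ρ' u, (∀ x ∈ Term.fv N, ρ' (f x) = ρ x) →
      (N.rename f).den ρ' u = N.den ρ u)
    {ρ ρ' : ℕ → ℕ} (u : ℕ) (hρ : ∀ x ∈ Bag.fv B, ρ' (f x) = ρ x) :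
    argDen (Bag.rename f B) (Bag.rename f L) ρ' u = argDen B L ρ u := by
  rw [argDen, argDen, Bag.fv_rename, names_image hf,
    names_congr (ρ := up 1 ρ' ∘ f) (ρ' := up 1 ρ),
    bagDen_of_rename (ρ := up 2 ρ) (B := L) (by rwa [Bag.fv_perm hL])
      (fun N hN => h N (hL.mem_iff.1 hN))]
  · intro y hy
    rw [Bag.fv_perm hL] at hy
    simp [up, hρ y hy]
  · intro y hy
    simp [up, hρ y hy]

theorem mem_outer_sub {k x : ℕ} {X : Finset ℕ} (hx : x ∈ X) (hk : ¬ x < k) : x - k ∈ outer k X := by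
  rwa [mem_outer, Nat.sub_add_cancel (not_lt.1 hk)]

theorem lift_sub {k x : ℕ} (f : ℕ → ℕ) (hk : ¬ x < k) : lift k f x - k = f (x - k) := by
  simp [lift, hk]

/-- The translation of a renamed term. -/
theorem Term.den_rename (M : Term) {f : ℕ → ℕ} (hf : Set.InjOn f M.fv) {ρ ρ' : ℕ → ℕ} (u : ℕ)
    (h : ∀ x ∈ M.fv, ρ' (f x) = ρ x) : (M.rename f).den ρ' u = M.den ρ u := by
  induction M using Term.ind generalizing f ρ ρ' u with
  | var x =>
    rw [Term.rename, den_var, den_var, h x (Finset.mem_singleton_self x)]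
  | lam k M ih =>
    rw [Term.rename, den_lam, den_lam]
    rw [shareDen_of_rename (g := lift k f) (M.fv_rename _) (injOn_lift hf)
      (fun ρ ρ' u => ih (injOn_lift hf) u) (ρ := fun i => ρ (i - k) + 1)]
    · exact fun i hi y => lift_eq_iff f (List.mem_range.1 hi) y
    · intro y hy hyl
      rw [List.mem_range] at hyl
      rw [lift_sub f hyl, h _ (mem_outer_sub hy hyl)]
  | app M B ih ih' =>
    have hM : M.fv ⊆ (Term.app M B).fv := Finset.subset_union_left
    have hB : Bag.fv B ⊆ (Term.app M B).fv := Finset.subset_union_right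
    rw [Term.rename, den_app, den_app, permutations_rename, Multiset.map_map]
    refine sups_permutations_congr fun L hL => ?_
    rw [Function.comp, ih (hf.mono hM) (ρ := up 1 ρ), argDen_of_rename hL (hf.mono hB)
      (fun N hN ρ ρ' u => ih' N hN (hf.mono fun y hy => hB (Bag.mem_fv.2 ⟨N, hN, hy⟩)) u)
      (ρ := ρ) (ρ' := ρ')]
    · exact fun y hy => h y (hB hy)
    · exact fun y hy => by simp [up, h y (hM hy)]
  | lsub M N ih ih' =>
    have hM : outer 1 M.fv ⊆ (Term.lsub M N).fv := Finset.subset_union_left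
    have hN : N.fv ⊆ (Term.lsub M N).fv := Finset.subset_union_right
    rw [Term.rename, den_lsub, den_lsub, ih (injOn_lift (hf.mono hM)) (ρ := ext ρ),
      subDen_of_rename (hf.mono hN) (fun ρ ρ' u => ih' (hf.mono hN) u) fun y hy => h y (hN hy)]
    intro y hy
    cases y with
    | zero => rfl
    | succ y =>
      rw [lift_one_succ]
      simp [ext, h y (hM (mem_outer.2 hy))]
  | fail X =>
    rw [Term.rename, den_fail, den_fail, names_image (X := X) hf, names_congr (ρ := ρ' ∘ f) (X := X) h]
  | share k M x ih =>
    have hM : outer k M.fv ⊆ (Term.share k M x).fv := Finset.subset_union_left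
    rw [Term.rename, den_share, den_share]
    rw [shareDen_of_rename (g := lift k f) (M.fv_rename _) (injOn_lift (hf.mono hM))
      (fun ρ ρ' u => ih (injOn_lift (hf.mono hM)) u) (ρ := fun i => ρ (i - k)), h x]
    · exact Finset.mem_union_right _ (Finset.mem_singleton_self x)
    · exact fun i hi y => lift_eq_iff f (List.mem_range.1 hi) y
    · intro y hy hyl
      rw [List.mem_range] at hyl
      rw [lift_sub f hyl, h _ (hM (mem_outer_sub hy hyl))]
  | esub k M B ih ih' =>
    have hM : outer k M.fv ⊆ (Term.esub k M B).fv := Finset.subset_union_left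
    have hB : Bag.fv B ⊆ (Term.esub k M B).fv := Finset.subset_union_right
    rw [Term.rename, den_esub, den_esub, permutations_rename, Multiset.map_map]
    refine sups_permutations_congr fun L hL => ?_
    rw [Function.comp, shareDen_of_rename (g := lift k f) (M.fv_rename _) (injOn_lift (hf.mono hM))
      (fun ρ ρ' u => ih (injOn_lift (hf.mono hM)) u) (ρ := fun i => ρ (i - k) + 1),
      bagDen_of_rename (ρ := up 1 ρ) (B := L)]
    · rw [Bag.fv_perm hL]
      exact hf.mono hB
    · exact fun N hN ρ ρ' u =>
        ih' N (hL.mem_iff.1 hN) (hf.mono fun y hy => hB (Bag.mem_fv.2 ⟨N, hL.mem_iff.1 hN, hy⟩)) u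
    · intro y hy
      rw [Bag.fv_perm hL] at hy
      simp [up, h y (hB hy)]
    · exact fun i hi y => lift_eq_iff f (List.mem_range.1 hi) y
    · intro y hy hyl
      rw [List.mem_range] at hyl
      rw [lift_sub f hyl, h _ (hM (mem_outer_sub hy hyl))]

theorem lift_id (k : ℕ) : lift k id = id := by
  funext n
  simp only [lift, id]
  split_ifs <;> omega

theorem Term.rename_id (M : Term) : M.rename id = M := by
  have hB {B : Bag} (h : ∀ N ∈ B, N.rename id = N) : Bag.rename id B = B := by
    rw [Bag.rename_eq_map, List.map_congr_left h, List.map_id']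
  induction M using Term.ind with
  | var x => rfl
  | lam k M ih => rw [Term.rename, lift_id, ih]
  | app M B ih ih' => rw [Term.rename, ih, hB ih']
  | lsub M N ih ih' => rw [Term.rename, lift_id, ih, ih']
  | fail X => rw [Term.rename, Finset.image_id]
  | share k M x ih => rw [Term.rename, lift_id, ih, id]
  | esub k M B ih ih' => rw [Term.rename, lift_id, ih, hB ih']

theorem Term.den_congr (M : Term) {ρ ρ' : ℕ → ℕ} (u : ℕ) (h : ∀ x ∈ M.fv, ρ' x = ρ x) :
    M.den ρ' u = M.den ρ u := by
  have := M.den_rename (f := id) (Set.injOn_id _) u h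
  rwa [M.rename_id] at this

theorem Term.subDen_rename (N : Term) {f : ℕ → ℕ} (hf : Set.InjOn f N.fv) {ρ ρ' : ℕ → ℕ}
    (h : ∀ x ∈ N.fv, ρ' (f x) = ρ x) : (N.rename f).subDen ρ' = N.subDen ρ :=
  subDen_of_rename hf (fun _ _ u => N.den_rename hf u) h

theorem Bag.den_rename (B : Bag) {f : ℕ → ℕ} (hf : Set.InjOn f (Bag.fv B)) {ρ ρ' : ℕ → ℕ} (x : ℕ)
    (h : ∀ x ∈ Bag.fv B, ρ' (f x) = ρ x) : Bag.den (Bag.rename f B) ρ' x = Bag.den B ρ x :=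
  bagDen_of_rename hf
    (fun N hN _ _ u => N.den_rename (hf.mono fun _ hy => Bag.mem_fv.2 ⟨N, hN, hy⟩) u) x h

theorem Bag.rename_id (B : Bag) : Bag.rename id B = B := by
  rw [Bag.rename_eq_map, List.map_congr_left fun N _ => N.rename_id, List.map_id']

theorem Bag.den_congr (B : Bag) {ρ ρ' : ℕ → ℕ} (x : ℕ) (h : ∀ x ∈ Bag.fv B, ρ' x = ρ x) :
    Bag.den B ρ' x = Bag.den B ρ x := by
  have := B.den_rename (f := id) (Set.injOn_id _) x h
  rwa [B.rename_id] at this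

theorem Term.subDen_congr (N : Term) {ρ ρ' : ℕ → ℕ} (h : ∀ x ∈ N.fv, ρ' x = ρ x) :
    N.subDen ρ' = N.subDen ρ := by
  have := N.subDen_rename (f := id) (Set.injOn_id _) h
  rwa [N.rename_id] at this

theorem argDen_shift (B L : Bag) (hL : L.Perm B) (k : ℕ) {ρ ρ' : ℕ → ℕ} (u : ℕ)
    (h : ∀ x, ρ' (x + k) = ρ x) : argDen (Bag.shift k B) (Bag.shift k L) ρ' u = argDen B L ρ u :=
  argDen_of_rename hL (add_left_injective k).injOn
    (fun N _ _ _ u => N.den_rename (add_left_injective k).injOn u) u fun x _ => h x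

end ShLam

namespace ShLam

open Proc.SProc
open Proc (SProc)

/-! ### Linear terms -/

/-- Terms without free sharing variables in which every variable occurs at most once. -/
inductive Term.Linear : Term → Prop
  | var (x : ℕ) : Term.Linear (.var x)
  | lam {k : ℕ} {M : Term} (h : M.Linear) (hk : ∀ i < k, i ∈ M.fv) : Term.Linear (.lam k M)
  | app {M : Term} {B : Bag} (h : M.Linear) (hB : ∀ N ∈ B, Term.Linear N)
      (hp : B.Pairwise fun N N' => Disjoint N.fv N'.fv) (hd : Disjoint M.fv (Bag.fv B)) :
      Term.Linear (.app M B)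
  | lsub {M N : Term} (h : M.Linear) (h' : N.Linear) (h0 : 0 ∈ M.fv)
      (hd : Disjoint (outer 1 M.fv) N.fv) : Term.Linear (.lsub M N)
  | fail (X : Finset ℕ) : Term.Linear (.fail X)
  | esub {k : ℕ} {M : Term} {B : Bag} (h : M.Linear) (hk : ∀ i < k, i ∈ M.fv)
      (hB : ∀ N ∈ B, Term.Linear N) (hp : B.Pairwise fun N N' => Disjoint N.fv N'.fv)
      (hd : Disjoint (outer k M.fv) (Bag.fv B)) : Term.Linear (.esub k M B)

/-- Bags of linear terms with disjoint variables. -/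
structure Bag.Linear (B : Bag) : Prop where
  linear : ∀ N ∈ B, Term.Linear N
  pairwise : B.Pairwise fun N N' => Disjoint N.fv N'.fv

theorem Bag.Linear.perm {B B' : Bag} (h : Bag.Linear B) (h' : B'.Perm B) : Bag.Linear B' :=
  ⟨fun N hN => h.1 N (h'.mem_iff.1 hN), h.2.perm h'.symm fun h => h.symm⟩

theorem Bag.Linear.nil : Bag.Linear [] := ⟨by simp, .nil⟩

theorem Bag.Linear.cons {M : Term} {B : Bag} (h : Bag.Linear (M :: B)) :
    M.Linear ∧ Bag.Linear B ∧ Disjoint M.fv (Bag.fv B) := by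
  obtain ⟨h1, h2⟩ := h
  rw [List.pairwise_cons] at h2
  refine ⟨h1 M List.mem_cons_self, ⟨fun N hN => h1 N (List.mem_cons_of_mem _ hN), h2.2⟩, ?_⟩
  rw [Finset.disjoint_left]
  intro x hx hx'
  obtain ⟨N, hN, hxN⟩ := Bag.mem_fv.1 hx'
  exact Finset.disjoint_left.1 (h2.1 N hN) hx hxN

theorem Bag.linear_cons {M : Term} {B : Bag} (h : M.Linear) (h' : Bag.Linear B)
    (hd : Disjoint M.fv (Bag.fv B)) : Bag.Linear (M :: B) := by
  refine ⟨?_, List.pairwise_cons.2 ⟨fun N hN => ?_, h'.2⟩⟩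
  · rintro N hN
    rcases List.mem_cons.1 hN with rfl | hN
    exacts [h, h'.1 N hN]
  · exact hd.mono_right fun y hy => Bag.mem_fv.2 ⟨N, hN, hy⟩

/-- All variables have a strict type. -/
def Ctx.Strict (Γ : Ctx) : Prop := ∀ n π, Γ n ≠ some (.inter π)

/-- The variables of a context. -/
def Ctx.Dom (Γ : Ctx) (X : Finset ℕ) : Prop := ∀ n, n ∈ X ↔ Γ n ≠ none

theorem Ctx.Split.strict {Θ Γ Δ : Ctx} (h : Ctx.Split Θ Γ Δ) (hΘ : Θ.Strict) :
    Γ.Strict ∧ Δ.Strict := by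
  refine ⟨fun n π hn => ?_, fun n π hn => ?_⟩
  · rcases h n with ⟨h, _⟩ | ⟨_, h⟩
    · simp [h] at hn
    · exact hΘ n π (h.trans hn)
  · rcases h n with ⟨_, h⟩ | ⟨h, _⟩
    · exact hΘ n π (h.trans hn)
    · simp [h] at hn

theorem Ctx.Split.disjoint {Θ Γ Δ : Ctx} (h : Ctx.Split Θ Γ Δ) {X Y : Finset ℕ} (hX : Γ.Dom X)
    (hY : Δ.Dom Y) : Disjoint X Y := by
  rw [Finset.disjoint_left]
  intro n hn hn'
  rcases h n with ⟨h, _⟩ | ⟨h, _⟩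
  · exact (hX n).1 hn h
  · exact (hY n).1 hn' h

theorem Ctx.Split.dom {Θ Γ Δ : Ctx} (h : Ctx.Split Θ Γ Δ) {X Y : Finset ℕ} (hX : Γ.Dom X)
    (hY : Δ.Dom Y) : Θ.Dom (X ∪ Y) := by
  intro n
  rw [Finset.mem_union, hX n, hY n]
  rcases h n with ⟨h, h'⟩ | ⟨h, h'⟩ <;> simp [h, h']

theorem Ctx.Strict.push {Γ : Ctx} (h : Γ.Strict) (k : ℕ) (σ : Ty) : (Γ.push k σ).Strict := by
  intro n π
  unfold Ctx.push
  split_ifs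
  · simp
  · exact h _ _

theorem Ctx.Dom.of_push {Γ : Ctx} {k : ℕ} {σ : Ty} {X : Finset ℕ} (h : (Γ.push k σ).Dom X) :
    Γ.Dom (outer k X) ∧ ∀ i < k, i ∈ X := by
  refine ⟨fun n => ?_, fun i hi => ?_⟩
  · rw [mem_outer, h]
    simp [Ctx.push]
  · rw [h]
    simp [Ctx.push, hi]

theorem Ctx.not_strict_add (Γ : Ctx) (x : ℕ) (π : List Ty) : ¬ (Γ.add x (.inter π)).Strict :=
  fun h => h x π (Function.update_self _ _ _)

theorem Ctx.dom_empty : Ctx.empty.Dom ∅ := by simp [Ctx.Dom, Ctx.empty]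

theorem outer_zero (X : Finset ℕ) : outer 0 X = X := by
  ext x
  rw [mem_outer, Nat.add_zero]

theorem Ctx.Dom.add {Γ : Ctx} {X : Finset ℕ} (h : Γ.Dom X) (x : ℕ) (a : Asg) :
    (Γ.add x a).Dom (X ∪ {x}) := by
  intro n
  by_cases hn : n = x
  · simp [Ctx.add, hn]
  · simp [Ctx.add, hn, h n]

mutual

theorem Typed.linear {Γ : Ctx} {M : Term} {τ : Ty} (h : Typed Γ M τ) :
    (Γ.Strict → M.Linear) ∧ Γ.Dom M.fv := by
  match h with
  | .var x σ =>
    refine ⟨fun _ => .var x, fun n => ?_⟩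
    by_cases hn : n = x
    · subst hn
      simp [Term.fv, Ctx.single]
    · simp [Term.fv, Ctx.single, hn, Ctx.empty]
  | .weak Δ x M τ hx h =>
    refine ⟨fun hs => absurd hs (Ctx.not_strict_add _ _ _), ?_⟩
    rw [Term.fv, outer_zero]
    exact h.linear.2.add x _
  | .share Δ k x M σ τ hk hx h =>
    exact ⟨fun hs => absurd hs (Ctx.not_strict_add _ _ _), h.linear.2.of_push.1.add x _⟩
  | .lam Δ k M σ τ h =>
    obtain ⟨h1, h2⟩ := h.linear
    exact ⟨fun hs => .lam (h1 (hs.push k σ)) h2.of_push.2, h2.of_push.1⟩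
  | .app Θ Γ Δ M B π τ hsp h h' =>
    obtain ⟨h1, h2⟩ := h.linear
    obtain ⟨h3, h4⟩ := h'.linear
    exact ⟨fun hs => .app (h1 (hsp.strict hs).1) (h3 (hsp.strict hs).2).1 (h3 (hsp.strict hs).2).2
      (hsp.disjoint h2 h4), hsp.dom h2 h4⟩
  | .lsub Θ Γ Δ M N σ τ hsp h h' =>
    obtain ⟨h1, h2⟩ := h.linear
    obtain ⟨h3, h4⟩ := h'.linear
    exact ⟨fun hs => .lsub (h1 ((hsp.strict hs).1.push 1 σ)) (h3 (hsp.strict hs).2) (h2.of_push.2 0 Nat.one_pos)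
      (hsp.disjoint h2.of_push.1 h4),
      hsp.dom h2.of_push.1 h4⟩
  | .esub Θ Γ Δ k M B σ τ hsp h h' =>
    obtain ⟨h1, h2⟩ := h.linear
    obtain ⟨h3, h4⟩ := h'.linear
    exact ⟨fun hs => .esub (h1 ((hsp.strict hs).1.push k σ)) h2.of_push.2 (h3 (hsp.strict hs).2).1
      (h3 (hsp.strict hs).2).2 (hsp.disjoint h2.of_push.1 h4),
      hsp.dom h2.of_push.1 h4⟩

theorem TypedBag.linear {Γ : Ctx} {B : Bag} {π : List Ty} (h : TypedBag Γ B π) :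
    (Γ.Strict → Bag.Linear B) ∧ Γ.Dom (Bag.fv B) := by
  match h with
  | .one => exact ⟨fun _ => .nil, Ctx.dom_empty⟩
  | .bag Θ Γ Δ M B σ k hsp h h' =>
    obtain ⟨h1, h2⟩ := h.linear
    obtain ⟨h3, h4⟩ := h'.linear
    exact ⟨fun hs => Bag.linear_cons (h1 (hsp.strict hs).1) (h3 (hsp.strict hs).2) (hsp.disjoint h2 h4), hsp.dom h2 h4⟩

end

mutual

theorem WF.linear {Γ : Ctx} {M : Term} {τ : Ty} (h : WF Γ M τ) :
    (Γ.Strict → M.Linear) ∧ Γ.Dom M.fv := by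
  match h with
  | .typed Γ M τ h => exact h.linear
  | .weak Δ x M τ hx h =>
    refine ⟨fun hs => absurd hs (Ctx.not_strict_add _ _ _), ?_⟩
    rw [Term.fv, outer_zero]
    exact h.linear.2.add x _
  | .share Δ k x M σ τ hk hx h =>
    exact ⟨fun hs => absurd hs (Ctx.not_strict_add _ _ _), h.linear.2.of_push.1.add x _⟩
  | .lam Δ k M σ τ h =>
    obtain ⟨h1, h2⟩ := h.linear
    exact ⟨fun hs => .lam (h1 (hs.push k σ)) h2.of_push.2, h2.of_push.1⟩
  | .fail Γ X τ h => exact ⟨fun _ => .fail X, fun n => (h n).symm⟩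
  | .app Θ Γ Δ M B σ τ j k hsp h h' =>
    obtain ⟨h1, h2⟩ := h.linear
    obtain ⟨h3, h4⟩ := h'.linear
    exact ⟨fun hs => .app (h1 (hsp.strict hs).1) (h3 (hsp.strict hs).2).1 (h3 (hsp.strict hs).2).2
      (hsp.disjoint h2 h4), hsp.dom h2 h4⟩
  | .lsub Θ Γ Δ M N σ τ hsp h h' =>
    obtain ⟨h1, h2⟩ := h.linear
    obtain ⟨h3, h4⟩ := h'.linear
    exact ⟨fun hs => .lsub (h1 ((hsp.strict hs).1.push 1 σ)) (h3 (hsp.strict hs).2) (h2.of_push.2 0 Nat.one_pos)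
      (hsp.disjoint h2.of_push.1 h4),
      hsp.dom h2.of_push.1 h4⟩
  | .esub Θ Γ Δ k j M B σ τ hsp h h' =>
    obtain ⟨h1, h2⟩ := h.linear
    obtain ⟨h3, h4⟩ := h'.linear
    exact ⟨fun hs => .esub (h1 ((hsp.strict hs).1.push k σ)) h2.of_push.2 (h3 (hsp.strict hs).2).1
      (h3 (hsp.strict hs).2).2 (hsp.disjoint h2.of_push.1 h4),
      hsp.dom h2.of_push.1 h4⟩

theorem WFBag.linear {Γ : Ctx} {B : Bag} {π : List Ty} (h : WFBag Γ B π) :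
    (Γ.Strict → Bag.Linear B) ∧ Γ.Dom (Bag.fv B) := by
  match h with
  | .typed Γ B π h => exact h.linear
  | .bag Θ Γ Δ M B σ k hsp h h' =>
    obtain ⟨h1, h2⟩ := h.linear
    obtain ⟨h3, h4⟩ := h'.linear
    exact ⟨fun hs => Bag.linear_cons (h1 (hsp.strict hs).1) (h3 (hsp.strict hs).2) (hsp.disjoint h2 h4), hsp.dom h2 h4⟩

end

theorem WFExpr.linear {Γ : Ctx} {E : Expr} {τ : Ty} (h : WFExpr Γ E τ) (hc : E.Closed) :
    ∀ M ∈ E, M.Linear := by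
  induction h with
  | term M τ h =>
    intro N hN
    obtain rfl := Multiset.mem_singleton.1 hN
    refine h.linear.1 fun n π hn => ?_
    have := (h.linear.2 n).2 (by simp [hn])
    simp [hc N hN] at this
  | sum E F τ h h' ih ih' =>
    intro N hN
    rcases Multiset.mem_add.1 hN with hN | hN
    · exact ih (fun M hM => hc M (Multiset.mem_add.2 (.inl hM))) N hN
    · exact ih' (fun M hM => hc M (Multiset.mem_add.2 (.inr hM))) N hN

theorem WFExpr.ne_zero {Γ : Ctx} {E : Expr} {τ : Ty} (h : WFExpr Γ E τ) : E ≠ 0 := by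
  induction h with
  | term M τ h => exact Multiset.singleton_ne_zero M
  | sum E F τ h h' ih ih' => exact fun h => ih (by simp_all)

end ShLam

namespace ShLam

open Proc.SProc
open Proc (SProc ind cnt)

/-! ### The translation is linear -/

theorem names_insert {ρ : ℕ → ℕ} {x : ℕ} {X : Finset ℕ} (h : x ∉ X) :
    names ρ (insert x X) = ρ x ::ₘ names ρ X := by
  rw [names, Finset.insert_val_of_notMem h, Multiset.map_cons]
  rfl

theorem names_union {ρ : ℕ → ℕ} {X Y : Finset ℕ} (h : Disjoint X Y) :
    names ρ (X ∪ Y) = names ρ X + names ρ Y := by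
  rw [← Finset.disjUnion_eq_union X Y h, names, Finset.disjUnion_val, Multiset.map_add]
  rfl

theorem names_outer (ρ : ℕ → ℕ) (k : ℕ) (X : Finset ℕ) :
    names ρ (outer k X) = names (fun i => ρ (i - k)) (X \ (List.range k).toFinset) := by
  have : X \ (List.range k).toFinset = (outer k X).image (· + k) := by
    ext x
    simp only [Finset.mem_sdiff, List.mem_toFinset, List.mem_range, Finset.mem_image, mem_outer]
    constructor
    · exact fun ⟨h, hk⟩ => ⟨x - k, by rwa [Nat.sub_add_cancel (not_lt.1 hk)], by omega⟩
    · rintro ⟨y, hy, rfl⟩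
      exact ⟨hy, by omega⟩
  rw [this, names_image (add_left_injective k).injOn]
  exact names_congr fun x _ => by simp

theorem cnt_names_mono {ρ : ℕ → ℕ} {X Y : Finset ℕ} (h : X ⊆ Y) (s : Set ℕ) :
    cnt s (names ρ X) ≤ cnt s (names ρ Y) := by
  rw [← Finset.union_sdiff_of_subset h, names_union Finset.disjoint_sdiff, Proc.cnt_add]
  omega

theorem cnt_names_up_succ (ρ : ℕ → ℕ) (n : ℕ) (X : Finset ℕ) (s : Set ℕ) :
    cnt ((· + 1) '' s) (names (up (n + 1) ρ) X) = cnt s (names (up n ρ) X) := by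
  have : names (up (n + 1) ρ) X = (names (up n ρ) X).map (· + 1) := by
    rw [names_map]
    rfl
  rw [this, Proc.cnt_map, Proc.preimage_succ_image]

theorem cnt_names_zero {ρ : ℕ → ℕ} {X : Finset ℕ} (h : ∀ x, ρ x ≠ 0) :
    cnt {0} (names ρ X) = 0 := by
  rw [Proc.cnt_eq_zero]
  intro n hn
  obtain ⟨x, _, rfl⟩ := Multiset.mem_map.1 hn
  exact h x

theorem up_zero (ρ : ℕ → ℕ) : up 0 ρ = ρ := rfl

theorem up_succ_ne_zero (ρ : ℕ → ℕ) (n x : ℕ) : up (n + 1) ρ x ≠ 0 := Nat.succ_ne_zero _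

theorem ind_image_zero (s : Set ℕ) : ind ((· + 1) '' s) 0 = 0 := by simp [Proc.ind]

theorem ind_zero_succ (n : ℕ) : ind {0} (n + 1) = 0 := by simp [Proc.ind]

theorem ind_self (n : ℕ) : ind {n} n = 1 := by simp [Proc.ind]

theorem ind_le_one (s : Set ℕ) (n : ℕ) : ind s n ≤ 1 := by
  unfold Proc.ind
  split_ifs <;> omega

/-- The occurrences of names in a linear translation. -/
def OccBound (p : SProc) (w : Multiset ℕ) : Prop := p.lin ∧ ∀ s, p.occ s ≤ cnt s w

theorem cnt_update_zero (ρ : ℕ → ℕ) (i : ℕ) (X : Finset ℕ) :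
    cnt {0} (names (Function.update (up 2 ρ) i 0) X) ≤ 1 := by
  have hle : X ⊆ insert i (X.erase i) := by
    intro x hx
    by_cases h : x = i <;> simp [h, hx]
  refine (cnt_names_mono hle _).trans ?_
  rw [names_insert (Finset.notMem_erase i X), Proc.cnt_cons,
    names_congr (ρ' := up 2 ρ) (fun x hx => Function.update_of_ne (Finset.ne_of_mem_erase hx) _ _),
    cnt_names_zero (up_succ_ne_zero ρ 1), Function.update_self, ind_self]

theorem cnt_update_image (ρ : ℕ → ℕ) (i : ℕ) (l : List ℕ) (X : Finset ℕ) (s : Set ℕ) :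
    cnt ((· + 1) '' s) (names (Function.update (up 2 ρ) i 0) (X \ l.toFinset)) ≤
      cnt s (names (up 1 ρ) (X \ (i :: l).toFinset)) := by
  have hle : X \ l.toFinset ⊆ insert i (X \ (i :: l).toFinset) := by
    intro x hx
    by_cases h : x = i
    · simp [h]
    · simpa [h] using hx
  refine (cnt_names_mono hle _).trans ?_
  rw [names_insert (by simp), Proc.cnt_cons,
    names_congr (ρ' := up 2 ρ)
      (fun x hx => Function.update_of_ne (by rintro rfl; simp at hx) _ _), cnt_names_up_succ,
    Function.update_self, ind_image_zero, add_zero]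

theorem OccBound.share {M : Term}
    (h : ∀ ρ u, OccBound (M.den ρ u) (u ::ₘ names ρ M.fv)) (l : List ℕ) (ρ : ℕ → ℕ) (x u : ℕ) :
    OccBound (M.shareDen l ρ x u) (x ::ₘ u ::ₘ names ρ (M.fv \ l.toFinset)) := by
  induction l generalizing ρ x u with
  | nil =>
    have hb := h (up 1 ρ) (u + 1)
    rw [shareDen_nil]
    refine ⟨?_, fun s => ?_⟩
    · have h0 := hb.2 {0}
      rw [Proc.cnt_cons, cnt_names_zero (up_succ_ne_zero ρ 0), ind_zero_succ] at h0
      simp only [lin_someOut, lin_out, lin_add, lin_someIn, lin_closeIn, occ_add, occ_someIn,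
        occ_closeIn, occ_noneOut, ind_zero_succ, ind_self, Proc.cnt_cons,
        cnt_names_zero (up_succ_ne_zero ρ 0)]
      exact ⟨⟨hb.1, trivial⟩, by omega⟩
    · have h0 := hb.2 ((· + 1) '' s)
      simp only [Proc.cnt_cons, Proc.ind_succ, cnt_names_up_succ, up_zero] at h0
      simp only [occ_someOut, occ_out, occ_add, occ_someIn, occ_closeIn, occ_noneOut,
        Proc.cnt_cons, Proc.ind_succ, cnt_names_up_succ, up_zero, ind_image_zero,
        List.toFinset_nil, Finset.sdiff_empty]
      omega
  | cons i l ih =>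
    have hb := ih (Function.update (up 2 ρ) i 0) (x + 2) (u + 2)
    rw [shareDen_cons]
    refine ⟨?_, fun s => ?_⟩
    · have h0 := hb.2 {0}
      have h1 := hb.2 ((· + 1) '' {0})
      have h2 := cnt_update_zero ρ i (M.fv \ l.toFinset)
      have h3 := cnt_update_image ρ i l M.fv {0}
      simp only [Proc.cnt_cons, Proc.ind_succ, ind_zero_succ] at h0 h1
      rw [cnt_names_zero (up_succ_ne_zero ρ 0)] at h3
      simp only [lin_someOut, lin_out, lin_add, lin_someIn, lin_closeIn, lin_inp, occ_add,
        occ_someIn, occ_closeIn, ind_zero_succ, ind_self, Proc.cnt_cons, occ_someOut, occ_inp,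
        cnt_names_zero (up_succ_ne_zero ρ 0), occ_zero, Proc.cnt_zero]
      refine ⟨⟨trivial, hb.1, by omega⟩, by omega⟩
    · have h0 := hb.2 ((· + 1) '' ((· + 1) '' s))
      have h3 := cnt_update_image ρ i l M.fv ((· + 1) '' s)
      simp only [Proc.cnt_cons, Proc.ind_succ] at h0
      rw [cnt_names_up_succ, up_zero] at h3
      simp only [occ_someOut, occ_out, occ_add, occ_someIn, occ_closeIn, occ_inp,
        Proc.cnt_cons, Proc.ind_succ, cnt_names_up_succ, up_zero, ind_image_zero, Proc.cnt_zero,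
        occ_zero]
      omega

theorem OccBound.sub {N : Term}
    (h : ∀ ρ u, OccBound (N.den ρ u) (u ::ₘ names ρ N.fv)) (ρ : ℕ → ℕ) :
    OccBound (N.subDen ρ) (0 ::ₘ names (up 1 ρ) N.fv) := by
  have h0 := h (up 1 ρ) 0
  refine ⟨(lin_someIn _ _ _).2 h0.1, fun s => ?_⟩
  have := h0.2 s
  rw [Proc.cnt_cons] at this
  simp only [Term.subDen, occ_someIn, Proc.cnt_cons]
  omega

theorem OccBound.bag {B : Bag} (hB : Bag.Linear B)
    (h : ∀ N ∈ B, ∀ ρ u, OccBound (Term.den N ρ u) (u ::ₘ names ρ (Term.fv N)))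
    (ρ : ℕ → ℕ) (x : ℕ) : OccBound (Bag.den B ρ x) (x ::ₘ names ρ (Bag.fv B)) := by
  induction B generalizing ρ x with
  | nil =>
    rw [bagDen_nil]
    refine ⟨?_, fun s => ?_⟩
    · have e1 : (closeOut 0).lin ∧ (noneOut (x + 1)).lin := ⟨trivial, trivial⟩
      simpa [ind_zero_succ, ind_self, Proc.cnt_zero] using e1
    · simp only [occ_someOut, occ_add, occ_someIn, occ_inp, occ_closeOut, occ_noneOut,
        Proc.cnt_cons, Proc.ind_succ, ind_image_zero, Proc.cnt_zero]
      omega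
  | cons N L ih =>
    obtain ⟨-, hL, hd⟩ := hB.cons
    have h1 := OccBound.sub (h N List.mem_cons_self) (up 1 ρ)
    have h2 := ih hL (fun N hN => h N (List.mem_cons_of_mem _ hN)) (up 2 ρ) (x + 2)
    have hn (ρ : ℕ → ℕ) : names ρ (Bag.fv (N :: L)) = names ρ N.fv + names ρ (Bag.fv L) :=
      names_union hd
    rw [bagDen_cons]
    refine ⟨?_, fun s => ?_⟩
    · have h10 := h1.2 {0}
      have h20 := h2.2 {0}
      have h11 := h1.2 ((· + 1) '' {0})
      have h21 := h2.2 ((· + 1) '' {0})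
      simp only [Proc.cnt_cons, Proc.ind_succ, ind_zero_succ, ind_self, ind_image_zero,
        ← up_two, cnt_names_up_succ, cnt_names_zero (up_succ_ne_zero ρ 0),
        cnt_names_zero (up_succ_ne_zero ρ 1)] at h10 h20 h11 h21
      have e1 : ind {0} 1 = 0 := ind_zero_succ 0
      have e2 : ind ((· + 1) '' {0}) 1 = 1 := (Proc.ind_succ {0} 0).trans (ind_self 0)
      simp only [lin_someOut, lin_out, lin_add, lin_someIn, lin_inp, occ_add,
        occ_someIn, occ_noneOut, ind_zero_succ, ind_self, Proc.cnt_cons, occ_someOut,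
        occ_out, cnt_names_zero (up_succ_ne_zero ρ 0), e1, e2]
      exact ⟨⟨⟨h1.1, h2.1, trivial⟩, by omega⟩, by omega⟩
    · have h10 := h1.2 ((· + 1) '' ((· + 1) '' s))
      have h20 := h2.2 ((· + 1) '' ((· + 1) '' s))
      have e2 : ind ((· + 1) '' ((· + 1) '' s)) 1 = 0 :=
        (Proc.ind_succ _ 0).trans (ind_image_zero _)
      simp only [Proc.cnt_cons, Proc.ind_succ, ind_image_zero,
        ← up_two, cnt_names_up_succ, up_zero] at h10 h20
      simp only [occ_someOut, occ_out, occ_add, occ_someIn, occ_inp, occ_noneOut, Proc.cnt_add,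
        Proc.cnt_cons, Proc.ind_succ, cnt_names_up_succ, up_zero, ind_image_zero, hn, e2]
      omega

theorem OccBound.arg {B L : Bag} (hB : Bag.Linear B) (hL : L.Perm B)
    (h : ∀ N ∈ B, ∀ ρ u, OccBound (Term.den N ρ u) (u ::ₘ names ρ (Term.fv N)))
    (ρ : ℕ → ℕ) (u : ℕ) :
    OccBound (argDen B L ρ u) (0 ::ₘ (u + 1) ::ₘ names (up 1 ρ) (Bag.fv B)) := by
  have h1 := OccBound.bag (hB.perm hL) (fun N hN => h N (hL.mem_iff.1 hN)) (up 2 ρ) 0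
  rw [Bag.fv_perm hL] at h1
  rw [argDen]
  refine ⟨?_, fun s => ?_⟩
  · have h10 := h1.2 {0}
    simp only [Proc.cnt_cons, ind_self, cnt_names_zero (up_succ_ne_zero ρ 1)] at h10
    simp only [lin_someIn, lin_out, lin_add, occ_add, occ_fwd, ind_zero_succ]
    have e1 : ind {0} 1 = 0 := ind_zero_succ 0
    exact ⟨⟨trivial, h1.1⟩, by omega⟩
  · have h10 := h1.2 ((· + 1) '' s)
    have e2 : ind ((· + 1) '' s) 1 = ind s 0 := Proc.ind_succ _ 0
    have e3 : ind ((· + 1) '' s) (u + 2) = ind s (u + 1) := Proc.ind_succ _ (u + 1)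
    simp only [Proc.cnt_cons, ind_image_zero, cnt_names_up_succ] at h10
    simp only [occ_someIn, occ_out, occ_add, occ_fwd, Proc.cnt_cons, e2, e3]
    omega

theorem OccBound.res {p : SProc} {w : Multiset ℕ} (h : p.lin) (h0 : p.occ {0} ≤ 2)
    (h' : ∀ s, p.occ ((· + 1) '' s) ≤ cnt s w) : OccBound (SProc.res p) w :=
  ⟨(lin_res p).2 ⟨h, h0⟩, fun s => by rw [occ_res]; exact h' s⟩

theorem OccBound.sups {m : Multiset SProc} {w : Multiset ℕ} (hm : m ≠ 0)
    (h : ∀ p ∈ m, OccBound p w) : OccBound (sups m) w :=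
  ⟨lin_sups hm fun p hp => (h p hp).1, fun s => occ_sups_le hm fun p hp => (h p hp).2 s⟩

theorem cnt_names_ext (ρ : ℕ → ℕ) (X : Finset ℕ) (s : Set ℕ) :
    cnt ((· + 1) '' s) (names (ext ρ) X) ≤ cnt s (names ρ (outer 1 X)) := by
  have hle : X ⊆ insert 0 (X \ (List.range 1).toFinset) := by
    intro x hx
    by_cases h : x = 0 <;> simp [h, hx]
  refine (cnt_names_mono hle _).trans ?_
  rw [names_insert (by simp), Proc.cnt_cons, ext, if_pos rfl, ind_image_zero, names_outer,
    names_congr (ρ' := up 1 fun i => ρ (i - 1)), cnt_names_up_succ, up_zero, add_zero]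
  intro x hx
  have : x ≠ 0 := by rintro rfl; simp at hx
  simp [ext, up, this]

theorem cnt_names_ext_zero (ρ : ℕ → ℕ) (X : Finset ℕ) : cnt {0} (names (ext ρ) X) ≤ 1 := by
  have hle : X ⊆ insert 0 (X \ (List.range 1).toFinset) := by
    intro x hx
    by_cases h : x = 0 <;> simp [h, hx]
  refine (cnt_names_mono hle _).trans ?_
  rw [names_insert (by simp), Proc.cnt_cons, ext, if_pos rfl, ind_self,
    names_congr (ρ' := up 1 fun i => ρ (i - 1)), cnt_names_zero (up_succ_ne_zero _ 0)]
  intro x hx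
  have : x ≠ 0 := by rintro rfl; simp at hx
  simp [ext, up, this]

theorem Term.Linear.occBound {M : Term} (hM : M.Linear) (ρ : ℕ → ℕ) (u : ℕ) :
    OccBound (M.den ρ u) (u ::ₘ names ρ M.fv) := by
  induction hM generalizing ρ u with
  | var x =>
    refine ⟨trivial, fun s => ?_⟩
    rw [den_var]
    have e1 : names ρ (Term.var x).fv = ρ x ::ₘ 0 := rfl
    simp only [occ_someOut, occ_fwd, e1, Proc.cnt_cons]
    omega
  | @lam k M h hk ih =>
    have h1 := OccBound.share ih (List.range k) (up 1 fun i => ρ (i - k)) 0 (u + 1)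
    rw [den_lam]
    refine ⟨?_, fun s => ?_⟩
    · have h10 := h1.2 {0}
      simp only [Proc.cnt_cons, ind_self, ind_zero_succ, cnt_names_zero (up_succ_ne_zero _ 0)]
        at h10
      rw [lin_someOut, lin_inp]
      exact ⟨h1.1, h10⟩
    · have h10 := h1.2 ((· + 1) '' s)
      simp only [Proc.cnt_cons, ind_image_zero, Proc.ind_succ, cnt_names_up_succ, up_zero] at h10
      simp only [occ_someOut, occ_inp, Proc.cnt_cons, Term.fv, names_outer]
      change max _ (max _ ((M.shareDen _ (up 1 fun i => ρ (i - k)) 0 (u + 1)).occ _)) ≤ _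
      omega
  | @app M B h hB hp hd ih ih' =>
    rw [den_app]
    refine .sups (multiset_map_ne_zero (permutations_ne_zero B) _) fun p hp' => ?_
    obtain ⟨L, hL, rfl⟩ := Multiset.mem_map.1 hp'
    have h1 := ih (up 1 ρ) 0
    have h2 := OccBound.arg ⟨hB, hp⟩ (mem_of_mem_permutations hL) ih' ρ u
    refine .res ?_ ?_ fun s => ?_
    · exact (lin_add _ _).2 ⟨h1.1, h2.1⟩
    · have h10 := h1.2 {0}
      have h20 := h2.2 {0}
      simp only [Proc.cnt_cons, ind_self, ind_zero_succ, cnt_names_zero (up_succ_ne_zero _ 0)]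
        at h10 h20
      rw [occ_add]
      omega
    · have h10 := h1.2 ((· + 1) '' s)
      have h20 := h2.2 ((· + 1) '' s)
      simp only [Proc.cnt_cons, ind_image_zero, Proc.ind_succ, cnt_names_up_succ, up_zero]
        at h10 h20
      rw [occ_add, Term.fv, names_union hd, Proc.cnt_cons, Proc.cnt_add]
      omega
  | @lsub M N h h' h0 hd ih ih' =>
    rw [den_lsub]
    have h1 := ih (ext ρ) (u + 1)
    have h2 := OccBound.sub ih' ρ
    refine .res ?_ ?_ fun s => ?_
    · exact (lin_add _ _).2 ⟨h1.1, h2.1⟩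
    · have h10 := h1.2 {0}
      have h20 := h2.2 {0}
      have := cnt_names_ext_zero ρ M.fv
      simp only [Proc.cnt_cons, ind_self, ind_zero_succ, cnt_names_zero (up_succ_ne_zero _ 0)]
        at h10 h20
      rw [occ_add]
      omega
    · have h10 := h1.2 ((· + 1) '' s)
      have h20 := h2.2 ((· + 1) '' s)
      have := cnt_names_ext ρ M.fv s
      simp only [Proc.cnt_cons, ind_image_zero, Proc.ind_succ, cnt_names_up_succ, up_zero]
        at h10 h20
      rw [occ_add, Term.fv, names_union hd, Proc.cnt_cons, Proc.cnt_add]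
      omega
  | fail X =>
    rw [den_fail]
    exact ⟨lin_nones _, fun s => (occ_nones _ s).le⟩
  | @esub k M B h hk hB hp hd ih ih' =>
    rw [den_esub]
    refine .sups (multiset_map_ne_zero (permutations_ne_zero B) _) fun p hp' => ?_
    obtain ⟨L, hL, rfl⟩ := Multiset.mem_map.1 hp'
    have hL := mem_of_mem_permutations hL
    have h1 := OccBound.share ih (List.range k) (up 1 fun i => ρ (i - k)) 0 (u + 1)
    have h2 := OccBound.bag (Bag.Linear.perm ⟨hB, hp⟩ hL) (fun N hN => ih' N (hL.mem_iff.1 hN))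
      (up 1 ρ) 0
    rw [Bag.fv_perm hL] at h2
    refine .res ?_ ?_ fun s => ?_
    · exact (lin_add _ _).2 ⟨h1.1, h2.1⟩
    · have h10 := h1.2 {0}
      have h20 := h2.2 {0}
      simp only [Proc.cnt_cons, ind_self, ind_zero_succ, cnt_names_zero (up_succ_ne_zero _ 0)]
        at h10 h20
      rw [occ_add]
      change (M.shareDen _ (up 1 fun i => ρ (i - k)) 0 (u + 1)).occ _ + _ ≤ _
      omega
    · have h10 := h1.2 ((· + 1) '' s)
      have h20 := h2.2 ((· + 1) '' s)
      simp only [Proc.cnt_cons, ind_image_zero, Proc.ind_succ, cnt_names_up_succ, up_zero]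
        at h10 h20
      rw [occ_add, Term.fv, names_union hd, Proc.cnt_cons, Proc.cnt_add, names_outer]
      change (M.shareDen _ (up 1 fun i => ρ (i - k)) 0 (u + 1)).occ _ + _ ≤ _
      omega

end ShLam

namespace Proc.SProc

open ShLam

/-! ### Communication between a sharing construct and a bag -/

theorem reds_some (x : ℕ) (w : Multiset ℕ) (p q : SProc) :
    Reds (someOut x p + someIn x w q) (p + q) := .single (.some x w p q)

theorem reds_none (x : ℕ) (w : Multiset ℕ) (q : SProc) :
    Reds (noneOut x + someIn x w q) (nones w) := .single (.none x w q)

theorem reds_comm (x : ℕ) (p q : SProc) : Reds (out x p + inp x q) (res (p + q)) :=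
  .single (.comm x q p)

theorem reds_some_comm (x : ℕ) (w : Multiset ℕ) (p q : SProc) :
    Reds (someOut x (out x p) + someIn x w (inp x q)) (res (p + q)) :=
  (reds_some x w _ _).trans (reds_comm x p q)

theorem Reds.add {p p' q q' : SProc} (h : Reds p p') (h' : Reds q q') :
    Reds (p + q) (p' + q') := (h.add_right q).trans (h'.add_left p')

theorem res_rename_lift_succ (p : SProc) : res (res (p.rename (lift 1 (· + 1)))) = res p := by
  rw [← rename_res, res_fresh]

end Proc.SProc

namespace ShLam

open Proc.SProc
open Proc (SProc)

theorem swap_zero : swapGroups 1 1 0 = 1 := rfl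

theorem swap_one : swapGroups 1 1 1 = 0 := rfl

theorem swap_add_two (n : ℕ) : swapGroups 1 1 (n + 2) = n + 2 := by simp [swapGroups]

theorem swap_comp_up_two (ρ : ℕ → ℕ) : swapGroups 1 1 ∘ up 2 ρ = up 2 ρ :=
  funext fun _ => swap_add_two _

theorem swap_comp_update (ρ : ℕ → ℕ) (i : ℕ) :
    swapGroups 1 1 ∘ Function.update (up 2 ρ) i 0 = up 1 (Function.update (up 1 ρ) i 0) := by
  funext n
  by_cases h : n = i
  · subst h
    simp [up, swap_zero]
  · simp only [Function.comp, Function.update_of_ne h, up]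
    exact swap_add_two _

theorem lift_succ_comp_update (ρ : ℕ → ℕ) (i : ℕ) :
    lift 1 (· + 1) ∘ Function.update (up 1 ρ) i 0 = Function.update (up 2 ρ) i 0 :=
  lift_comp_update _ _ _

theorem lift_succ_comp_up (ρ : ℕ → ℕ) : lift 1 (· + 1) ∘ up 1 ρ = up 2 ρ :=
  lift_comp_up _ _

theorem shareDen_bagDen_cons (M N : Term) (i : ℕ) (l : List ℕ) (L : Bag) (ρ σ : ℕ → ℕ) (u : ℕ) :
    Reds (res (M.shareDen (i :: l) (up 1 ρ) 0 (u + 1) + Bag.den (N :: L) (up 1 σ) 0))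
      (res (N.subDen σ + res (M.shareDen l (up 1 (Function.update (up 1 ρ) i 0)) 0 (u + 2) +
        Bag.den L (up 2 σ) 0))) := by
  have e : res (N.subDen σ + res (M.shareDen l (up 1 (Function.update (up 1 ρ) i 0)) 0 (u + 2) +
        Bag.den L (up 2 σ) 0)) =
      res (res (res (N.subDen (up 2 σ) + Bag.den L (up 3 σ) 2 +
        M.shareDen l (Function.update (up 3 ρ) i 0) 2 (u + 3)))) := by
    have e1 : N.subDen (up 2 σ) + Bag.den L (up 3 σ) 2 +
          M.shareDen l (Function.update (up 3 ρ) i 0) 2 (u + 3) =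
        (N.subDen (up 1 σ) + Bag.den L (up 2 σ) 1 +
          M.shareDen l (Function.update (up 2 ρ) i 0) 1 (u + 2)).rename (lift 1 (· + 1)) := by
      rw [rename_add, rename_add, subDen_rename_of N.rename_den, Bag.rename_den,
        Term.rename_shareDen, up_two ρ, up_two σ, lift_succ_comp_update, lift_succ_comp_up,
        lift_one_succ, lift_one_succ]
      rfl
    have e2 : (N.subDen (up 1 σ) + Bag.den L (up 2 σ) 1 +
          M.shareDen l (Function.update (up 2 ρ) i 0) 1 (u + 2)).rename (swapGroups 1 1) =
        (N.subDen σ).rename (· + 1) + (Bag.den L (up 2 σ) 0 +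
          M.shareDen l (up 1 (Function.update (up 1 ρ) i 0)) 0 (u + 2)) := by
      rw [rename_add, rename_add, Bag.rename_den, Term.rename_shareDen, swap_comp_update,
        swap_comp_up_two, Term.rename_subDen, Term.rename_subDen, swap_one, swap_add_two, swap_zero,
        ← up_two, swap_comp_up_two, add_assoc]
      rfl
    rw [e1, res_rename_lift_succ, res_swap, e2, add_res, add_comm (Bag.den L _ _)]
  rw [e, shareDen_cons, bagDen_cons]
  refine Reds.res ((reds_some_comm _ _ _ _).trans (Reds.res ?_))
  simp only [zero_add]
  rw [add_assoc]
  refine (Reds.add_left ((reds_some _ _ _ _).trans ?_) _).trans (b := someIn 0 0 (closeIn 0 0) +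
    res (N.subDen (up 2 σ) + (Bag.den L (up 3 σ) 2 + noneOut 1) +
        M.shareDen l (Function.update (up 3 ρ) i 0) 2 (u + 3))) ?_
  · rw [add_comm]
    exact reds_some_comm _ _ _ _
  · rw [add_res]
    refine Reds.res ?_
    have := (reds_none 1 0 (closeIn 1 0)).add_left (N.subDen (up 2 σ) + Bag.den L (up 3 σ) 2 +
        M.shareDen l (Function.update (up 3 ρ) i 0) 2 (u + 3))
    rw [nones_zero, add_zero] at this
    convert this using 1
    change someIn 1 0 (closeIn 1 0) + _ = _
    abel

theorem shareDen_bagDen_nil (M : Term) (ρ σ : ℕ → ℕ) (u : ℕ) :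
    Reds (res (M.shareDen [] (up 1 ρ) 0 (u + 1) + Bag.den [] (up 1 σ) 0)) (M.den ρ u) := by
  have e : M.den ρ u = res (res (M.den (up 2 ρ) (u + 2))) := by
    have h (ρ : ℕ → ℕ) (u : ℕ) : res (M.den (up 1 ρ) (u + 1)) = M.den ρ u := by
      conv_rhs => rw [← res_fresh (M.den ρ u), M.rename_den]
      rfl
    rw [up_two, h, h]
  rw [e, shareDen_nil, bagDen_nil]
  refine Reds.res ((reds_some_comm _ _ _ _).trans (Reds.res ?_))
  rw [zero_add]
  have h1 := (reds_some 0 ((u + 2) ::ₘ names (up 2 ρ) M.fv) (closeOut 0)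
    (closeIn 0 (M.den (up 2 ρ) (u + 2)))).add (reds_none 1 0 (noneOut 1))
  have h2 := h1.trans (Reds.add_right (.single (.close _ _)) _)
  rw [nones_zero, add_zero] at h2
  convert h2 using 1
  rw [← up_two]
  abel

theorem shareDen_cons_bagDen_nil (M : Term) (i : ℕ) (l : List ℕ) (ρ σ : ℕ → ℕ) (u : ℕ) :
    Reds (res (M.shareDen (i :: l) (up 1 ρ) 0 (u + 1) + Bag.den [] (up 1 σ) 0))
      (nones (u ::ₘ names ρ (M.fv \ (i :: l).toFinset))) := by
  set X := M.fv \ (i :: l).toFinset with hX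
  have e : nones (u ::ₘ names ρ X) = res (res (nones ((u + 2) ::ₘ names (up 2 ρ) X))) := by
    have h (ρ : ℕ → ℕ) (u : ℕ) : res (nones ((u + 1) ::ₘ names (up 1 ρ) X)) =
        nones (u ::ₘ names ρ X) := by
      conv_rhs => rw [← res_fresh (nones _), nones_rename, Multiset.map_cons, names_map]
      rfl
    rw [up_two, h, h]
  rw [e, shareDen_cons, bagDen_nil, ← hX]
  refine Reds.res ((reds_some_comm _ _ _ _).trans (Reds.res ?_))
  simp only [zero_add]
  have h1 : Reds (someOut 0 (closeOut 0) + someIn 0 0 (closeIn 0 0)) 0 :=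
    (reds_some _ _ _ _).trans (.single (.close _ _))
  have h2 : Reds (someOut 1 (someIn 1 ((u + 2) ::ₘ names (up 2 ρ) X)
      (inp 1 (M.shareDen l (Function.update (up 2 (up 1 ρ)) i 0) 2 (u + 3)))) +
        someIn 1 0 (noneOut 1)) (nones ((u + 2) ::ₘ names (up 2 ρ) X)) := by
    refine (reds_some _ _ _ _).trans ?_
    rw [add_comm]
    exact reds_none _ _ _
  have h3 := Reds.add h1 h2
  rw [zero_add] at h3
  convert h3 using 1
  rw [← up_two]
  abel

theorem shareDen_nil_bagDen_cons (M N : Term) (L : Bag) (ρ σ : ℕ → ℕ) (u : ℕ) :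
    Reds (res (M.shareDen [] (up 1 ρ) 0 (u + 1) + Bag.den (N :: L) (up 1 σ) 0))
      (nones (u ::ₘ names ρ M.fv + names σ (Bag.fv (N :: L)))) := by
  set X := Bag.fv (N :: L) with hX
  have e : nones (u ::ₘ names ρ M.fv + names σ X) =
      res (res (nones ((u + 2) ::ₘ names (up 2 ρ) M.fv + names (up 2 σ) X))) := by
    have h (ρ σ : ℕ → ℕ) (u : ℕ) : res (nones ((u + 1) ::ₘ names (up 1 ρ) M.fv +
        names (up 1 σ) X)) = nones (u ::ₘ names ρ M.fv + names σ X) := by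
      conv_rhs => rw [← res_fresh (nones _), nones_rename, Multiset.map_add, Multiset.map_cons,
        names_map, names_map]
      rfl
    rw [up_two, up_two, h, h]
  rw [e, shareDen_nil, bagDen_cons, ← hX]
  refine Reds.res ((reds_some_comm _ _ _ _).trans (Reds.res ?_))
  simp only [zero_add]
  refine (ReflTransGen.trans (b := nones (0 ::ₘ names (up 2 σ) X) +
    someIn 0 ((u + 2) ::ₘ names (up 2 ρ) M.fv) (closeIn 0 (M.den (up 2 ρ) (u + 2)))) ?_ ?_)
  · rw [add_comm (someIn 0 _ _) (noneOut 1), add_right_comm]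
    exact (reds_none _ _ _).add_right _
  · rw [nones_cons, add_right_comm, nones_add]
    exact (reds_none _ _ _).add_right _

/-- A term below the linear substitutions of the elements of a bag for the variables in a
list. -/
def linkDen (M : Term) : List ℕ → Bag → (ℕ → ℕ) → (ℕ → ℕ) → ℕ → SProc
  | i :: l, N :: L, ρ, σ, u =>
      res (N.subDen σ + linkDen M l L (Function.update (up 1 ρ) i 0) (up 1 σ) (u + 1))
  | [], _, ρ, _, u => M.den ρ u
  | _, [], ρ, _, u => M.den ρ u

theorem shareDen_bagDen_linkDen (M : Term) (l : List ℕ) (L : Bag) (h : l.length = L.length)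
    (ρ σ : ℕ → ℕ) (u : ℕ) :
    Reds (res (M.shareDen l (up 1 ρ) 0 (u + 1) + Bag.den L (up 1 σ) 0))
      (linkDen M l L ρ σ u) := by
  induction l generalizing L ρ σ u with
  | nil =>
    cases L with
    | nil => exact shareDen_bagDen_nil M ρ σ u
    | cons N L => simp at h
  | cons i l ih =>
    cases L with
    | nil => simp at h
    | cons N L =>
      exact (shareDen_bagDen_cons M N i l L ρ σ u).trans
        (Reds.res ((ih L (by simpa using h) _ _ _).add_left _))

theorem linkDen_rename (M : Term) (l : List ℕ) (L : Bag) (ρ σ : ℕ → ℕ) (u : ℕ) (f : ℕ → ℕ) :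
    (linkDen M l L ρ σ u).rename f = linkDen M l L (f ∘ ρ) (f ∘ σ) (f u) := by
  induction l generalizing L ρ σ u f with
  | nil =>
    simp only [linkDen]
    exact M.rename_den _ _ _
  | cons i l ih =>
    cases L with
    | nil =>
      simp only [linkDen]
      exact M.rename_den _ _ _
    | cons N L =>
      simp only [linkDen]
      rw [rename_res, rename_add, ih, subDen_rename_of N.rename_den, lift_comp_update,
        lift_comp_up, lift_one_succ]

/-- `p` and `q` commute as arguments of cuts. -/
theorem res_add_res_swap {p p' q q' r : SProc} (hp : p.rename (swapGroups 1 1) = p'.rename (· + 1))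
    (hq : q.rename (· + 1) = q'.rename (swapGroups 1 1)) :
    res (q + res (p + r)) = res (p' + res (q' + r.rename (swapGroups 1 1))) := by
  have hq' : (q.rename (· + 1)).rename (swapGroups 1 1) = q' := by
    rw [hq, SProc.rename_rename]
    refine (congrArg (q'.rename ·) (funext fun n => ?_)).trans q'.rename_id
    match n with
    | 0 => rfl
    | 1 => rfl
    | n + 2 => simp [swapGroups]
  rw [add_res, res_swap, add_res, rename_add, rename_add, hp, hq']
  congr 2
  abel

theorem linkDen_lsub (M K : Term) (l : List ℕ) (L : Bag) (h : l.length = L.length)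
    (ρ σ τ : ℕ → ℕ) (u : ℕ) (hK : ∀ y ∈ K.fv, y ∉ l ∧ ρ y = τ y) :
    linkDen (.lsub M K) l L ρ σ u =
      res (K.subDen τ + linkDen M (l.map Nat.succ) L (ext ρ) (up 1 σ) (u + 1)) := by
  induction l generalizing L ρ σ τ u with
  | nil =>
    simp only [linkDen, List.map_nil]
    rw [den_lsub, add_comm, K.subDen_congr fun y hy => (hK y hy).2]
  | cons i l ih =>
    cases L with
    | nil => simp at h
    | cons N L =>
      simp only [linkDen, List.map_cons]
      rw [ih L (by simpa using h) _ _ (up 1 τ)]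
      · rw [res_add_res_swap (p' := K.subDen τ) (q' := N.subDen (up 1 σ)), linkDen_rename]
        · have e1 : swapGroups 1 1 ∘ ext (Function.update (up 1 ρ) i 0) =
              Function.update (up 1 (ext ρ)) i.succ 0 := by
            funext n
            cases n with
            | zero => rfl
            | succ n =>
              by_cases hn : n = i
              · subst hn
                simp [ext, swap_one]
              · simp only [Function.comp, ext, Nat.add_sub_cancel, Nat.succ_ne_zero, if_false,
                  Function.update_of_ne hn, ne_eq, Nat.succ_eq_add_one, add_left_inj, hn,
                  not_false_eq_true, Function.update_of_ne, up]
                exact swap_add_two _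
          rw [e1, ← up_two, swap_comp_up_two, swap_add_two]
        · rw [Term.rename_subDen, Term.rename_subDen, ← up_two, swap_comp_up_two, swap_zero]
          rfl
        · rw [Term.rename_subDen, Term.rename_subDen, ← up_two, swap_comp_up_two, swap_zero]
          rfl
      · intro y hy
        obtain ⟨h1, h2⟩ := hK y hy
        rw [List.mem_cons, not_or] at h1
        refine ⟨h1.2, ?_⟩
        rw [Function.update_of_ne h1.1]
        simp [up, h2]

theorem den_lsubs (M : Term) (L : Bag) (ρ : ℕ → ℕ) (u : ℕ) :
    (M.lsubs L).den ρ u =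
      linkDen M (List.range L.length) L (fun i => ρ (i - L.length)) ρ u := by
  induction L generalizing M with
  | nil => rfl
  | cons N L ih =>
    rw [Term.lsubs, ih, linkDen_lsub (τ := fun i => ρ (i - L.length)) _ _ _ _ List.length_range,
      List.length_cons, List.range_succ_eq_map, linkDen]
    · congr 2
      · exact N.subDen_rename (add_left_injective _).injOn fun y _ => by simp
      · congr 1
        funext i
        cases i with
        | zero => rfl
        | succ i => simp [ext, up]
    · intro y hy
      rw [Term.shift, N.fv_rename] at hy
      obtain ⟨z, _, rfl⟩ := Finset.mem_image.1 hy
      simp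

/-- The substitution of a bag for the variables of a term, for one order of the bag. -/
theorem shareDen_bagDen_lsubs (M : Term) (L : Bag) (ρ : ℕ → ℕ) (u : ℕ) :
    Reds (res (M.shareDen (List.range L.length) (fun i => ρ (i - L.length) + 1) 0 (u + 1) +
      Bag.den L (up 1 ρ) 0)) ((M.lsubs L).den ρ u) := by
  rw [den_lsubs]
  exact shareDen_bagDen_linkDen M _ L List.length_range (fun i => ρ (i - L.length)) ρ u

/-- A failure of an explicit substitution, for one order of the bag. -/
theorem shareDen_bagDen_fail (M : Term) (l : List ℕ) (L : Bag) (hl : l.Nodup)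
    (hlM : ∀ i ∈ l, i ∈ M.fv) (hL : Bag.Linear L)
    (h : l.length ≠ L.length ∨ M = .fail M.fv) (ρ σ : ℕ → ℕ) (u : ℕ) :
    Reds (res (M.shareDen l (up 1 ρ) 0 (u + 1) + Bag.den L (up 1 σ) 0))
      (nones (u ::ₘ names ρ (M.fv \ l.toFinset) + names σ (Bag.fv L))) := by
  induction l generalizing L ρ σ u with
  | nil =>
    cases L with
    | nil =>
      have h := h.resolve_left (by simp)
      have := shareDen_bagDen_nil M ρ σ u
      conv at this => rhs; rw [h, den_fail]
      simpa [Bag.fv, names] using this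
    | cons N L => simpa using shareDen_nil_bagDen_cons M N L ρ σ u
  | cons i l ih =>
    cases L with
    | nil => simpa [Bag.fv, names] using shareDen_cons_bagDen_nil M i l ρ σ u
    | cons N L =>
      rw [List.nodup_cons] at hl
      obtain ⟨-, hL', hd⟩ := hL.cons
      refine (shareDen_bagDen_cons M N i l L ρ σ u).trans ?_
      have := ih L hl.2 (fun j hj => hlM j (List.mem_cons_of_mem _ hj)) hL' (by simpa using h)
        (Function.update (up 1 ρ) i 0) (up 1 σ) (u + 1)
      refine (Reds.res (this.add_left _)).trans ?_
      have e1 : M.fv \ l.toFinset = insert i (M.fv \ (i :: l).toFinset) := by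
        ext x
        by_cases hx : x = i
        · subst hx
          simp [hlM x List.mem_cons_self, hl.1]
        · simp [hx]
      have e2 : names (Function.update (up 1 ρ) i 0) (M.fv \ l.toFinset) =
          0 ::ₘ names (up 1 ρ) (M.fv \ (i :: l).toFinset) := by
        rw [e1, names_insert (by simp), Function.update_self,
          names_congr fun x hx => Function.update_of_ne (by rintro rfl; simp at hx) _ _]
      have e3 : nones (u ::ₘ names ρ (M.fv \ (i :: l).toFinset) + names σ (Bag.fv (N :: L))) =
          res (nones (names (up 1 σ) N.fv) + nones ((u + 1) ::ₘ
            (names (up 1 ρ) (M.fv \ (i :: l).toFinset) + names (up 1 σ) (Bag.fv L)))) := by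
        rw [← res_fresh (nones _), nones_rename, Bag.fv, names_union hd]
        simp only [Multiset.map_add, Multiset.map_cons, names_map, nones_add, nones_cons]
        change res (noneOut (u + 1) + nones (names (up 1 ρ) _) + (nones (names (up 1 σ) _) +
          nones (names (up 1 σ) _))) = _
        congr 1
        abel
      rw [e2, e3, Multiset.cons_add, Multiset.cons_add, Multiset.cons_swap, nones_cons, ← add_assoc,
        add_comm (N.subDen σ)]
      exact Reds.res ((reds_none _ _ _).add_right _)

end ShLam

namespace ShLam

open Proc.SProc
open Proc (SProc)

/-! ### Simulation of the reductions -/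

/-- The translation of an expression up to structural congruence. -/
noncomputable def Expr.den (E : Expr) (ρ : ℕ → ℕ) (u : ℕ) : SProc := sups (E.map fun M => M.den ρ u)

theorem den_singleton (M : Term) (ρ : ℕ → ℕ) (u : ℕ) : Expr.den {M} ρ u = M.den ρ u := by
  rw [Expr.den, Multiset.map_singleton, sups_singleton]

theorem Expr.cls_enc {E : Expr} (h : E ≠ 0) (ρ : ℕ → ℕ) (u : ℕ) :
    (Expr.enc E ρ u).cls = Expr.den E ρ u := by
  rw [Expr.enc, cls_choices (by simpa using h), List.map_map, Expr.den]
  conv_rhs => rw [← Multiset.coe_toList E, Multiset.map_coe]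
  rfl

theorem permConst_ne_zero (B : Bag) (M : Term) : permConst B M ≠ 0 := by
  rw [permConst, ne_eq, Multiset.coe_eq_zero]
  exact permutations_ne_nil B _

theorem den_permConst (B : Bag) (M : Term) (ρ : ℕ → ℕ) (u : ℕ) :
    Expr.den (permConst B M) ρ u = M.den ρ u := by
  have : permConst B M = (B.permutations : Multiset Bag).map fun _ => M := rfl
  rw [Expr.den, this, Multiset.map_map]
  exact sups_map_const (permutations_ne_zero B) _

theorem sups_permutations_reds {B : Bag} {f g : Bag → SProc} (h : ∀ L, L.Perm B → Reds (f L) (g L)) :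
    Reds (sups ((B.permutations : Multiset Bag).map f))
      (sups ((B.permutations : Multiset Bag).map g)) :=
  sups_map_reds (permutations_ne_zero B) fun L hL => h L (mem_of_mem_permutations hL)

theorem sups_permutations_reds_const {B : Bag} {f : Bag → SProc} {p : SProc}
    (h : ∀ L, L.Perm B → Reds (f L) p) :
    Reds (sups ((B.permutations : Multiset Bag).map f)) p := by
  have := sups_permutations_reds (g := fun _ => p) h
  rwa [sups_map_const (permutations_ne_zero B)] at this

theorem den_beta (k : ℕ) (M : Term) (B : Bag) (ρ : ℕ → ℕ) (u : ℕ) :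
    Reds ((Term.app (.lam k M) B).den ρ u) ((Term.esub k M B).den ρ u) := by
  rw [den_app, den_esub]
  refine sups_permutations_reds fun L _ => ?_
  rw [den_lam, argDen]
  refine (Reds.res (((reds_some _ _ _ _).trans ?_))).trans
    (b := res (res (fwd 1 (u + 2) + Bag.den L (up 2 ρ) 0 +
      M.shareDen (List.range k) (fun i => up 1 ρ (i - k) + 1) 0 1))) ?_
  · rw [add_comm]
    exact reds_comm _ _ _
  · rw [res_swap, rename_add, rename_add, rename_fwd, swap_one, swap_add_two, add_assoc]
    refine (Reds.res (.single (.forw (u + 1) _))).trans ?_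
    rw [← rename_add, SProc.rename_rename, rename_add, Bag.rename_den, Term.rename_shareDen,
      add_comm]
    have e1 : (Proc.inst (u + 1) ∘ swapGroups 1 1) ∘ up 2 ρ = up 1 ρ := by
      rw [Function.comp_assoc, swap_comp_up_two]
      rfl
    have e2 : (Proc.inst (u + 1) ∘ swapGroups 1 1) ∘ (fun i => up 1 ρ (i - k) + 1) =
        fun i => ρ (i - k) + 1 := congrArg (· ∘ fun i => i - k) e1
    rw [e1, e2]
    exact .refl

theorem den_exSub {k : ℕ} (M : Term) {B : Bag} (h : B.length = k) (ρ : ℕ → ℕ) (u : ℕ) :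
    Reds ((Term.esub k M B).den ρ u)
      (Expr.den ((B.permutations.map M.lsubs : List Term) : Expr) ρ u) := by
  rw [den_esub, Expr.den, ← Multiset.map_coe, Multiset.map_map]
  refine sups_permutations_reds fun L hL => ?_
  obtain rfl : L.length = k := hL.length_eq.trans h
  exact shareDen_bagDen_lsubs M L ρ u

theorem den_esub_fail {k : ℕ} {M : Term} {B : Bag} (hM : (Term.esub k M B).Linear)
    (h : k ≠ B.length ∨ M = .fail M.fv) (ρ : ℕ → ℕ) (u : ℕ) :
    Reds ((Term.esub k M B).den ρ u) ((Term.fail (outer k M.fv ∪ Bag.fv B)).den ρ u) := by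
  cases hM with
  | esub hM hk hB hp hd =>
    rw [den_esub, den_fail, names_union hd, names_outer, ← Multiset.cons_add]
    refine sups_permutations_reds_const fun L hL => ?_
    rw [← Bag.fv_perm hL]
    exact shareDen_bagDen_fail M (List.range k) L List.nodup_range
      (fun i hi => hk i (List.mem_range.1 hi)) (Bag.Linear.perm ⟨hB, hp⟩ hL)
      (by rwa [List.length_range, hL.length_eq]) (fun i => ρ (i - k)) ρ u

theorem res_nones_up (u : ℕ) (ρ : ℕ → ℕ) (X : Finset ℕ) :
    res (nones ((u + 1) ::ₘ names (up 1 ρ) X)) = nones (u ::ₘ names ρ X) := by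
  conv_rhs => rw [← res_fresh (nones _), nones_rename, Multiset.map_cons, names_map]
  rfl

theorem den_app_fail {X : Finset ℕ} {B : Bag} (hd : Disjoint X (Bag.fv B)) (ρ : ℕ → ℕ) (u : ℕ) :
    Reds ((Term.app (.fail X) B).den ρ u) ((Term.fail (X ∪ Bag.fv B)).den ρ u) := by
  rw [den_app, den_fail (X ∪ Bag.fv B), ← res_nones_up, names_union hd]
  refine sups_permutations_reds_const fun L _ => Reds.res ?_
  rw [den_fail, argDen, nones_cons, add_right_comm, add_comm (names _ X), ← Multiset.cons_add,
    nones_add]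
  exact (reds_none _ _ _).add_right _

theorem outer_one_eq {X : Finset ℕ} (h : 0 ∈ X) (ρ : ℕ → ℕ) :
    names (ext ρ) X = 0 ::ₘ names (up 1 ρ) (outer 1 X) := by
  have : X = insert 0 (X \ (List.range 1).toFinset) := by
    ext x
    by_cases hx : x = 0 <;> simp [hx, h]
  conv_lhs => rw [this]
  rw [names_insert (by simp), names_outer]
  congr 1
  refine names_congr fun x hx => ?_
  have : x ≠ 0 := by rintro rfl; simp at hx
  simp [ext, up, this]

theorem den_lsub_fail {X : Finset ℕ} {N : Term} (h0 : 0 ∈ X) (hd : Disjoint (outer 1 X) N.fv)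
    (ρ : ℕ → ℕ) (u : ℕ) :
    Reds ((Term.lsub (.fail X) N).den ρ u) ((Term.fail (outer 1 X ∪ N.fv)).den ρ u) := by
  rw [den_lsub, den_fail, den_fail, ← res_nones_up u ρ, names_union hd, outer_one_eq h0, Term.subDen,
    Multiset.cons_swap, nones_cons, add_right_comm, ← Multiset.cons_add, add_comm (_ ::ₘ _),
    nones_add]
  exact Reds.res ((reds_none _ _ _).add_right _)

/-- The head of the term, which is reached through applications and linear substitutions, is
the free variable `x`. -/
inductive Term.HeadVar : Term → ℕ → Prop
  | var (x : ℕ) : Term.HeadVar (.var x) x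
  | app {M : Term} {x : ℕ} (h : M.HeadVar x) (B : Bag) : Term.HeadVar (.app M B) x
  | lsub {M : Term} {x : ℕ} (h : M.HeadVar (x + 1)) (N : Term) : Term.HeadVar (.lsub M N) x

theorem Term.HeadVar.headVar_eq {M : Term} {x : ℕ} (h : M.HeadVar x) : M.headVar = some x := by
  induction h with
  | var x => rfl
  | app h B ih => exact ih
  | lsub h N ih => simp [Term.headVar, ih, outVar]

theorem Term.HeadVar.mem_fv {M : Term} {x : ℕ} (h : M.HeadVar x) : x ∈ M.fv := by
  induction h with
  | var x => exact Finset.mem_singleton_self x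
  | app h B ih => exact Finset.mem_union_left _ ih
  | lsub h N ih => exact Finset.mem_union_left _ (mem_outer.2 ih)

/-- `(ν x)(M | x.some; N)` reduces to the translation of the head substitution. -/
theorem Term.HeadVar.den_headSubst {M : Term} {x : ℕ} (h : M.HeadVar x) (hM : M.Linear) (N : Term)
    {ρ ρ' : ℕ → ℕ} (u : ℕ) (hx : ρ x = 0) (hρ : ∀ y ∈ M.fv, y ≠ x → ρ y = ρ' y + 1) :
    Reds (res (M.den ρ (u + 1) + N.subDen ρ')) ((M.headSubst x N).den ρ' u) := by
  induction h generalizing ρ ρ' u N with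
  | var x =>
    rw [den_var, hx]
    refine (Reds.res (reds_some _ _ _ _)).trans ((ReflTransGen.single (.forw u _)).trans ?_)
    rw [N.rename_den, Term.headSubst, if_pos rfl]
    exact .refl
  | @app M x h B ih =>
    cases hM with
    | app hM hB hp hd =>
      rw [den_app, Term.headSubst, den_app]
      have hxB : x ∉ Bag.fv B := Finset.disjoint_left.1 hd h.mem_fv
      have hB : ∀ y ∈ Bag.fv B, ρ y = ρ' y + 1 := fun y hy =>
        hρ y (Finset.mem_union_right _ hy) fun h => hxB (h ▸ hy)
      rw [map_sups_permutations (fun p => res (p + N.subDen ρ'))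
        (fun p q => by rw [sup_add, res_sup])]
      refine sups_permutations_reds fun L hL => ?_
      rw [add_comm _ (N.subDen ρ'), add_comm _ (argDen B L ρ (u + 1)),
        res_add_res_swap (p' := argDen B L ρ' u) (q' := N.subDen (up 1 ρ')), add_comm (argDen _ _ _ _),
        M.rename_den]
      · refine Reds.res (Reds.add_right ?_ _)
        rw [swap_zero, add_comm]
        refine ih hM N 0 ?_ ?_
        · simp [up, hx, swap_one]
        · intro y hy hyx
          simp only [Function.comp, up, hρ y (Finset.mem_union_left _ hy) hyx]
          exact swap_add_two _
      · rw [rename_argDen, rename_argDen, swap_zero, swap_add_two,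
          names_congr (ρ := swapGroups 1 1 ∘ up 1 ρ) (ρ' := (· + 1) ∘ up 1 ρ') ,
          Bag.den_congr L (ρ := up 1 ((· + 1) ∘ up 1 ρ'))]
        · intro y hy
          rw [Bag.fv_perm hL] at hy
          simp only [Function.comp, up, hB y hy]
          rw [swap_add_two]
        · intro y hy
          simp only [Function.comp, up, hB y hy]
          exact swap_add_two _
      · rw [Term.rename_subDen, Term.rename_subDen, ← up_two, swap_comp_up_two, swap_zero]
        rfl
  | @lsub M x h K ih =>
    cases hM with
    | lsub hM hK h0 hd =>
      rw [den_lsub, Term.headSubst, den_lsub]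
      have hxK : x ∉ K.fv := Finset.disjoint_left.1 hd (mem_outer.2 h.mem_fv)
      have hK : ∀ y ∈ K.fv, ρ y = ρ' y + 1 := fun y hy =>
        hρ y (Finset.mem_union_right _ hy) fun h => hxK (h ▸ hy)
      rw [add_comm _ (N.subDen ρ'), add_comm _ (K.subDen ρ),
        res_add_res_swap (p' := K.subDen ρ') (q' := N.subDen (up 1 ρ')), add_comm (K.subDen _),
        M.rename_den]
      · refine Reds.res (Reds.add_right ?_ _)
        rw [swap_add_two, add_comm]
        have e : (N.shift 1).subDen (ext ρ') = N.subDen (up 1 ρ') :=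
          N.subDen_rename (add_left_injective 1).injOn fun y _ => by simp [ext, up]
        rw [← e]
        refine ih hM (N.shift 1) (u + 1) ?_ ?_
        · simp [ext, hx, swap_one]
        · intro y hy hyx
          cases y with
          | zero => rfl
          | succ y =>
            simp only [Function.comp, ext, Nat.add_sub_cancel, Nat.succ_ne_zero, if_false,
              hρ y (Finset.mem_union_left _ (mem_outer.2 hy)) fun h => hyx (h ▸ rfl)]
            exact swap_add_two _
      · rw [Term.rename_subDen, Term.rename_subDen, swap_zero,
          names_congr (ρ := swapGroups 1 1 ∘ up 1 ρ) (ρ' := (· + 1) ∘ up 1 ρ') ,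
          K.den_congr (ρ := (· + 1) ∘ up 1 ρ')]
        all_goals
          intro y hy
          simp only [Function.comp, up, hK y hy]
          exact swap_add_two _
      · rw [Term.rename_subDen, Term.rename_subDen, ← up_two, swap_comp_up_two, swap_zero]
        rfl

theorem Term.HeadVar.fv_headSubst {M : Term} {x : ℕ} (h : M.HeadVar x) (hM : M.Linear) (N : Term) :
    (M.headSubst x N).fv = M.fv.erase x ∪ N.fv := by
  induction h generalizing N with
  | var x => simp [Term.headSubst, Term.fv]
  | @app M x h B ih =>
    cases hM with
    | app hM hB hp hd =>
      have hxB : x ∉ Bag.fv B := Finset.disjoint_left.1 hd h.mem_fv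
      rw [Term.headSubst, Term.fv, ih hM, Term.fv, Finset.erase_union_distrib,
        Finset.erase_eq_of_notMem hxB, Finset.union_right_comm]
  | @lsub M x h K ih =>
    cases hM with
    | lsub hM hK h0 hd =>
      have hxK : x ∉ K.fv := Finset.disjoint_left.1 hd (mem_outer.2 h.mem_fv)
      rw [Term.headSubst, Term.fv, ih hM, Term.fv, Finset.erase_union_distrib,
        Finset.erase_eq_of_notMem hxK]
      ext y
      simp [mem_outer, Term.shift, Term.fv_rename]
      tauto

theorem Term.Linear.rename {M : Term} (hM : M.Linear) {f : ℕ → ℕ} (hf : Set.InjOn f M.fv) :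
    (M.rename f).Linear := by
  have key {X Y Z : Finset ℕ} {f : ℕ → ℕ} (hf : Set.InjOn f Z) (hX : X ⊆ Z) (hY : Y ⊆ Z)
      (h : Disjoint X Y) : Disjoint (X.image f) (Y.image f) := by
    rw [Finset.disjoint_left]
    intro n hn hn'
    obtain ⟨a, ha, rfl⟩ := Finset.mem_image.1 hn
    obtain ⟨b, hb, hab⟩ := Finset.mem_image.1 hn'
    exact Finset.disjoint_left.1 h ha (hf (hX ha) (hY hb) hab.symm ▸ hb)
  have hbag {B : Bag} {f : ℕ → ℕ} (hf : Set.InjOn f (Bag.fv B))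
      (h : ∀ N ∈ B, ∀ {f : ℕ → ℕ}, Set.InjOn f (Term.fv N) → (N.rename f).Linear)
      (hp : B.Pairwise fun N N' => Disjoint N.fv N'.fv) : Bag.Linear (Bag.rename f B) := by
    have hsub {N : Term} (hN : N ∈ B) : N.fv ⊆ Bag.fv B := fun y hy => Bag.mem_fv.2 ⟨N, hN, hy⟩
    rw [Bag.rename_eq_map]
    refine ⟨fun N hN => ?_, ?_⟩
    · obtain ⟨N, hNB, rfl⟩ := List.mem_map.1 hN
      exact h N hNB (hf.mono (hsub hNB))
    · rw [List.pairwise_map]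
      refine hp.imp_of_mem fun ha hb h => ?_
      rw [Term.fv_rename, Term.fv_rename]
      exact key hf (hsub ha) (hsub hb) h
  have hlift {k : ℕ} {f : ℕ → ℕ} {M : Term} (hk : ∀ i < k, i ∈ M.fv) :
      ∀ i < k, i ∈ (M.rename (lift k f)).fv := fun i hi => by
    rw [Term.fv_rename]
    exact Finset.mem_image.2 ⟨i, hk i hi, lift_of_lt f hi⟩
  induction hM generalizing f with
  | var x => exact .var _
  | lam h hk ih => exact .lam (ih (injOn_lift hf)) (hlift hk)
  | @app M B h hB hp hd ih ih' =>
    have hM : M.fv ⊆ (Term.app M B).fv := Finset.subset_union_left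
    have hBs : Bag.fv B ⊆ (Term.app M B).fv := Finset.subset_union_right
    have hl := hbag (hf.mono hBs) (fun N hN _ => ih' N hN) hp
    refine .app (ih (hf.mono hM)) hl.1 hl.2 ?_
    rw [Term.fv_rename, Bag.fv_rename]
    exact key hf hM hBs hd
  | @lsub M N h h' h0 hd ih ih' =>
    have hM : outer 1 M.fv ⊆ (Term.lsub M N).fv := Finset.subset_union_left
    have hN : N.fv ⊆ (Term.lsub M N).fv := Finset.subset_union_right
    refine .lsub (ih (injOn_lift (hf.mono hM))) (ih' (hf.mono hN))
      (hlift (k := 1) (by simpa using h0) 0 Nat.one_pos) ?_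
    rw [Term.fv_rename, Term.fv_rename, outer_image_lift]
    exact key hf hM hN hd
  | fail X => exact .fail _
  | @esub k M B h hk hB hp hd ih ih' =>
    have hM : outer k M.fv ⊆ (Term.esub k M B).fv := Finset.subset_union_left
    have hBs : Bag.fv B ⊆ (Term.esub k M B).fv := Finset.subset_union_right
    have hl := hbag (hf.mono hBs) (fun N hN _ => ih' N hN) hp
    refine .esub (ih (injOn_lift (hf.mono hM))) (hlift hk) hl.1 hl.2 ?_
    rw [Term.fv_rename, Bag.fv_rename, outer_image_lift]
    exact key hf hM hBs hd

theorem Term.Linear.shift {M : Term} (hM : M.Linear) (k : ℕ) : (M.shift k).Linear :=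
  hM.rename (add_left_injective k).injOn

theorem mem_fv_shift {k x : ℕ} {M : Term} : x ∈ (M.shift k).fv ↔ k ≤ x ∧ x - k ∈ M.fv := by
  rw [Term.shift, Term.fv_rename, Finset.mem_image]
  constructor
  · rintro ⟨y, hy, rfl⟩
    simpa using hy
  · exact fun ⟨h, h'⟩ => ⟨x - k, h', by omega⟩

theorem Term.HeadVar.linear_headSubst {M : Term} {x : ℕ} (h : M.HeadVar x) (hM : M.Linear)
    {N : Term} (hN : N.Linear) (hd : Disjoint (M.fv.erase x) N.fv) :
    (M.headSubst x N).Linear := by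
  induction h generalizing N with
  | var x => rwa [Term.headSubst, if_pos rfl]
  | @app M x h B ih =>
    cases hM with
    | app hM hB hp hd' =>
      have hxB : x ∉ Bag.fv B := Finset.disjoint_left.1 hd' h.mem_fv
      rw [Term.fv, Finset.erase_union_distrib, Finset.erase_eq_of_notMem hxB,
        Finset.disjoint_union_left] at hd
      refine .app (ih hM hN hd.1) hB hp ?_
      rw [h.fv_headSubst hM, Finset.disjoint_union_left]
      exact ⟨hd'.mono_left (Finset.erase_subset _ _), hd.2.symm⟩
  | @lsub M x h K ih =>
    cases hM with
    | lsub hM hK h0 hd' =>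
      have hxK : x ∉ K.fv := Finset.disjoint_left.1 hd' (mem_outer.2 h.mem_fv)
      rw [Term.fv, Finset.erase_union_distrib, Finset.erase_eq_of_notMem hxK,
        Finset.disjoint_union_left] at hd
      refine .lsub (ih hM (hN.shift 1) ?_) hK ?_ ?_
      · rw [Finset.disjoint_left]
        intro y hy hy'
        obtain ⟨hy1, hy'⟩ := mem_fv_shift.1 hy'
        obtain ⟨y, rfl⟩ := Nat.exists_eq_add_of_le' hy1
        rw [Nat.add_sub_cancel] at hy'
        refine Finset.disjoint_left.1 hd.1 ?_ hy'
        simpa [mem_outer] using hy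
      · rw [h.fv_headSubst hM]
        simp [h0]
      · rw [h.fv_headSubst hM, Finset.disjoint_left]
        intro y hy hyK
        simp only [mem_outer, Finset.mem_union, Finset.mem_erase, mem_fv_shift,
          Nat.add_sub_cancel] at hy
        rcases hy with hy | hy
        · exact Finset.disjoint_left.1 hd' (mem_outer.2 hy.2) hyK
        · exact Finset.disjoint_left.1 hd.2 hyK hy.2

theorem Term.linear_lsubs {M : Term} {L : Bag} (hM : M.Linear) (hk : ∀ i < L.length, i ∈ M.fv)
    (hL : Bag.Linear L) (hd : Disjoint (outer L.length M.fv) (Bag.fv L)) :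
    (M.lsubs L).Linear ∧ (M.lsubs L).fv = outer L.length M.fv ∪ Bag.fv L := by
  induction L generalizing M with
  | nil => exact ⟨hM, by simp [Term.lsubs, Bag.fv, outer_zero]⟩
  | cons N L ih =>
    obtain ⟨hN, hL', hNL⟩ := hL.cons
    rw [List.length_cons] at hk hd
    have hmem (x : ℕ) : x ∈ outer L.length (Term.lsub M (N.shift L.length)).fv ↔
        x ∈ outer (L.length + 1) M.fv ∪ N.fv := by
      simp [Term.fv, mem_outer, mem_fv_shift, add_assoc]
    have hfv := Finset.ext hmem
    have hd1 : Disjoint (outer (L.length + 1) M.fv) N.fv :=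
      hd.mono_right Finset.subset_union_left
    have hd2 : Disjoint (outer (L.length + 1) M.fv) (Bag.fv L) :=
      hd.mono_right Finset.subset_union_right
    obtain ⟨h1, h2⟩ := ih (M := .lsub M (N.shift L.length)) (.lsub hM (hN.shift _) (hk 0 (by omega)) (by
        rw [Finset.disjoint_left]
        intro y hy hy'
        obtain ⟨hy1, hy'⟩ := mem_fv_shift.1 hy'
        refine Finset.disjoint_left.1 hd1 ?_ hy'
        rw [mem_outer] at hy ⊢
        convert hy using 1
        omega))
      (fun i hi => Finset.mem_union_left _ (mem_outer.2 (hk (i + 1) (by omega)))) hL'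
      (by rw [hfv, Finset.disjoint_union_left]; exact ⟨hd2, hNL⟩)
    refine ⟨h1, ?_⟩
    rw [Term.lsubs, h2, hfv, List.length_cons, Bag.fv, Finset.union_assoc]

/-! ### The size of terms -/

mutual
  /-- A measure that decreases in the evaluation of a term. -/
  def Term.weight : Term → ℕ
    | .var _ => 1
    | .lam _ M => M.weight + 1
    | .app M B => M.weight + Bag.weight B + 1
    | .lsub M N => M.weight + N.weight + 1
    | .fail _ => 0
    | .share _ M _ => M.weight + 1
    | .esub _ M B => M.weight + Bag.weight B + 1
  /-- The sum of the weights of the elements of a bag and of its size. -/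
  def Bag.weight : List Term → ℕ
    | [] => 0
    | M :: B => M.weight + 1 + Bag.weight B
end

theorem Bag.weight_eq_sum (B : Bag) : Bag.weight B = (B.map fun M => M.weight + 1).sum := by
  induction B with
  | nil => rfl
  | cons M B ih => rw [Bag.weight, ih, List.map_cons, List.sum_cons]

theorem Bag.weight_perm {B B' : Bag} (h : B.Perm B') : Bag.weight B = Bag.weight B' := by
  rw [Bag.weight_eq_sum, Bag.weight_eq_sum, (h.map _).sum_eq]

theorem Term.weight_rename (M : Term) (f : ℕ → ℕ) : (M.rename f).weight = M.weight := by
  have hB {B : Bag} (f : ℕ → ℕ) (h : ∀ N ∈ B, ∀ f, (Term.rename f N).weight = N.weight) :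
      Bag.weight (Bag.rename f B) = Bag.weight B := by
    rw [Bag.weight_eq_sum, Bag.weight_eq_sum, Bag.rename_eq_map, List.map_map]
    exact congrArg _ (List.map_congr_left fun N hN => congrArg (· + 1) (h N hN f))
  induction M using Term.ind generalizing f with
  | var x => rfl
  | lam k M ih => rw [Term.rename, Term.weight, Term.weight, ih]
  | app M B ih ih' => rw [Term.rename, Term.weight, Term.weight, ih, hB f ih']
  | lsub M N ih ih' => rw [Term.rename, Term.weight, Term.weight, ih, ih']
  | fail X => rfl
  | share k M x ih => rw [Term.rename, Term.weight, Term.weight, ih]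
  | esub k M B ih ih' => rw [Term.rename, Term.weight, Term.weight, ih, hB f ih']

theorem Bag.weight_rename (B : Bag) (f : ℕ → ℕ) : Bag.weight (Bag.rename f B) = Bag.weight B := by
  induction B with
  | nil => rfl
  | cons M B ih => rw [Bag.rename, Bag.weight, Bag.weight, ih, M.weight_rename]

theorem Term.weight_lsubs (M : Term) (L : Bag) :
    (M.lsubs L).weight = M.weight + Bag.weight L := by
  induction L generalizing M with
  | nil => rfl
  | cons N L ih =>
    rw [Term.lsubs, ih, Term.weight, Term.shift, Term.weight_rename, Bag.weight]
    omega

theorem Term.HeadVar.weight_headSubst {M : Term} {x : ℕ} (h : M.HeadVar x) (N : Term) :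
    (M.headSubst x N).weight + 1 = M.weight + N.weight := by
  induction h generalizing N with
  | var x =>
    rw [Term.headSubst, if_pos rfl, Term.weight]
    omega
  | app h B ih =>
    rw [Term.headSubst, Term.weight, Term.weight]
    have := ih N
    omega
  | lsub h K ih =>
    rw [Term.headSubst, Term.weight, Term.weight]
    have := ih (N.shift 1)
    rw [Term.shift, Term.weight_rename] at this
    rw [Term.shift]
    omega

end ShLam

namespace ShLam

open Proc.SProc
open Proc (SProc)

/-! ### Reduction up to the precongruence -/

theorem Expr.Pre.add_right {E F : Expr} (h : Expr.Pre E F) (G : Expr) : Expr.Pre (E + G) (F + G) := by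
  induction h with
  | refl E => exact .refl _
  | trans E F G _ _ ih ih' => exact .trans _ _ _ ih ih'
  | summand M M' E h =>
    rw [Multiset.cons_add, Multiset.cons_add]
    exact .summand _ _ _ h

theorem Expr.Red.add_right {E F : Expr} (h : Expr.Red E F) (G : Expr) : Expr.Red (E + G) (F + G) := by
  cases h with
  | summand M F E h =>
    rw [Multiset.cons_add, add_assoc]
    exact .summand _ _ _ h

theorem Expr.MultiPre.lift {E F : Expr} (h : Expr.MultiPre E F) (f : Expr → Expr)
    (hpre : ∀ E F, Expr.Pre E F → Expr.Pre (f E) (f F))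
    (hred : ∀ E F, Expr.Red E F → Expr.Red (f E) (f F)) : Expr.MultiPre (f E) (f F) := by
  obtain ⟨E', h, h'⟩ := h
  refine ⟨f E', ReflTransGen.lift f ?_ _ _ h, hpre _ _ h'⟩
  rintro E F ⟨E₁, E₂, h1, h2, h3⟩
  exact ⟨f E₁, f E₂, hpre _ _ h1, hred _ _ h2, hpre _ _ h3⟩

theorem Expr.MultiPre.refl (E : Expr) : Expr.MultiPre E E := ⟨E, .refl, .refl E⟩

theorem Expr.MultiPre.trans {E F G : Expr} (h : Expr.MultiPre E F) (h' : Expr.MultiPre F G) :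
    Expr.MultiPre E G := by
  obtain ⟨E', h1, h2⟩ := h
  obtain ⟨F', h3, h4⟩ := h'
  rcases h3.cases_head with rfl | ⟨F₁, ⟨A, B, hA, hAB, hB⟩, h3⟩
  · exact ⟨E', h1, .trans _ _ _ h2 h4⟩
  · exact ⟨F', h1.trans (.head ⟨A, B, .trans _ _ _ h2 hA, hAB, hB⟩ h3), h4⟩

theorem Expr.MultiPre.add {E E' F F' : Expr} (h : Expr.MultiPre E E') (h' : Expr.MultiPre F F') :
    Expr.MultiPre (E + F) (E' + F') := by
  have h1 := h.lift (· + F) (fun _ _ h => h.add_right F) (fun _ _ h => h.add_right F)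
  have h2 := h'.lift (· + E') (fun _ _ h => h.add_right E') (fun _ _ h => h.add_right E')
  rw [add_comm F, add_comm F'] at h2
  exact h1.trans h2

theorem Expr.MultiPre.map {E F : Expr} (h : Expr.MultiPre E F) (f : Term → Term)
    (hpre : ∀ M M', TPre M M' → TPre (f M) (f M')) (hred : ∀ M F, TRed M F → TRed (f M) (F.map f)) :
    Expr.MultiPre (E.map f) (F.map f) := by
  refine h.lift (Multiset.map f) (fun E F h => ?_) (fun E F h => ?_)
  · induction h with
    | refl E => exact .refl _
    | trans E F G _ _ ih ih' => exact .trans _ _ _ ih ih'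
    | summand M M' E h =>
      rw [Multiset.map_cons, Multiset.map_cons]
      exact .summand _ _ _ (hpre _ _ h)
  · cases h with
    | summand M F E h =>
      rw [Multiset.map_cons, Multiset.map_add]
      exact .summand _ _ _ (hred _ _ h)

theorem TRed.multiPre {M : Term} {F : Expr} (h : TRed M F) : Expr.MultiPre {M} F := by
  refine ⟨F, .single ⟨_, _, .refl _, ?_, .refl _⟩, .refl _⟩
  have := Expr.Red.summand M F 0 h
  rwa [add_zero] at this

theorem TPre.multiPre {M M' : Term} (h : TPre M M') : Expr.MultiPre {M} {M'} :=
  ⟨_, .refl, .summand M M' 0 h⟩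

/-- The expression `E` reduces to `F`, and so do their translations. -/
structure Simul (E F : Expr) : Prop where
  ne_zero : F ≠ 0
  multiPre : Expr.MultiPre E F
  reds (ρ : ℕ → ℕ) (u : ℕ) : Reds (E.den ρ u) (F.den ρ u)

theorem Simul.refl {E : Expr} (h : E ≠ 0) : Simul E E := ⟨h, .refl E, fun _ _ => .refl⟩

theorem Simul.trans {E F G : Expr} (h : Simul E F) (h' : Simul F G) : Simul E G :=
  ⟨h'.1, h.2.trans h'.2, fun ρ u => (h.3 ρ u).trans (h'.3 ρ u)⟩

theorem den_add {E F : Expr} (hE : E ≠ 0) (hF : F ≠ 0) (ρ : ℕ → ℕ) (u : ℕ) :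
    Expr.den (E + F) ρ u = E.den ρ u ⊔ F.den ρ u := by
  induction E, hE using multiset_induction with
  | h1 M => rw [Multiset.singleton_add, Expr.den, Multiset.map_cons,
      sups_cons _ (multiset_map_ne_zero hF _), den_singleton, Expr.den]
  | h2 M E hE ih =>
    have hEF : E + F ≠ 0 := fun h => hE (add_eq_zero.1 h).1
    rw [Multiset.cons_add, Expr.den, Multiset.map_cons, sups_cons _ (multiset_map_ne_zero hEF _),
      Expr.den, Multiset.map_cons, sups_cons _ (multiset_map_ne_zero hE _), sup_assoc]
    exact congrArg _ ih

theorem Simul.add {E E' F F' : Expr} (hE : E ≠ 0) (hF : F ≠ 0) (h : Simul E E') (h' : Simul F F') :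
    Simul (E + F) (E' + F') := by
  refine ⟨fun h0 => h.1 (add_eq_zero.1 h0).1, h.2.add h'.2, fun ρ u => ?_⟩
  rw [den_add hE hF, den_add h.1 h'.1]
  exact (h.3 ρ u).sup (h'.3 ρ u)

theorem Simul.bind {E : Expr} (hE : E ≠ 0) {C : Term → Prop}
    (h : ∀ M ∈ E, ∃ F, Simul {M} F ∧ ∀ M' ∈ F, C M') : ∃ F, Simul E F ∧ ∀ M' ∈ F, C M' := by
  induction E, hE using multiset_induction with
  | h1 M => exact h M (Multiset.mem_singleton_self M)
  | h2 M E hE ih =>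
    obtain ⟨F, hF, hF'⟩ := h M (Multiset.mem_cons_self M E)
    obtain ⟨G, hG, hG'⟩ := ih fun N hN => h N (Multiset.mem_cons_of_mem hN)
    refine ⟨F + G, ?_, fun N hN => (Multiset.mem_add.1 hN).elim (hF' N) (hG' N)⟩
    rw [← Multiset.singleton_add]
    exact hF.add (Multiset.singleton_ne_zero M) hE hG

theorem TRed.simul {M : Term} {F : Expr} (h : TRed M F) (hF : F ≠ 0)
    (h' : ∀ ρ u, Reds (M.den ρ u) (F.den ρ u)) : Simul {M} F :=
  ⟨hF, h.multiPre, fun ρ u => by rw [den_singleton]; exact h' ρ u⟩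

theorem TRed.simul_singleton {M N : Term} (h : TRed M {N})
    (h' : ∀ ρ u, Reds (M.den ρ u) (N.den ρ u)) : Simul {M} {N} :=
  h.simul (Multiset.singleton_ne_zero N) fun ρ u => by rw [den_singleton]; exact h' ρ u

theorem TRed.simul_permConst {M N : Term} {B : Bag} (h : TRed M (permConst B N))
    (h' : ∀ ρ u, Reds (M.den ρ u) (N.den ρ u)) : Simul {M} (permConst B N) :=
  h.simul (permConst_ne_zero B N) fun ρ u => by rw [den_permConst]; exact h' ρ u

theorem TPre.simul {M N : Term} (h : TPre M N)
    (h' : ∀ ρ u, Reds (M.den ρ u) (N.den ρ u)) : Simul {M} {N} :=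
  ⟨Multiset.singleton_ne_zero N, h.multiPre, fun ρ u => by
    rw [den_singleton, den_singleton]; exact h' ρ u⟩

theorem Simul.app {M : Term} {F : Expr} (h : Simul {M} F) (B : Bag) :
    Simul {.app M B} (F.map fun M' => .app M' B) := by
  refine ⟨multiset_map_ne_zero h.1 _, ?_, fun ρ u => ?_⟩
  · rw [← Multiset.map_singleton (fun M' => Term.app M' B) M]
    exact h.2.map _ (fun _ _ h => .ctxApp _ _ _ h) (fun _ _ h => .ctxApp _ _ _ h)
  · have e : Expr.den (F.map fun M' => .app M' B) ρ u =
        sups ((B.permutations : Multiset Bag).map fun L =>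
          res (F.den (up 1 ρ) 0 + argDen B L ρ u)) := by
      rw [Expr.den, Multiset.map_map]
      simp only [Function.comp_def, den_app]
      rw [sups_sups_comm h.1 (permutations_ne_zero B)]
      refine sups_permutations_congr fun L _ => ?_
      rw [Expr.den, map_sups (multiset_map_ne_zero h.1 _) (fun p => res (p + argDen B L ρ u))
        (fun p q => by rw [sup_add, res_sup]), Multiset.map_map]
      rfl
    rw [den_singleton, e, den_app]
    refine sups_permutations_reds fun L _ => Reds.res (Reds.add_right ?_ _)
    rw [← den_singleton]
    exact h.3 _ _

theorem Simul.lsub {M : Term} {F : Expr} (h : Simul {M} F) (N : Term) :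
    Simul {.lsub M N} (F.map fun M' => .lsub M' N) := by
  refine ⟨multiset_map_ne_zero h.1 _, ?_, fun ρ u => ?_⟩
  · rw [← Multiset.map_singleton (fun M' => Term.lsub M' N) M]
    exact h.2.map _ (fun _ _ h => .ctxLsub _ _ _ h) (fun _ _ h => .ctxLsub _ _ _ h)
  · have e : Expr.den (F.map fun M' => .lsub M' N) ρ u =
        res (F.den (ext ρ) (u + 1) + N.subDen ρ) := by
      rw [Expr.den, Multiset.map_map, Expr.den,
        map_sups (multiset_map_ne_zero h.1 _) (fun p => res (p + N.subDen ρ))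
        (fun p q => by rw [sup_add, res_sup]), Multiset.map_map]
      rfl
    rw [den_singleton, e, den_lsub]
    refine Reds.res (Reds.add_right ?_ _)
    rw [← den_singleton]
    exact h.3 _ _

theorem Simul.appLsub (M N : Term) (B : Bag) :
    Simul {.app (.lsub M N) B} {.lsub (.app M (Bag.shift 1 B)) N} := by
  refine (TPre.appLsub' M N B).simul fun ρ u => ?_
  have : (Term.app (.lsub M N) B).den ρ u = (Term.lsub (.app M (Bag.shift 1 B)) N).den ρ u := by
    rw [den_app, den_lsub (.app _ _), den_app, map_sups_permutations (fun p => res (p + N.subDen ρ))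
      (fun p q => by rw [sup_add, res_sup]), Bag.shift, permutations_rename, Multiset.map_map]
    refine sups_permutations_congr fun L hL => ?_
    have e1 : swapGroups 1 1 ∘ ext (up 1 ρ) = up 1 (ext ρ) := by
      funext i
      cases i with
      | zero => rfl
      | succ i => simpa [ext, up] using swap_add_two (ρ i)
    have e : argDen (Bag.rename (· + 1) B) (Bag.rename (· + 1) L) (ext ρ) (u + 1) =
        argDen B L (up 1 ρ) (u + 1) :=
      argDen_shift B L hL 1 (u + 1) fun x => by simp [ext, up]
    rw [Function.comp, e, den_lsub, add_comm _ (argDen _ _ _ _), add_comm _ (N.subDen _),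
      res_add_res_swap (p' := N.subDen ρ) (q' := argDen B L (up 1 ρ) (u + 1)), M.rename_den,
      e1, zero_add, swap_one, add_comm (N.subDen ρ), add_comm (argDen _ _ _ _)]
    · rw [Term.rename_subDen, Term.rename_subDen, ← up_two, swap_comp_up_two, swap_zero]
      rfl
    · rw [rename_argDen, rename_argDen, ← up_two, swap_comp_up_two, swap_zero, swap_add_two]
      rfl
  rw [this]

/-! ### Evaluation -/

/-- An abstraction below linear substitutions. -/
inductive Term.HeadLam : Term → Prop
  | lam (k : ℕ) (M : Term) : Term.HeadLam (.lam k M)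
  | lsub {M : Term} (h : M.HeadLam) (N : Term) : Term.HeadLam (.lsub M N)

/-- The results of evaluation. -/
def Term.IsValue (M : Term) : Prop := (∃ x, M.HeadVar x) ∨ M.HeadLam ∨ M = .fail M.fv

/-- A term can be evaluated. -/
def Evaluates (M : Term) : Prop :=
  ∃ E, Simul {M} E ∧ ∀ M' ∈ E, M'.IsValue ∧ M'.Linear ∧ M'.fv = M.fv ∧ M'.weight ≤ M.weight

theorem Evaluates.of_isValue {M : Term} (h : M.IsValue) (h' : M.Linear) : Evaluates M :=
  ⟨{M}, .refl (Multiset.singleton_ne_zero M), fun N hN => by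
    obtain rfl := Multiset.mem_singleton.1 hN
    exact ⟨h, h', rfl, le_rfl⟩⟩

theorem Evaluates.of_fail {X : Finset ℕ} : Evaluates (.fail X) :=
  .of_isValue (.inr (.inr rfl)) (.fail X)

theorem Evaluates.of_simul {M : Term} {E : Expr} (h : Simul {M} E)
    (h' : ∀ N ∈ E, Evaluates N ∧ N.fv = M.fv ∧ N.weight ≤ M.weight) : Evaluates M := by
  obtain ⟨F, hF, hF'⟩ := Simul.bind
    (C := fun M' => M'.IsValue ∧ M'.Linear ∧ M'.fv = M.fv ∧ M'.weight ≤ M.weight) h.1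
    fun N hN => by
      obtain ⟨⟨F, hF, hF'⟩, hfv, hw⟩ := h' N hN
      refine ⟨F, hF, fun M' hM' => ?_⟩
      obtain ⟨h1, h2, h3, h4⟩ := hF' M' hM'
      exact ⟨h1, h2, h3.trans hfv, h4.trans hw⟩
  exact ⟨F, h.trans hF, hF'⟩

theorem Evaluates.of_simul_singleton {M N : Term} (h : Simul {M} {N}) (h' : Evaluates N)
    (hfv : N.fv = M.fv) (hw : N.weight ≤ M.weight) : Evaluates M :=
  .of_simul h fun M' hM' => by
    obtain rfl := Multiset.mem_singleton.1 hM'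
    exact ⟨h', hfv, hw⟩

theorem Evaluates.of_simul_fail {M : Term} {B : Bag} {X : Finset ℕ}
    (h : Simul {M} (permConst B (.fail X))) (hfv : X = M.fv) : Evaluates M :=
  .of_simul h fun N hN => by
    obtain ⟨_, _, rfl⟩ := List.mem_map.1 (Multiset.mem_coe.1 hN)
    exact ⟨.of_fail, hfv, Nat.zero_le _⟩

theorem Evaluates.lsub {n : ℕ} (ih : ∀ M : Term, M.weight < n → M.Linear → Evaluates M)
    {M N : Term} (h : (Term.lsub M N).Linear) (hw : (Term.lsub M N).weight ≤ n) :
    Evaluates (.lsub M N) := by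
  cases h with
  | lsub hM hN h0 hd =>
  rw [Term.weight] at hw
  obtain ⟨E, hE, hE'⟩ := ih M (by omega) hM
  refine .of_simul (hE.lsub N) fun K hK => ?_
  obtain ⟨M', hM', rfl⟩ := Multiset.mem_map.1 hK
  obtain ⟨hv, hl, hfv, hw'⟩ := hE' M' hM'
  refine ⟨?_, by rw [Term.fv, hfv, Term.fv], by rw [Term.weight, Term.weight]; omega⟩
  rw [← hfv] at h0 hd
  have hl' : (Term.lsub M' N).Linear := .lsub hl hN h0 hd
  rcases hv with ⟨x, hx⟩ | hv | hv
  · cases x with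
    | succ x => exact .of_isValue (.inl ⟨x, .lsub hx N⟩) hl'
    | zero =>
      have hfvs : (M'.headSubst 0 (N.shift 1)).fv = M'.fv.erase 0 ∪ (N.shift 1).fv :=
        hx.fv_headSubst hl _
      have hpos : ∀ y ∈ (M'.headSubst 0 (N.shift 1)).fv, y ≠ 0 := by
        intro y hy
        rw [hfvs, Finset.mem_union, Finset.mem_erase, mem_fv_shift] at hy
        omega
      have hinj : Set.InjOn Nat.pred (M'.headSubst 0 (N.shift 1)).fv := fun a ha b hb hab => by
        have := hpos a ha
        have := hpos b hb
        simp only [Nat.pred_eq_sub_one] at hab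
        omega
      have hdisj : Disjoint (M'.fv.erase 0) (N.shift 1).fv := by
        rw [Finset.disjoint_left]
        intro y hy hy'
        obtain ⟨hy1, hy'⟩ := mem_fv_shift.1 hy'
        refine Finset.disjoint_left.1 hd (mem_outer.2 ?_) hy'
        rw [Nat.sub_add_cancel hy1]
        exact Finset.mem_of_mem_erase hy
      have hlin := hx.linear_headSubst hl (hN.shift 1) hdisj
      have hwt := hx.weight_headSubst (N.shift 1)
      rw [Term.shift, N.weight_rename] at hwt
      refine .of_simul_singleton ((TRed.linFetch M' N hx.headVar_eq).simul_singleton fun ρ u => ?_)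
        (ih _ ?_ (hlin.rename hinj)) ?_ ?_
      · rw [Term.den_rename _ hinj (ρ := fun i => ρ (i - 1)) u fun _ _ => rfl, den_lsub]
        have e : (N.shift 1).subDen (fun i => ρ (i - 1)) = N.subDen ρ :=
          N.subDen_rename (add_left_injective 1).injOn fun y _ => by simp
        rw [← e]
        exact hx.den_headSubst hl _ u rfl fun y _ hy0 => by simp [ext, hy0]
      · rw [Term.weight_rename, Term.shift]
        omega
      · rw [Term.fv_rename, hfvs]
        ext y
        simp only [Finset.mem_image, Finset.mem_union, Finset.mem_erase, mem_fv_shift, Term.fv,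
          mem_outer]
        constructor
        · rintro ⟨z, ⟨h1, h2⟩ | ⟨h1, h2⟩, rfl⟩
          · obtain ⟨z, rfl⟩ := Nat.exists_eq_succ_of_ne_zero h1
            exact .inl h2
          · exact .inr h2
        · rintro (h | h)
          · exact ⟨y + 1, .inl ⟨by omega, h⟩, rfl⟩
          · exact ⟨y + 1, .inr ⟨by omega, h⟩, rfl⟩
      · rw [Term.weight_rename, Term.weight, Term.shift]
        omega
  · exact .of_isValue (.inr (.inl (.lsub hv N))) hl'
  · generalize M'.fv = X at hv hfv h0 hd
    subst hv
    exact .of_simul_singleton ((TRed.cons₃ X N h0).simul_singleton (den_lsub_fail h0 hd)) .of_fail rfl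
      (Nat.zero_le _)

theorem Evaluates.app {n : ℕ} (ih : ∀ M : Term, M.weight < n → M.Linear → Evaluates M)
    {M : Term} {B : Bag} (h : (Term.app M B).Linear) (hw : (Term.app M B).weight ≤ n) :
    Evaluates (.app M B) := by
  cases h with
  | app hM hB hp hd =>
  rw [Term.weight] at hw
  obtain ⟨E, hE, hE'⟩ := ih M (by omega) hM
  refine .of_simul (hE.app B) fun K hK => ?_
  obtain ⟨M', hM', rfl⟩ := Multiset.mem_map.1 hK
  obtain ⟨hv, hl, hfv, hw'⟩ := hE' M' hM'
  refine ⟨?_, by rw [Term.fv, hfv, Term.fv], by rw [Term.weight, Term.weight]; omega⟩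
  rw [← hfv] at hd
  have hl' : (Term.app M' B).Linear := .app hl hB hp hd
  rcases hv with ⟨x, hx⟩ | hv | hv
  · exact .of_isValue (.inl ⟨x, .app hx B⟩) hl'
  · cases hv with
    | lam k M =>
      cases hl with
      | lam hl hk =>
      rw [Term.weight] at hw'
      refine .of_simul_singleton ((TRed.beta k M B).simul_singleton (den_beta k M B))
        (ih _ ?_ (.esub hl hk hB hp hd)) rfl ?_
      · rw [Term.weight]
        omega
      · rw [Term.weight, Term.weight, Term.weight]
        omega
    | @lsub M hv N =>
      cases hl with
      | lsub hl hN h0 hd' =>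
      rw [Term.weight] at hw'
      rw [Term.fv, Finset.disjoint_union_left] at hd
      have hBs : Bag.Linear (Bag.shift 1 B) := by
        rw [Bag.shift, Bag.rename_eq_map]
        refine ⟨fun K hK => ?_, ?_⟩
        · obtain ⟨K, hKB, rfl⟩ := List.mem_map.1 hK
          exact (hB K hKB).shift 1
        · rw [List.pairwise_map]
          refine hp.imp fun h => ?_
          rw [Term.fv_rename, Term.fv_rename]
          exact (Finset.disjoint_image (add_left_injective 1)).2 h
      have hout : outer 1 (Term.app M (Bag.shift 1 B)).fv = outer 1 M.fv ∪ Bag.fv B := by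
        ext y
        simp [Term.fv, mem_outer, Bag.shift, Bag.fv_rename]
      refine .of_simul_singleton (Simul.appLsub M N B) (.lsub ih (.lsub (.app hl hBs.1 hBs.2 ?_) hN
        (Finset.mem_union_left _ h0) ?_) ?_) ?_ ?_
      · rw [Bag.shift, Bag.fv_rename, Finset.disjoint_left]
        intro y hy hy'
        obtain ⟨z, hz, rfl⟩ := Finset.mem_image.1 hy'
        exact Finset.disjoint_left.1 hd.1 (mem_outer.2 hy) hz
      · rw [hout, Finset.disjoint_union_left]
        exact ⟨hd', hd.2.symm⟩
      · simp only [Term.weight, Bag.shift, Bag.weight_rename]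
        omega
      · change outer 1 (Term.app M (Bag.shift 1 B)).fv ∪ N.fv = outer 1 M.fv ∪ N.fv ∪ Bag.fv B
        rw [hout, Finset.union_right_comm]
      · simp only [Term.weight, Bag.shift, Bag.weight_rename]
        omega
  · generalize M'.fv = X at hv hfv hd
    subst hv
    exact .of_simul_fail ((TRed.cons₁ X B).simul_permConst (den_app_fail hd)) rfl

theorem Evaluates.esub {n : ℕ} (ih : ∀ M : Term, M.weight < n → M.Linear → Evaluates M)
    {k : ℕ} {M : Term} {B : Bag} (h : (Term.esub k M B).Linear)
    (hw : (Term.esub k M B).weight ≤ n) : Evaluates (.esub k M B) := by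
  have h' := h
  cases h' with
  | esub hM hk hB hp hd =>
  rw [Term.weight] at hw
  by_cases hkB : k = B.length
  · by_cases hk0 : k = 0
    · subst hk0
      obtain rfl := List.length_eq_zero_iff.1 hkB.symm
      refine .of_simul_singleton ((TPre.empty M).simul fun ρ u => ?_) (ih M (by omega) hM) ?_ ?_
      · have := den_exSub (k := 0) M (B := []) rfl ρ u
        simpa [den_singleton, Term.lsubs] using this
      · rw [Term.fv, outer_zero, Bag.fv, Finset.union_empty]
      · rw [Term.weight]
        omega
    · by_cases hf : ∃ X, M = .fail X
      · obtain ⟨X, rfl⟩ := hf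
        have hX : Finset.range k ⊆ X := fun i hi => hk i (Finset.mem_range.1 hi)
        exact .of_simul_fail ((TRed.cons₂ k X B hX (by omega)).simul_permConst
          (den_esub_fail h (.inr rfl))) rfl
      · refine .of_simul ((TRed.exSub k M B (by omega) hkB.symm fun X h => hf ⟨X, h⟩).simul ?_
          (den_exSub M hkB.symm)) fun N hN => ?_
        · rw [ne_eq, Multiset.coe_eq_zero]
          exact permutations_ne_nil B _
        · obtain ⟨L, hL, rfl⟩ := List.mem_map.1 (Multiset.mem_coe.1 hN)
          have hL := List.mem_permutations.1 hL
          obtain rfl : L.length = k := hL.length_eq.trans hkB.symm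
          rw [← Bag.fv_perm hL] at hd
          obtain ⟨h1, h2⟩ := Term.linear_lsubs hM hk (Bag.Linear.perm ⟨hB, hp⟩ hL) hd
          refine ⟨ih _ ?_ h1, ?_, ?_⟩
          · rw [Term.weight_lsubs, Bag.weight_perm hL]
            omega
          · rw [h2, Term.fv, Bag.fv_perm hL]
          · rw [Term.weight_lsubs, Bag.weight_perm hL, Term.weight]
            omega
  · exact .of_simul_fail ((TRed.fail k M B hkB).simul_permConst (den_esub_fail h (.inl hkB))) rfl

theorem Term.Linear.evaluates {M : Term} (h : M.Linear) : Evaluates M := by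
  induction hn : M.weight using Nat.strong_induction_on generalizing M with
  | _ n ih =>
  have ih' : ∀ M : Term, M.weight < n → M.Linear → Evaluates M := fun M hM hl => ih _ hM hl rfl
  cases M with
  | var x => exact .of_isValue (.inl ⟨x, .var x⟩) h
  | lam k M => exact .of_isValue (.inr (.inl (.lam k M))) h
  | app M B => exact .app ih' h hn.le
  | lsub M N => exact .lsub ih' h hn.le
  | fail X => exact .of_fail
  | share k M x => cases h
  | esub k M B => exact .esub ih' h hn.le

end ShLam

namespace ShLam

open Proc.SProc
open Proc (SProc Conf Config Atom Normal)

/-! ### Values of closed expressions -/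

theorem Term.HeadLam.conf {M : Term} (h : M.HeadLam) {ρ e : ℕ → ℕ} {u : ℕ} {F : Finset ℕ}
    {c : Config} (hc : Conf (M.enc ρ u) e F c) :
    ∃ p d, c = Atom.someOut (e u) p ::ₘ d ∧ ∀ a ∈ d, ∃ x ∈ F, ∃ w q, a = Atom.someIn x w q := by
  induction h generalizing ρ e u F c with
  | lam k M =>
    rw [Term.enc] at hc
    obtain ⟨rfl, rfl⟩ := hc
    exact ⟨_, 0, rfl, by simp⟩
  | lsub h N ih =>
    rw [Term.enc] at hc
    obtain ⟨a, F', ha, rfl, F₁, F₂, c₁, c₂, -, rfl, rfl, h1, rfl, rfl⟩ := hc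
    obtain ⟨p, d, rfl, hd⟩ := ih h1
    refine ⟨p, d + {Atom.someIn a _ _}, Multiset.cons_add _ _ _, fun b hb => ?_⟩
    rcases Multiset.mem_add.1 hb with hb | hb
    · obtain ⟨x, hx, h⟩ := hd b hb
      exact ⟨x, by simp [hx], h⟩
    · obtain rfl := Multiset.mem_singleton.1 hb
      exact ⟨a, Finset.mem_insert_self _ _, _, _, rfl⟩

theorem normal_someOut {u : ℕ} {p : SProc} {d : Config} {F : Finset ℕ} (hF : Disjoint F {u})
    (hd : ∀ a ∈ d, ∃ x ∈ F, ∃ w q, a = Atom.someIn x w q) :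
    Normal {u} (Atom.someOut u p ::ₘ d) := by
  have key : ∀ a ∈ Atom.someOut u p ::ₘ d, a = Atom.someOut u p ∨
      ∃ x w q, x ≠ u ∧ a = Atom.someIn x w q := by
    intro a ha
    rcases Multiset.mem_cons.1 ha with rfl | ha
    · exact .inl rfl
    · obtain ⟨x, hx, w, q, rfl⟩ := hd a ha
      refine .inr ⟨x, w, q, ?_, rfl⟩
      rintro rfl
      simp [hx] at hF
  intro T hT
  generalize Atom.someOut u p ::ₘ d = c at key hT
  cases hT with
  | @pair x a b q r G h hA hG =>
    have ha := key a (by simp)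
    have hb := key b (by simp)
    cases h <;> simp_all
  | fwd hx h =>
    have ha := key _ (Multiset.mem_cons_self _ _)
    simp at ha

theorem normal_noneOut (u : ℕ) : Normal {u} {Atom.noneOut u} := by
  intro T hT
  generalize h : ({Atom.noneOut u} : Config) = c at hT
  cases hT with
  | pair => simpa using congrArg Multiset.card h
  | @fwd x y r =>
    have : Atom.fwd s(x, y) ∈ ({Atom.noneOut u} : Config) := h ▸ Multiset.mem_cons_self _ _
    simp at this

theorem Term.IsValue.normal {M : Term} (h : M.IsValue) (hfv : M.fv = ∅) {ρ : ℕ → ℕ} {u : ℕ}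
    {c : Config} (hc : (M.den ρ u).HasConf {u} c) : Normal {u} c := by
  obtain ⟨F, hF, hc⟩ := Proc.hasConf_cls.1 hc
  rcases h with ⟨x, hx⟩ | h | h
  · simpa [hfv] using hx.mem_fv
  · obtain ⟨p, d, rfl, hd⟩ := h.conf hc
    exact normal_someOut hF hd
  · rw [h, hfv, Term.enc, Finset.sort_empty] at hc
    obtain ⟨rfl, rfl⟩ := hc
    exact normal_noneOut u

theorem Expr.normal {E : Expr} (hE : E ≠ 0) (h : ∀ M ∈ E, M.IsValue ∧ M.fv = ∅) {ρ : ℕ → ℕ} {u : ℕ}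
    {c : Config} (hc : (E.den ρ u).HasConf {u} c) : Normal {u} c := by
  induction E, hE using multiset_induction with
  | h1 M =>
    rw [den_singleton] at hc
    obtain ⟨h1, h2⟩ := h M (Multiset.mem_singleton_self M)
    exact h1.normal h2 hc
  | h2 M E hE ih =>
    rw [← Multiset.singleton_add, den_add (Multiset.singleton_ne_zero M) hE, den_singleton] at hc
    rcases Proc.hasConf_sup.1 hc with hc | hc
    · obtain ⟨h1, h2⟩ := h M (Multiset.mem_cons_self M E)
      exact h1.normal h2 hc
    · exact ih (fun N hN => h N (Multiset.mem_cons_of_mem hN)) hc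

theorem Expr.linP {E : Expr} (hE : E ≠ 0) (h : ∀ M ∈ E, M.Linear) (hcl : E.Closed) (ρ : ℕ → ℕ)
    (u : ℕ) : Proc.LinP {u} (E.enc ρ u) := by
  have hb : OccBound (E.den ρ u) {u} := by
    refine .sups (multiset_map_ne_zero hE _) fun p hp => ?_
    obtain ⟨M, hM, rfl⟩ := Multiset.mem_map.1 hp
    have := (h M hM).occBound ρ u
    rwa [hcl M hM] at this
  rw [← Expr.cls_enc hE] at hb
  have hocc (s : Set ℕ) : (E.enc ρ u).occ s ≤ Proc.ind s u := by
    refine (hb.2 s).trans_eq ?_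
    rw [← Multiset.cons_zero, Proc.cnt_cons, Proc.cnt_zero, zero_add]
  refine Proc.lin.linP hb.1 ?_ fun a _ => (hocc {a}).trans ((ind_le_one _ _).trans one_le_two)
  exact Nat.le_zero.1 ((hocc _).trans_eq (Proc.ind_eq_zero.2 (by simp)))

end ShLam

theorem theoreml (N : ShLam.Expr) (hwf : ShLam.Expr.WellFormed N)
    (hcl : ShLam.Expr.Closed N) (ρ : ℕ → ℕ) (u : ℕ) (Q : Proc)
    (hQ : Relation.ReflTransGen Proc.Red (ShLam.Expr.enc N ρ u) Q) :
    ∃ (Q' : Proc) (N' : ShLam.Expr),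
      Relation.ReflTransGen Proc.Red Q Q' ∧
      ShLam.Expr.MultiPre N N' ∧
      Proc.SC (ShLam.Expr.enc N' ρ u) Q' := by
  obtain ⟨Γ, τ, hwf⟩ := hwf
  have hN := hwf.ne_zero
  have hl := hwf.linear hcl
  obtain ⟨N', hsim, hval⟩ := ShLam.Simul.bind hN
    (C := fun M => M.IsValue ∧ M.fv = ∅) fun M hM => by
      obtain ⟨E, hE, hE'⟩ := (hl M hM).evaluates
      exact ⟨E, hE, fun M' hM' => ⟨(hE' M' hM').1, (hE' M' hM').2.2.1.trans (hcl M hM)⟩⟩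
  obtain ⟨Q', hQ', hsc⟩ := Proc.exists_reds_of_normal (A := {u}) (N := ShLam.Expr.enc N' ρ u)
    (ShLam.Expr.linP hN hl hcl ρ u) hQ
    (by rw [ShLam.Expr.cls_enc hN, ShLam.Expr.cls_enc hsim.ne_zero]; exact hsim.reds ρ u)
    fun c hc => by
      rw [ShLam.Expr.cls_enc hsim.ne_zero] at hc
      exact ShLam.Expr.normal hsim.ne_zero hval hc
  exact ⟨Q', N', hQ', hsim.multiPre, hsc⟩
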